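/- Let $\mathbb K=\mathbb R$ or $\mathbb C$; "smooth" means $C^\infty$ if $\mathbb K=\mathbb R$ and holomorphic if $\mathbb K=\mathbb C$. A surface in $\mathbb P^3(\mathbb K)$ given by a lift $F:V\to\mathbb K^4$ is called a quadric if its image is contained in the zero locus of a nondegenerate quadratic form on $\mathbb K^4$. For $\alpha,\beta_1,\beta_2,\gamma_1,\gamma_2\in\mathbb K$ let $S_{F_2}$ be a surface $(x,y)\mapsto[F_0:F_1:F_2:F_3]$, where $F_0,\dots,F_3$ are smooth, linearly independent solutions, on a connected nonempty open subset $V$ of $\{xy(1-x)(1-y)(1-x-y)\neq0\}\subset\mathbb K^2$, of $$x(1-x)F_{xx}-xyF_{xy}+(\gamma_1-(\alpha+\beta_1+1)x)F_x-\beta_1yF_y-\alpha\beta_1F=0,$$ $$y(1-y)F_{yy}-xyF_{xy}+(\gamma_2-(\alpha+\beta_2+1)y)F_y-\beta_2xF_x-\alpha\beta_2F=0.$$ For $\alpha,\beta,\gamma_1,\gamma_2\in\mathbb K$ let $S_{F_4}$ be defined in the same way by smooth, linearly independent solutions, on a connected nonempty open subset $V$ of $\{xy((1-x-y)^2-4xy)\ne0\}$,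 of $$x(x+y-1)F_{xx}+2xyF_{xy}+((\alpha+\beta+1)x+\gamma_1(y-1))F_x+y(\alpha+\beta-\gamma_2+1)F_y+\alpha\beta F=0,$$ $$y(x+y-1)F_{yy}+2xyF_{xy}+x(\alpha+\beta-\gamma_1+1)F_x+((\alpha+\beta+1)y+\gamma_2(x-1))F_y+\alpha\beta F=0.$$ Introduce coordinates $(s,t)$ on $S_{F_2}$ by $(x,y)=\left(\frac1s,1-\frac ts\right)$ and on $S_{F_4}$ by $(x,y)=\left(\frac1{(s+t)^2},\frac{(s-t)^2}{(s+t)^2}\right)$. Let $S=S_{F_2}$ or $S=S_{F_4}$, let $U$ be a connected nonempty open set of the $(s,t)$-plane that is mapped into $V$, let $f$ be a nowhere vanishing smooth function on $U$, and let $z(s,t)=f(s,t)\,F(x(s,t),y(s,t))$. Then: 1. $S_{F_2}$ is a quadric if and only if $\alpha=\beta_1+\beta_2-\tfrac12$, $\gamma_1=2\beta_1$ and $\gamma_2=2\beta_2$. $S_{F_4}$ is a quadric if and only if $\gamma_2=\alpha+\beta-\gamma_1+1$. 2. The coordinates $(s,t)$ are conjugate: $z,z_s,z_t,z_{ss}$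 are linearly independent at every point of $U$ and there are (necessarily unique) smooth functions $a,b,c,q,m,n,r$ on $U$, $q$ nowhere zero, with $$z_{st}+az_s+bz_t+cz=0,\qquad z_{tt}+qz_{ss}+mz_s+nz_t+rz=0 .$$ 3. Let $\mathsf h=ab+a_s-c$ and $\mathsf k=ab+b_t-c$ be the Laplace invariants, and let $S^+$ and $S^-$ be given by the Laplace transforms $z^+=z_t+az$ and $z^-=z_s+bz$. If both focal surfaces $S,S^+$ of the congruence $\mathbf L^+=\{S,S^+\}$ are quadrics, then $\mathsf h\equiv0$ on $U$. If both focal surfaces $S,S^-$ of the congruence $\mathbf L^-=\{S,S^-\}$ are quadrics, then $\mathsf k\equiv0$ on $U$. -/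

import Mathlib

open scoped ContDiff

namespace HypergeometricCongruence

section

variable {𝕜 : Type*} [RCLike 𝕜] {E : Type*} [NormedAddCommGroup E] [NormedSpace 𝕜 E]

/-- Partial derivative with respect to the first coordinate. -/
noncomputable def pd₁ (f : 𝕜 × 𝕜 → E) (p : 𝕜 × 𝕜) : E := fderiv 𝕜 f p (1, 0)

/-- Partial derivative with respect to the second coordinate. -/
noncomputable def pd₂ (f : 𝕜 × 𝕜 → E) (p : 𝕜 × 𝕜) : E := fderiv 𝕜 f p (0, 1)

/-- The linear system annihilating Appell's `F₂`, for a function `F` of `p = (x, y)` (scalar, or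
vector valued: then each component is a solution). -/
def SolvesAppellF₂ (α β₁ β₂ γ₁ γ₂ : 𝕜) (V : Set (𝕜 × 𝕜)) (F : 𝕜 × 𝕜 → E) : Prop :=
  ∀ p ∈ V,
    (p.1 * (1 - p.1)) • pd₁ (pd₁ F) p - (p.1 * p.2) • pd₂ (pd₁ F) p
        + (γ₁ - (α + β₁ + 1) * p.1) • pd₁ F p - (β₁ * p.2) • pd₂ F p - (α * β₁) • F p = 0 ∧
    (p.2 * (1 - p.2)) • pd₂ (pd₂ F) p - (p.1 * p.2) • pd₂ (pd₁ F) p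
        + (γ₂ - (α + β₂ + 1) * p.2) • pd₂ F p - (β₂ * p.1) • pd₁ F p - (α * β₂) • F p = 0

/-- The linear system annihilating Appell's `F₄`, for a function `F` of `p = (x, y)`. -/
def SolvesAppellF₄ (α β γ₁ γ₂ : 𝕜) (V : Set (𝕜 × 𝕜)) (F : 𝕜 × 𝕜 → E) : Prop :=
  ∀ p ∈ V,
    (p.1 * (p.1 + p.2 - 1)) • pd₁ (pd₁ F) p + (2 * p.1 * p.2) • pd₂ (pd₁ F) p
        + ((α + β + 1) * p.1 + γ₁ * (p.2 - 1)) • pd₁ F p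
        + (p.2 * (α + β - γ₂ + 1)) • pd₂ F p + (α * β) • F p = 0 ∧
    (p.2 * (p.1 + p.2 - 1)) • pd₂ (pd₂ F) p + (2 * p.1 * p.2) • pd₂ (pd₁ F) p
        + (p.1 * (α + β - γ₁ + 1)) • pd₁ F p
        + ((α + β + 1) * p.2 + γ₂ * (p.1 - 1)) • pd₂ F p + (α * β) • F p = 0

/-- The complement of the singular locus `x y (1 - x) (1 - y) (1 - x - y) = 0` of the
`F₂` system. -/
def regularF₂ (𝕜 : Type*) [RCLike 𝕜] : Set (𝕜 × 𝕜) :=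
  {p | p.1 ≠ 0 ∧ p.2 ≠ 0 ∧ 1 - p.1 ≠ 0 ∧ 1 - p.2 ≠ 0 ∧ 1 - p.1 - p.2 ≠ 0}

/-- The complement of the singular locus `x y ((1 - x - y)² - 4 x y) = 0` of the `F₄` system. -/
def regularF₄ (𝕜 : Type*) [RCLike 𝕜] : Set (𝕜 × 𝕜) :=
  {p | p.1 ≠ 0 ∧ p.2 ≠ 0 ∧ (1 - p.1 - p.2) ^ 2 - 4 * p.1 * p.2 ≠ 0}

/-- `F : V → 𝕜⁴` is the local lift of an immersion `p ↦ [F₀ : F₁ : F₂ : F₃]` defined by a rank-4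
linear system: the domain is a connected open set avoiding the singular locus, and the four
components are smooth (`C^∞` if `𝕜 = ℝ`, holomorphic if `𝕜 = ℂ`) and linearly independent as
functions on `V`. -/
structure IsLocalLift (reg V : Set (𝕜 × 𝕜)) (F : 𝕜 × 𝕜 → (Fin 4 → 𝕜)) : Prop where
  isOpen : IsOpen V
  isConnected : IsConnected V
  subset_regular : V ⊆ reg
  smooth : ContDiffOn 𝕜 ∞ F V
  independent : LinearIndependent 𝕜 (fun (i : Fin 4) (p : V) => F p i)

/-- `F : V → 𝕜⁴` parametrizes (a piece of) the surface `S_{F₂} ⊂ ℙ³`: its components are four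
linearly independent local solutions of the `F₂` system. -/
def IsSurfaceF₂ (α β₁ β₂ γ₁ γ₂ : 𝕜) (V : Set (𝕜 × 𝕜)) (F : 𝕜 × 𝕜 → (Fin 4 → 𝕜)) : Prop :=
  IsLocalLift (regularF₂ 𝕜) V F ∧ SolvesAppellF₂ α β₁ β₂ γ₁ γ₂ V F

/-- `F : V → 𝕜⁴` parametrizes (a piece of) the surface `S_{F₄} ⊂ ℙ³`. -/
def IsSurfaceF₄ (α β γ₁ γ₂ : 𝕜) (V : Set (𝕜 × 𝕜)) (F : 𝕜 × 𝕜 → (Fin 4 → 𝕜)) : Prop :=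
  IsLocalLift (regularF₄ 𝕜) V F ∧ SolvesAppellF₄ α β γ₁ γ₂ V F

/-- The image of `[z] : U → ℙ³` is contained in a quadric surface, the zero locus of a
nondegenerate quadratic form `X ↦ Xᵀ M X`. -/
def IsQuadricOn (U : Set (𝕜 × 𝕜)) (z : 𝕜 × 𝕜 → (Fin 4 → 𝕜)) : Prop :=
  ∃ M : Matrix (Fin 4) (Fin 4) 𝕜, M.IsSymm ∧ M.det ≠ 0 ∧
    ∀ p ∈ U, z p ⬝ᵥ M.mulVec (z p) = 0

/-- The map `T₂`, `(x, y) = (1/s, 1 - t/s)`, giving conjugate coordinates `(s, t)` on `S_{F₂}`. -/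
noncomputable def T₂ (p : 𝕜 × 𝕜) : 𝕜 × 𝕜 := (1 / p.1, 1 - p.2 / p.1)

/-- The map `T₄`, `(x, y) = (1/(s+t)², (s-t)²/(s+t)²)`, giving conjugate coordinates `(s, t)`
on `S_{F₄}`. -/
noncomputable def T₄ (p : 𝕜 × 𝕜) : 𝕜 × 𝕜 :=
  (1 / (p.1 + p.2) ^ 2, (p.1 - p.2) ^ 2 / (p.1 + p.2) ^ 2)

/-- Coefficient functions of a rank-4 system in conjugate coordinates. -/
structure ConjugateCoeffs (𝕜 : Type*) where
  (a b c q m n r : 𝕜 × 𝕜 → 𝕜)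

/-- The lift `z` satisfies on `U` the rank-4 conjugate system
`z_st + a z_s + b z_t + c z = 0`, `z_tt + q z_ss + m z_s + n z_t + r z = 0` with smooth
coefficients, frame `(z, z_s, z_t, z_ss)`, and nondegenerate second fundamental form
`ds² - q dt²`. The coefficients are determined by `z` because of the frame condition. -/
structure IsConjugateSystem (U : Set (𝕜 × 𝕜)) (z : 𝕜 × 𝕜 → (Fin 4 → 𝕜))
    (C : ConjugateCoeffs 𝕜) : Prop where
  smooth_a : ContDiffOn 𝕜 ∞ C.a U
  smooth_b : ContDiffOn 𝕜 ∞ C.b U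
  smooth_c : ContDiffOn 𝕜 ∞ C.c U
  smooth_q : ContDiffOn 𝕜 ∞ C.q U
  smooth_m : ContDiffOn 𝕜 ∞ C.m U
  smooth_n : ContDiffOn 𝕜 ∞ C.n U
  smooth_r : ContDiffOn 𝕜 ∞ C.r U
  q_ne_zero : ∀ p ∈ U, C.q p ≠ 0
  frame : ∀ p ∈ U, LinearIndependent 𝕜 ![z p, pd₁ z p, pd₂ z p, pd₁ (pd₁ z) p]
  hyperbolic : ∀ p ∈ U,
    pd₂ (pd₁ z) p + C.a p • pd₁ z p + C.b p • pd₂ z p + C.c p • z p = 0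
  second : ∀ p ∈ U,
    pd₂ (pd₂ z) p + C.q p • pd₁ (pd₁ z) p + C.m p • pd₁ z p + C.n p • pd₂ z p + C.r p • z p = 0

/-- The positive Laplace invariant `h = a b + a_s - c`. -/
noncomputable def ConjugateCoeffs.h (C : ConjugateCoeffs 𝕜) (p : 𝕜 × 𝕜) : 𝕜 :=
  C.a p * C.b p + pd₁ C.a p - C.c p

/-- The negative Laplace invariant `k = a b + b_t - c`. -/
noncomputable def ConjugateCoeffs.k (C : ConjugateCoeffs 𝕜) (p : 𝕜 × 𝕜) : 𝕜 :=
  C.a p * C.b p + pd₂ C.b p - C.c p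

/-- The positive Laplace transform `z⁺ = z_t + a z`, the second focal surface of the congruence of
tangent lines to the `t`-curves of the surface `z`. -/
noncomputable def laplacePos (C : ConjugateCoeffs 𝕜) (z : 𝕜 × 𝕜 → (Fin 4 → 𝕜)) (p : 𝕜 × 𝕜) :
    Fin 4 → 𝕜 :=
  pd₂ z p + C.a p • z p

/-- The negative Laplace transform `z⁻ = z_s + b z`, the second focal surface of the congruence of
tangent lines to the `s`-curves of the surface `z`. -/
noncomputable def laplaceNeg (C : ConjugateCoeffs 𝕜) (z : 𝕜 × 𝕜 → (Fin 4 → 𝕜)) (p : 𝕜 × 𝕜) :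
    Fin 4 → 𝕜 :=
  pd₁ z p + C.b p • z p

/-- Both focal surfaces `S`, `S⁺` of the positive Laplace congruence are quadrics. -/
def PosFocalQuadrics (U : Set (𝕜 × 𝕜)) (z : 𝕜 × 𝕜 → (Fin 4 → 𝕜)) (C : ConjugateCoeffs 𝕜) : Prop :=
  IsQuadricOn U z ∧ IsQuadricOn U (laplacePos C z)

/-- Both focal surfaces `S`, `S⁻` of the negative Laplace congruence are quadrics. -/
def NegFocalQuadrics (U : Set (𝕜 × 𝕜)) (z : 𝕜 × 𝕜 → (Fin 4 → 𝕜)) (C : ConjugateCoeffs 𝕜) : Prop :=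
  IsQuadricOn U z ∧ IsQuadricOn U (laplaceNeg C z)

/-- `z` is a lift on `U`, in the coordinates `(s, t)` given by `T`, of the surface with lift `F`
on `V`; the nonvanishing factor `f` is a projective gauge transformation. -/
structure IsGaugedPullback (T : 𝕜 × 𝕜 → 𝕜 × 𝕜) (V : Set (𝕜 × 𝕜)) (F : 𝕜 × 𝕜 → (Fin 4 → 𝕜))
    (U : Set (𝕜 × 𝕜)) (z : 𝕜 × 𝕜 → (Fin 4 → 𝕜)) : Prop where
  isOpen : IsOpen U
  isConnected : IsConnected U
  mapsTo : Set.MapsTo T U V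
  gauge : ∃ f : 𝕜 × 𝕜 → 𝕜, ContDiffOn 𝕜 ∞ f U ∧ (∀ p ∈ U, f p ≠ 0) ∧
    ∀ p ∈ U, z p = f p • F (T p)

end

end HypergeometricCongruence

open HypergeometricCongruence

/-! Each Appell system is equivalent to a total differential system `∂₁y = P y`, `∂₂y = Q y` for a
frame of four vectors. Grönwall's inequality along segments gives unique continuation, so four
independent solutions have a nowhere vanishing Wronskian (`IsTotalSystem.linearIndependent`). This
yields the frame condition; the conjugate equations themselves are the Appell equations after an
explicit change of variables.

If a surface lies on a quadric with bilinear form B, repeated differentiation of B(z, z) = 0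
overdetermines the Gram matrix of the frame. For a conjugate net, A = B(z_s, z_s) has logarithmic
derivatives -(2b + q_s/q) and -2a, and m is determined by b and q (`IsConj.quadric_metric`). For F₂
this forces the parameter conditions; for F₄ the analogous computation is made in (x, y).
Conversely, under these conditions an explicit field N of nondegenerate symmetric matrices with N₀₀
= 0 is preserved up to scale by the system, and unique continuation makes it proportional to the
Gram matrix of a constant form (`IsTotalSystem.isQuadricOn`).

For the congruences, q is a function of s times a function of t in both cases. Compatibility of the
equations for A then gives a_s = b_t when S is a quadric. If S⁺ lies on a quadric with form B⁺ as
well, then where h ≠ 0 the function B⁺(z, z) also has explicit logarithmic derivatives, one of them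
containing h_s/h, and their compatibility leaves (log h)_st = 0 (`IsConj.laplaceInv_log`). But h
equals c/(s-t)² for F₂ and P/(s+t)² + R/(s-t)² for F₄, and such a function violates this unless it
vanishes. Exchanging s and t gives the statement for k, and gauge invariance of h and k passes from
F itself to an arbitrary lift. -/

namespace HypergeometricCongruence

/-! ### Calculus of functions of two variables over ℝ or ℂ. -/

section Calculus

variable {𝕜 : Type*} [RCLike 𝕜] {E : Type*} [NormedAddCommGroup E] [NormedSpace 𝕜 E]
  {G : Type*} [NormedAddCommGroup G] [NormedSpace 𝕜 G] {H : Type*} [NormedAddCommGroup H]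
  [NormedSpace 𝕜 H]

/-- Directional derivative. -/
noncomputable def dd (v : 𝕜 × 𝕜) (f : 𝕜 × 𝕜 → E) (p : 𝕜 × 𝕜) : E := fderiv 𝕜 f p v

/-- `f` is differentiable at `p` with derivatives `fv` and `fw` in the directions `v` and `w`. -/
structure HasPD (v w : 𝕜 × 𝕜) (f : 𝕜 × 𝕜 → E) (p : 𝕜 × 𝕜) (fv fw : E) : Prop where
  diff : DifferentiableAt 𝕜 f p
  fst : dd v f p = fv
  snd : dd w f p = fw

variable {v w p : 𝕜 × 𝕜} {f g : 𝕜 × 𝕜 → E} {fv fw gv gw : E} {φ ψ : 𝕜 × 𝕜 → 𝕜} {φv φw ψv ψw : 𝕜}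
  {U : Set (𝕜 × 𝕜)}

theorem HasPD.of_diff (h : DifferentiableAt 𝕜 f p) : HasPD v w f p (dd v f p) (dd w f p) :=
  ⟨h, rfl, rfl⟩

theorem HasPD.congr (h : HasPD v w f p fv fw) (h₁ : fv = gv) (h₂ : fw = gw) :
    HasPD v w f p gv gw := h₁ ▸ h₂ ▸ h

theorem HasPD.congr_fun (h : HasPD v w f p fv fw) (hU : IsOpen U) (hp : p ∈ U)
    (hfg : ∀ p ∈ U, f p = g p) : HasPD v w g p fv fw := by
  have he : g =ᶠ[nhds p] f := by
    filter_upwards [hU.mem_nhds hp] with x hx using (hfg x hx).symm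
  refine ⟨he.differentiableAt_iff.2 h.diff, ?_, ?_⟩
  · rw [dd, he.fderiv_eq]; exact h.fst
  · rw [dd, he.fderiv_eq]; exact h.snd

theorem HasPD.unique (h : HasPD v w f p fv fw) (h' : HasPD v w f p gv gw) : fv = gv ∧ fw = gw :=
  ⟨h.fst.symm.trans h'.fst, h.snd.symm.trans h'.snd⟩

theorem HasPD.const (c : E) : HasPD v w (fun _ => c) p 0 0 :=
  ⟨differentiableAt_const c, by simp [dd], by simp [dd]⟩

theorem HasPD.add (hf : HasPD v w f p fv fw) (hg : HasPD v w g p gv gw) :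
    HasPD v w (fun p => f p + g p) p (fv + gv) (fw + gw) := by
  refine ⟨hf.diff.add hg.diff, ?_, ?_⟩
  · rw [← hf.fst, ← hg.fst, dd, fderiv_fun_add hf.diff hg.diff]; rfl
  · rw [← hf.snd, ← hg.snd, dd, fderiv_fun_add hf.diff hg.diff]; rfl

theorem HasPD.neg (hf : HasPD v w f p fv fw) : HasPD v w (fun p => - f p) p (-fv) (-fw) := by
  refine ⟨hf.diff.neg, ?_, ?_⟩
  · rw [← hf.fst, dd, fderiv_fun_neg]; rfl
  · rw [← hf.snd, dd, fderiv_fun_neg]; rfl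

theorem HasPD.sub (hf : HasPD v w f p fv fw) (hg : HasPD v w g p gv gw) :
    HasPD v w (fun p => f p - g p) p (fv - gv) (fw - gw) := by
  simpa only [sub_eq_add_neg] using hf.add hg.neg

theorem HasPD.smul (hφ : HasPD v w φ p φv φw) (hg : HasPD v w g p gv gw) :
    HasPD v w (fun p => φ p • g p) p (φv • g p + φ p • gv) (φw • g p + φ p • gw) := by
  refine ⟨hφ.diff.smul hg.diff, ?_, ?_⟩
  · rw [← hφ.fst, ← hg.fst, dd, fderiv_fun_smul hφ.diff hg.diff]; simp [dd, add_comm]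
  · rw [← hφ.snd, ← hg.snd, dd, fderiv_fun_smul hφ.diff hg.diff]; simp [dd, add_comm]

theorem HasPD.mul (hφ : HasPD v w φ p φv φw) (hψ : HasPD v w ψ p ψv ψw) :
    HasPD v w (fun p => φ p * ψ p) p (φv * ψ p + φ p * ψv) (φw * ψ p + φ p * ψw) := hφ.smul hψ

theorem HasPD.inv (hφ : HasPD v w φ p φv φw) (h0 : φ p ≠ 0) :
    HasPD v w (fun p => (φ p)⁻¹) p (-φv / φ p ^ 2) (-φw / φ p ^ 2) := by
  have h := (hasDerivAt_inv h0).comp_hasFDerivAt p hφ.diff.hasFDerivAt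
  refine ⟨h.differentiableAt, ?_, ?_⟩
  · rw [← hφ.fst, dd]
    refine (congrArg (fun T => T v) h.fderiv).trans ?_
    simp [dd]; field_simp
  · rw [← hφ.snd, dd]
    refine (congrArg (fun T => T w) h.fderiv).trans ?_
    simp [dd]; field_simp

theorem HasPD.div (hφ : HasPD v w φ p φv φw) (hψ : HasPD v w ψ p ψv ψw) (h0 : ψ p ≠ 0) :
    HasPD v w (fun p => φ p / ψ p) p ((φv * ψ p - φ p * ψv) / ψ p ^ 2)
      ((φw * ψ p - φ p * ψw) / ψ p ^ 2) := by
  simp only [div_eq_mul_inv (φ _)]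
  refine (hφ.mul (hψ.inv h0)).congr ?_ ?_ <;> field_simp <;> ring

theorem HasPD.bilin (B : E →L[𝕜] G →L[𝕜] H) {g : 𝕜 × 𝕜 → G} {gv gw : G}
    (hf : HasPD v w f p fv fw) (hg : HasPD v w g p gv gw) :
    HasPD v w (fun p => B (f p) (g p)) p (B fv (g p) + B (f p) gv) (B fw (g p) + B (f p) gw) := by
  have h := B.hasFDerivAt_of_bilinear hf.diff.hasFDerivAt hg.diff.hasFDerivAt
  refine ⟨h.differentiableAt, ?_, ?_⟩
  · rw [← hf.fst, ← hg.fst, dd, h.fderiv]; simp [dd, add_comm]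
  · rw [← hf.snd, ← hg.snd, dd, h.fderiv]; simp [dd, add_comm]

theorem HasPD.clm (L : E →L[𝕜] G) (hf : HasPD v w f p fv fw) :
    HasPD v w (fun p => L (f p)) p (L fv) (L fw) := by
  have h := L.hasFDerivAt.comp p hf.diff.hasFDerivAt
  refine ⟨h.differentiableAt, ?_, ?_⟩
  · rw [← hf.fst]; exact congrArg (fun T => T v) h.fderiv
  · rw [← hf.snd]; exact congrArg (fun T => T w) h.fderiv

theorem HasPD.x : HasPD (1, 0) (0, 1) (fun p : 𝕜 × 𝕜 => p.1) p 1 0 :=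
  ⟨differentiableAt_fst, by rw [dd, fderiv_fst]; rfl, by rw [dd, fderiv_fst]; rfl⟩

theorem HasPD.y : HasPD (1, 0) (0, 1) (fun p : 𝕜 × 𝕜 => p.2) p 0 1 :=
  ⟨differentiableAt_snd, by rw [dd, fderiv_snd]; rfl, by rw [dd, fderiv_snd]; rfl⟩

/-- Chain rule for the composition with a map of the plane. -/
theorem HasPD.comp {X Y : 𝕜 × 𝕜 → 𝕜} {Xv Xw Yv Yw : 𝕜} {f₁ f₂ : E}
    (hf : HasPD (1, 0) (0, 1) f (X p, Y p) f₁ f₂)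
    (hX : HasPD v w X p Xv Xw) (hY : HasPD v w Y p Yv Yw) :
    HasPD v w (fun p => f (X p, Y p)) p (Xv • f₁ + Yv • f₂) (Xw • f₁ + Yw • f₂) := by
  have h := hf.diff.hasFDerivAt.comp p (hX.diff.hasFDerivAt.prodMk hY.diff.hasFDerivAt)
  have key : ∀ a b : 𝕜, fderiv 𝕜 f (X p, Y p) (a, b) = a • f₁ + b • f₂ := fun a b => by
    have : ((a, b) : 𝕜 × 𝕜) = a • (1, 0) + b • (0, 1) := by simp
    rw [this, map_add, map_smul, map_smul, ← hf.fst, ← hf.snd]; rfl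
  refine ⟨h.differentiableAt, ?_, ?_⟩
  · rw [← hX.fst, ← hY.fst, ← key]; exact congrArg (fun T => T v) h.fderiv
  · rw [← hX.snd, ← hY.snd, ← key]; exact congrArg (fun T => T w) h.fderiv

theorem diffAt_of_smooth (hU : IsOpen U) (hf : ContDiffOn 𝕜 ∞ f U) (hp : p ∈ U) :
    DifferentiableAt 𝕜 f p :=
  (hf.contDiffAt (hU.mem_nhds hp)).differentiableAt (by simp)

theorem HasPD.of_smooth (hU : IsOpen U) (hf : ContDiffOn 𝕜 ∞ f U) (hp : p ∈ U) :
    HasPD v w f p (dd v f p) (dd w f p) := .of_diff (diffAt_of_smooth hU hf hp)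

theorem dd_smooth (hU : IsOpen U) (hf : ContDiffOn 𝕜 ∞ f U) : ContDiffOn 𝕜 ∞ (dd v f) U :=
  (hf.fderiv_of_isOpen (m := ∞) hU (by simp)).clm_apply contDiffOn_const

theorem pd₁_smooth (hU : IsOpen U) (hf : ContDiffOn 𝕜 ∞ f U) : ContDiffOn 𝕜 ∞ (pd₁ f) U :=
  dd_smooth hU hf

theorem pd₂_smooth (hU : IsOpen U) (hf : ContDiffOn 𝕜 ∞ f U) : ContDiffOn 𝕜 ∞ (pd₂ f) U :=
  dd_smooth hU hf

theorem dd_comm (hU : IsOpen U) (hf : ContDiffOn 𝕜 ∞ f U) (hp : p ∈ U) :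
    dd v (dd w f) p = dd w (dd v f) p := by
  have hf' := hf.contDiffAt (hU.mem_nhds hp)
  have hs : IsSymmSndFDerivAt 𝕜 f p := hf'.isSymmSndFDerivAt (by
    rw [minSmoothness_of_isRCLikeNormedField]; exact WithTop.coe_le_coe.2 le_top)
  have hd : DifferentiableAt 𝕜 (fderiv 𝕜 f) p :=
    diffAt_of_smooth hU (hf.fderiv_of_isOpen (m := ∞) hU (by simp)) hp
  have key : ∀ a b : 𝕜 × 𝕜, dd a (dd b f) p = fderiv 𝕜 (fderiv 𝕜 f) p a b := fun a b => by
    have := (hd.hasFDerivAt.clm_apply (hasFDerivAt_const b p)).fderiv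
    change fderiv 𝕜 (fun q => fderiv 𝕜 f q b) p a = _
    rw [this]; simp
  rw [key, key]; exact hs _ _

theorem pd_comm (hU : IsOpen U) (hf : ContDiffOn 𝕜 ∞ f U) (hp : p ∈ U) :
    pd₁ (pd₂ f) p = pd₂ (pd₁ f) p := dd_comm hU hf hp

theorem HasPD.of_smooth' (hU : IsOpen U) (hf : ContDiffOn 𝕜 ∞ f U) (hp : p ∈ U) :
    HasPD (1, 0) (0, 1) f p (pd₁ f p) (pd₂ f p) := .of_smooth hU hf hp

/-- Derivatives of two functions that agree on an open set. -/
theorem HasPD.eq_of_eqOn (hU : IsOpen U) (hp : p ∈ U) (hfg : ∀ p ∈ U, f p = g p)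
    (hf : HasPD v w f p fv fw) (hg : HasPD v w g p gv gw) : fv = gv ∧ fw = gw :=
  (hf.congr_fun hU hp hfg).unique hg

theorem pd₁_congr (hU : IsOpen U) (hp : p ∈ U) (hfg : ∀ p ∈ U, f p = g p) :
    pd₁ f p = pd₁ g p := by
  have he : f =ᶠ[nhds p] g := by
    filter_upwards [hU.mem_nhds hp] with x hx using hfg x hx
  simp only [pd₁, he.fderiv_eq]

theorem pd₂_congr (hU : IsOpen U) (hp : p ∈ U) (hfg : ∀ p ∈ U, f p = g p) :
    pd₂ f p = pd₂ g p := by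
  have he : f =ᶠ[nhds p] g := by
    filter_upwards [hU.mem_nhds hp] with x hx using hfg x hx
  simp only [pd₂, he.fderiv_eq]

end Calculus

/-! ### Unique continuation for linear total differential systems. -/

section Uniqueness

variable {𝕜 : Type*} [RCLike 𝕜] {E : Type*} [NormedAddCommGroup E] [NormedSpace 𝕜 E]

theorem norm_fderiv_apply_le (f : 𝕜 × 𝕜 → E) (p v : 𝕜 × 𝕜) :
    ‖fderiv 𝕜 f p v‖ ≤ (‖pd₁ f p‖ + ‖pd₂ f p‖) * ‖v‖ := by
  have : v = v.1 • (1, 0) + v.2 • (0, 1) := by simp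
  rw [this, map_add, map_smul, map_smul, ← this]
  refine (norm_add_le _ _).trans ?_
  rw [norm_smul, norm_smul, add_mul, mul_comm ‖v.1‖, mul_comm ‖v.2‖]
  exact add_le_add (mul_le_mul_of_nonneg_left (norm_fst_le v) (norm_nonneg _))
    (mul_le_mul_of_nonneg_left (norm_snd_le v) (norm_nonneg _))

/-- A solution of a linear total differential inequality vanishing at one end of a segment
vanishes at the other end. -/
theorem eq_zero_of_segment [NormedSpace ℝ E] [IsScalarTower ℝ 𝕜 E] {Y : 𝕜 × 𝕜 → E} {p q : 𝕜 × 𝕜}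
    {K : ℝ} {B : Set (𝕜 × 𝕜)} (hB : Convex ℝ B) (hp : p ∈ B) (hq : q ∈ B)
    (hY : ∀ x ∈ B, DifferentiableAt 𝕜 Y x)
    (hK : ∀ x ∈ B, ‖pd₁ Y x‖ + ‖pd₂ Y x‖ ≤ K * ‖Y x‖) (h0 : Y p = 0) : Y q = 0 := by
  -- Restriction to a real segment treats the real and the holomorphic case together: Grönwall's
  -- inequality is applied to a function of one real variable.
  set γ : ℝ → 𝕜 × 𝕜 := fun τ => p + τ • (q - p) with hγ
  have hmem : ∀ τ ∈ Set.Icc (0 : ℝ) 1, γ τ ∈ B := fun τ hτ =>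
    hB.add_smul_sub_mem hp hq hτ
  have hγd : ∀ τ, HasDerivAt γ (q - p) τ := fun τ => by
    have := ((hasDerivAt_id τ).smul_const (q - p)).const_add p
    rw [one_smul] at this
    exact this
  have hd : ∀ τ ∈ Set.Icc (0 : ℝ) 1,
      HasDerivAt (fun τ => Y (γ τ)) (fderiv 𝕜 Y (γ τ) (q - p)) τ := fun τ hτ => by
    exact ((hY _ (hmem τ hτ)).hasFDerivAt.restrictScalars ℝ).comp_hasDerivAt τ (hγd τ)
  have := eq_zero_of_abs_deriv_le_mul_abs_self_of_eq_zero_right (f := fun τ => Y (γ τ))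
    (f' := fun τ => fderiv 𝕜 Y (γ τ) (q - p)) (K := K * ‖q - p‖) (a := 0) (b := 1)
    (fun τ hτ => (hd τ hτ).continuousAt.continuousWithinAt)
    (fun τ hτ => (hd τ (Set.Ico_subset_Icc_self hτ)).hasDerivWithinAt) (by simp [hγ, h0])
    (fun τ hτ => by
      refine (norm_fderiv_apply_le _ _ _).trans ?_
      calc _ ≤ (K * ‖Y (γ τ)‖) * ‖q - p‖ :=
            mul_le_mul_of_nonneg_right (hK _ (hmem τ (Set.Ico_subset_Icc_self hτ)))
              (norm_nonneg _)
        _ = _ := by ring)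
    1 (by simp)
  simpa [hγ] using this

/-- Unique continuation for linear total differential systems. -/
theorem eq_zero_of_total_system [NormedSpace ℝ E] [IsScalarTower ℝ 𝕜 E] {Y : 𝕜 × 𝕜 → E}
    {U : Set (𝕜 × 𝕜)} (hU : IsOpen U) (hc : IsPreconnected U) {κ : 𝕜 × 𝕜 → ℝ}
    (hκ : ContinuousOn κ U) (hY : ∀ x ∈ U, DifferentiableAt 𝕜 Y x)
    (hK : ∀ x ∈ U, ‖pd₁ Y x‖ + ‖pd₂ Y x‖ ≤ κ x * ‖Y x‖) {p₀ : 𝕜 × 𝕜} (hp₀ : p₀ ∈ U)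
    (h0 : Y p₀ = 0) : ∀ p ∈ U, Y p = 0 := by
  -- The zero `q` may be any point of the ball, not only its centre; this makes the interior of the
  -- zero set relatively closed in `U`.
  have hball : ∀ p ∈ U, ∃ r > 0, ∀ q ∈ Metric.ball p r, Y q = 0 →
      ∀ x ∈ Metric.ball p r, Y x = 0 := by
    intro p hp
    have h1 : ∀ᶠ x in nhds p, κ x < κ p + 1 :=
      ((hκ.continuousAt (hU.mem_nhds hp)).eventually_lt continuousAt_const (by simp))
    obtain ⟨r, hr, hr'⟩ := Metric.eventually_nhds_iff_ball.1 (h1.and (hU.mem_nhds hp))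
    refine ⟨r, hr, fun q hq hq0 x hx => ?_⟩
    refine eq_zero_of_segment (K := κ p + 1) (convex_ball p r) hq hx
      (fun y hy => hY y (hr' y hy).2) (fun y hy => (hK y (hr' y hy).2).trans ?_) hq0
    exact mul_le_mul_of_nonneg_right (hr' y hy).1.le (norm_nonneg _)
  have hsub : U ⊆ interior {p | Y p = 0} := by
    refine hc.subset_of_closure_inter_subset isOpen_interior ⟨p₀, hp₀, ?_⟩ ?_
    · obtain ⟨r, hr, h⟩ := hball p₀ hp₀
      exact mem_interior.2 ⟨_, h p₀ (Metric.mem_ball_self hr) h0, Metric.isOpen_ball,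
        Metric.mem_ball_self hr⟩
    · rintro p ⟨hp, hpU⟩
      obtain ⟨r, hr, h⟩ := hball p hpU
      obtain ⟨q, hq, hqi⟩ := mem_closure_iff.1 hp _ Metric.isOpen_ball (Metric.mem_ball_self hr)
      exact mem_interior.2 ⟨_, h q hq (interior_subset (s := {p | Y p = 0}) hqi), Metric.isOpen_ball,
        Metric.mem_ball_self hr⟩
  exact fun p hp => interior_subset (s := {p | Y p = 0}) (hsub hp)

end Uniqueness

/-! ### Frames, Wronskians, and a criterion for lying on a quadric. -/

section Frames

variable {𝕜 : Type*} [RCLike 𝕜]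

theorem HasPD.pi {ι : Type*} [Fintype ι] {E : Type*} [NormedAddCommGroup E] [NormedSpace 𝕜 E]
    {v w p : 𝕜 × 𝕜} {f : ι → 𝕜 × 𝕜 → E} {fv fw : ι → E}
    (h : ∀ i, HasPD v w (f i) p (fv i) (fw i)) : HasPD v w (fun p i => f i p) p fv fw := by
  have hd := hasFDerivAt_pi.2 fun i => (h i).diff.hasFDerivAt
  refine ⟨hd.differentiableAt, ?_, ?_⟩
  · refine (congrArg (fun T => T v) hd.fderiv).trans (funext fun i => ?_)
    exact (h i).fst
  · refine (congrArg (fun T => T w) hd.fderiv).trans (funext fun i => ?_)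
    exact (h i).snd

/-- The bilinear form with matrix `M`. -/
noncomputable def form (M : Matrix (Fin 4) (Fin 4) 𝕜) :
    (Fin 4 → 𝕜) →L[𝕜] (Fin 4 → 𝕜) →L[𝕜] 𝕜 :=
  (Matrix.toLinearMap₂' 𝕜 M).toContinuousBilinearMap

theorem form_apply (M : Matrix (Fin 4) (Fin 4) 𝕜) (x y : Fin 4 → 𝕜) :
    form M x y = x ⬝ᵥ M.mulVec y := by
  rw [form, LinearMap.toContinuousBilinearMap_apply, Matrix.toLinearMap₂'_apply']

theorem form_symm {M : Matrix (Fin 4) (Fin 4) 𝕜} (hM : M.IsSymm) (x y : Fin 4 → 𝕜) :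
    form M x y = form M y x := by
  rw [form_apply, form_apply, Matrix.dotProduct_mulVec, ← Matrix.mulVec_transpose, hM.eq,
    dotProduct_comm]

/-- A vector orthogonal to a basis vanishes. -/
theorem eq_zero_of_form {M : Matrix (Fin 4) (Fin 4) 𝕜} (hM : M.det ≠ 0)
    {e : Fin 4 → Fin 4 → 𝕜} (he : LinearIndependent 𝕜 e) {x : Fin 4 → 𝕜}
    (hx : ∀ i, form M (e i) x = 0) : x = 0 := by
  have hW : IsUnit (Matrix.of e) := Matrix.linearIndependent_rows_iff_isUnit.1 he
  have h1 : (Matrix.of e).mulVec (M.mulVec x) = 0 := by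
    ext i; rw [Matrix.mulVec]; simpa [form_apply] using hx i
  by_contra h0
  have h2 : M.mulVec x ≠ 0 := fun h =>
    hM (Matrix.exists_mulVec_eq_zero_iff.1 ⟨x, h0, h⟩)
  have h3 : (Matrix.of e).det = 0 := Matrix.exists_mulVec_eq_zero_iff.1 ⟨_, h2, h1⟩
  exact ((Matrix.isUnit_iff_isUnit_det _).1 hW).ne_zero h3

/-- Four vectors of `𝕜⁴` are independent if no nonzero covector kills them. -/
theorem linearIndependent_of_dual {e : Fin 4 → Fin 4 → 𝕜}
    (h : ∀ x : Fin 4 → 𝕜, (∀ i, e i ⬝ᵥ x = 0) → x = 0) : LinearIndependent 𝕜 e := by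
  refine Matrix.linearIndependent_rows_iff_isUnit (A := Matrix.of e) |>.2 ?_
  rw [Matrix.isUnit_iff_isUnit_det, isUnit_iff_ne_zero]
  intro h0
  obtain ⟨x, hx, hx'⟩ := Matrix.exists_mulVec_eq_zero_iff.2 h0
  exact hx (h x fun i => congrFun hx' i)

theorem eq_zero_of_dual {e : Fin 4 → Fin 4 → 𝕜} (he : LinearIndependent 𝕜 e) {x : Fin 4 → 𝕜}
    (hx : ∀ i, e i ⬝ᵥ x = 0) : x = 0 :=
  eq_zero_of_form (M := 1) (by simp) he fun i => by rw [form_apply, Matrix.one_mulVec]; exact hx i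

/-- `y` is a frame along `U` satisfying the total differential system with matrices `P`, `Q`. -/
structure IsTotalSystem (U : Set (𝕜 × 𝕜)) (P Q : 𝕜 × 𝕜 → Matrix (Fin 4) (Fin 4) 𝕜)
    (y : Fin 4 → 𝕜 × 𝕜 → (Fin 4 → 𝕜)) : Prop where
  contP : ∀ i j, ContinuousOn (fun p => P p i j) U
  contQ : ∀ i j, ContinuousOn (fun p => Q p i j) U
  deriv : ∀ p ∈ U, ∀ i,
    HasPD (1, 0) (0, 1) (y i) p (∑ j, P p i j • y j p) (∑ j, Q p i j • y j p)

/-- Sum of the norms of the entries of a matrix. -/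
noncomputable def entrySum (P : Matrix (Fin 4) (Fin 4) 𝕜) : ℝ := ∑ i, ∑ j, ‖P i j‖

theorem entrySum_nonneg (P : Matrix (Fin 4) (Fin 4) 𝕜) : 0 ≤ entrySum P :=
  Finset.sum_nonneg fun _ _ => Finset.sum_nonneg fun _ _ => norm_nonneg _

theorem continuousOn_entrySum {U : Set (𝕜 × 𝕜)} {P : 𝕜 × 𝕜 → Matrix (Fin 4) (Fin 4) 𝕜}
    (h : ∀ i j, ContinuousOn (fun p => P p i j) U) : ContinuousOn (fun p => entrySum (P p)) U :=
  continuousOn_finsetSum _ fun i _ => continuousOn_finsetSum _ fun j _ => (h i j).norm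

theorem norm_sum_row_le (P : Matrix (Fin 4) (Fin 4) 𝕜) (i : Fin 4) (Y : Fin 4 → 𝕜) {C : ℝ}
    (hY : ∀ j, ‖Y j‖ ≤ C) : ‖∑ j, P i j * Y j‖ ≤ entrySum P * C := by
  calc ‖∑ j, P i j * Y j‖ ≤ ∑ j, ‖P i j‖ * C :=
        norm_sum_le_of_le _ fun j _ => by
          rw [norm_mul]; exact mul_le_mul_of_nonneg_left (hY j) (norm_nonneg _)
    _ = (∑ j, ‖P i j‖) * C := by rw [Finset.sum_mul]
    _ ≤ entrySum P * C := by
        refine mul_le_mul_of_nonneg_right ?_ ((norm_nonneg _).trans (hY 0))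
        exact Finset.single_le_sum (f := fun i => ∑ j, ‖P i j‖)
          (fun _ _ => Finset.sum_nonneg fun _ _ => norm_nonneg _) (Finset.mem_univ i)

theorem entry_le_entrySum (P : Matrix (Fin 4) (Fin 4) 𝕜) (i j : Fin 4) : ‖P i j‖ ≤ entrySum P :=
  (Finset.single_le_sum (f := fun j => ‖P i j‖) (fun _ _ => norm_nonneg _)
    (Finset.mem_univ j)).trans (Finset.single_le_sum (f := fun i => ∑ j, ‖P i j‖)
          (fun _ _ => Finset.sum_nonneg fun _ _ => norm_nonneg _) (Finset.mem_univ i))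

variable {U : Set (𝕜 × 𝕜)} {P Q : 𝕜 × 𝕜 → Matrix (Fin 4) (Fin 4) 𝕜}
  {y : Fin 4 → 𝕜 × 𝕜 → (Fin 4 → 𝕜)}

/-- The Wronskian of independent solutions does not vanish. -/
theorem IsTotalSystem.linearIndependent (h : IsTotalSystem U P Q y) (hU : IsOpen U)
    (hc : IsPreconnected U)
    (hi : LinearIndependent 𝕜 (fun (i : Fin 4) (p : U) => y 0 p i)) {p : 𝕜 × 𝕜} (hp : p ∈ U) :
    LinearIndependent 𝕜 (fun i => y i p) := by
  refine linearIndependent_of_dual fun x hx => ?_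
  -- A covector `x` killing the frame at `p` gives a scalar solution of the system with zero initial
  -- value. It vanishes on all of `U`, and its 0-th component is a linear relation between the
  -- components of `y 0`.
  let L : (Fin 4 → 𝕜) →L[𝕜] 𝕜 := (form 1).flip x
  have hL : ∀ z, L z = z ⬝ᵥ x := fun z => by simp [L, form_apply]
  have hY : ∀ q ∈ U, HasPD (1, 0) (0, 1) (fun q (i : Fin 4) => L (y i q)) q
      (fun i => ∑ j, P q i j * L (y j q)) (fun i => ∑ j, Q q i j * L (y j q)) := fun q hq =>
    .pi fun i => ((h.deriv q hq i).clm L).congr (by simp) (by simp)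
  have hz := eq_zero_of_total_system (Y := fun q (i : Fin 4) => L (y i q)) hU hc
    (κ := fun q => entrySum (P q) + entrySum (Q q))
    ((continuousOn_entrySum h.contP).add (continuousOn_entrySum h.contQ))
    (fun q hq => (hY q hq).diff) (fun q hq => by
      rw [add_mul]
      have hn : ∀ i, ‖L (y i q)‖ ≤ ‖fun i : Fin 4 => L (y i q)‖ :=
        norm_le_pi_norm (fun i : Fin 4 => L (y i q))
      refine add_le_add ?_ ?_
      · rw [show pd₁ _ q = _ from (hY q hq).fst]
        exact (pi_norm_le_iff_of_nonneg (mul_nonneg (entrySum_nonneg _) (norm_nonneg _))).2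
          fun i => norm_sum_row_le _ i _ hn
      · rw [show pd₂ _ q = _ from (hY q hq).snd]
        exact (pi_norm_le_iff_of_nonneg (mul_nonneg (entrySum_nonneg _) (norm_nonneg _))).2
          fun i => norm_sum_row_le _ i _ hn)
    hp (funext fun i => by rw [hL]; exact hx i)
  rw [Fintype.linearIndependent_iff] at hi
  refine funext (hi x (funext fun q => ?_))
  have := congrFun (hz q q.2) 0
  simp only [hL] at this
  simpa [dotProduct, mul_comm] using this

/-- The derivation of symmetric matrices induced by a total differential system. -/
def gramDeriv (P N : Matrix (Fin 4) (Fin 4) 𝕜) (i j : Fin 4) : 𝕜 :=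
  (∑ k, P i k * N k j) + ∑ k, P j k * N i k

theorem norm_gramDeriv_le (P N : Matrix (Fin 4) (Fin 4) 𝕜) (i j : Fin 4) {C : ℝ}
    (hN : ∀ i j, ‖N i j‖ ≤ C) : ‖gramDeriv P N i j‖ ≤ 2 * entrySum P * C := by
  refine (norm_add_le _ _).trans ?_
  have h1 := norm_sum_row_le P i (fun k => N k j) fun k => hN k j
  have h2 := norm_sum_row_le P j (fun k => N i k) fun k => hN i k
  linarith

theorem gramDeriv_add_mul (P K N : Matrix (Fin 4) (Fin 4) 𝕜) (c : 𝕜) (i j : Fin 4) :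
    gramDeriv P (fun i j => K i j + c * N i j) i j = gramDeriv P K i j + c * gramDeriv P N i j := by
  simp only [gramDeriv, Finset.sum_add_distrib, mul_add, Finset.mul_sum]
  have h : ∀ a b : 𝕜, a * (c * b) = c * (a * b) := fun a b => by ring
  simp only [h]
  ring

/-- If the total differential system preserves the conformal class of a field of nondegenerate
symmetric matrices `N` with `N₀₀ = 0`, the first frame vector describes a quadric. -/
theorem IsTotalSystem.isQuadricOn (h : IsTotalSystem U P Q y) (hU : IsOpen U)
    (hc : IsPreconnected U) {p₀ : 𝕜 × 𝕜} (hp₀ : p₀ ∈ U)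
    (hi : LinearIndependent 𝕜 (fun i => y i p₀))
    (N : 𝕜 × 𝕜 → Matrix (Fin 4) (Fin 4) 𝕜) (μ ν : 𝕜 × 𝕜 → 𝕜)
    (hsymm : (N p₀).IsSymm) (hdet : (N p₀).det ≠ 0) (h00 : ∀ p ∈ U, N p 0 0 = 0)
    (h03 : ∀ p ∈ U, N p 0 3 = -1)
    (hN : ∀ p ∈ U, ∀ i j, HasPD (1, 0) (0, 1) (fun p => N p i j) p
      (gramDeriv (P p) (N p) i j - μ p * N p i j) (gramDeriv (Q p) (N p) i j - ν p * N p i j)) :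
    IsQuadricOn U (y 0) := by
  set W : Matrix (Fin 4) (Fin 4) 𝕜 := Matrix.of fun i => y i p₀ with hWdef
  have hW : IsUnit W := Matrix.linearIndependent_rows_iff_isUnit.1 hi
  have hWd : IsUnit W.det := (Matrix.isUnit_iff_isUnit_det _).1 hW
  -- The unique form whose Gram matrix in the frame at `p₀` is `N p₀`.
  set M := W⁻¹ * N p₀ * (W⁻¹).transpose with hMdef
  have hMW : W * M * W.transpose = N p₀ := by
    have h1 : W * W⁻¹ = 1 := Matrix.mul_nonsing_inv _ hWd
    have h2 : (W⁻¹).transpose * W.transpose = 1 := by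
      rw [← Matrix.transpose_mul, h1, Matrix.transpose_one]
    calc W * M * W.transpose = (W * W⁻¹) * N p₀ * ((W⁻¹).transpose * W.transpose) := by
          simp only [hMdef, Matrix.mul_assoc]
      _ = N p₀ := by rw [h1, h2, Matrix.one_mul, Matrix.mul_one]
  have hform : ∀ i j, form M (y i p₀) (y j p₀) = N p₀ i j := fun i j => by
    rw [← hMW, form_apply, Matrix.mul_assoc]
    simp only [dotProduct, Matrix.mulVec, Matrix.mul_apply, Matrix.transpose_apply, hWdef,
      Matrix.of_apply]
  refine ⟨M, ?_, ?_, ?_⟩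
  · rw [Matrix.IsSymm, hMdef, Matrix.transpose_mul, Matrix.transpose_mul, Matrix.transpose_transpose,
      hsymm.eq, Matrix.mul_assoc]
  · intro h0
    apply hdet
    rw [← hMW, Matrix.det_mul, Matrix.det_mul, h0]; simp
  set K : 𝕜 × 𝕜 → Matrix (Fin 4) (Fin 4) 𝕜 := fun p i j => form M (y i p) (y j p) with hK
  have hKd : ∀ p ∈ U, ∀ i j, HasPD (1, 0) (0, 1) (fun p => K p i j) p
      (gramDeriv (P p) (K p) i j) (gramDeriv (Q p) (K p) i j) := fun p hp i j => by
    refine ((h.deriv p hp i).bilin (form M) (h.deriv p hp j)).congr ?_ ?_ <;>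
    simp [gramDeriv, hK]
  -- Since `N` has (0,3)-entry -1, `Y` measures the failure of `K` to be a multiple of `N`. At `p₀`
  -- one has `K = N`, hence `Y = 0`.
  set Y : 𝕜 × 𝕜 → Fin 4 → Fin 4 → 𝕜 := fun p i j => K p i j + K p 0 3 * N p i j with hYdef
  -- The constant entry has zero derivative, which determines the conformal factors. With this, the
  -- derivatives of `Y` become linear expressions in `Y` alone.
  have h03d : ∀ p ∈ U, gramDeriv (P p) (N p) 0 3 = - μ p ∧ gramDeriv (Q p) (N p) 0 3 = - ν p := by
    intro p hp
    have := HasPD.eq_of_eqOn hU hp h03 (hN p hp 0 3) (HasPD.const (-1))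
    rw [h03 p hp] at this
    constructor
    · linear_combination this.1
    · linear_combination this.2
  have hYd : ∀ p ∈ U, HasPD (1, 0) (0, 1) Y p
      (fun i j => gramDeriv (P p) (Y p) i j + gramDeriv (P p) (Y p) 0 3 * N p i j)
      (fun i j => gramDeriv (Q p) (Y p) i j + gramDeriv (Q p) (Y p) 0 3 * N p i j) := by
    intro p hp
    refine .pi fun i => .pi fun j => ?_
    refine ((hKd p hp i j).add ((hKd p hp 0 3).mul (hN p hp i j))).congr ?_ ?_
    · rw [gramDeriv_add_mul, gramDeriv_add_mul, (h03d p hp).1]; ring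
    · rw [gramDeriv_add_mul, gramDeriv_add_mul, (h03d p hp).2]; ring
  have hNc : ∀ i j, ContinuousOn (fun p => N p i j) U := fun i j p hp =>
    (hN p hp i j).diff.continuousAt.continuousWithinAt
  have hz := eq_zero_of_total_system (Y := Y) hU hc
    (κ := fun q => 2 * entrySum (P q) * (1 + entrySum (N q)) +
      2 * entrySum (Q q) * (1 + entrySum (N q)))
    (((continuousOn_const.mul (continuousOn_entrySum h.contP)).mul
      (continuousOn_const.add (continuousOn_entrySum hNc))).add
      ((continuousOn_const.mul (continuousOn_entrySum h.contQ)).mul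
      (continuousOn_const.add (continuousOn_entrySum hNc))))
    (fun q hq => (hYd q hq).diff) (fun q hq => by
      have hn : ∀ i j, ‖Y q i j‖ ≤ ‖Y q‖ := fun i j =>
        (norm_le_pi_norm (Y q i) j).trans (norm_le_pi_norm (Y q) i)
      have hb : ∀ (R : Matrix (Fin 4) (Fin 4) 𝕜) (i j : Fin 4),
          ‖gramDeriv R (Y q) i j + gramDeriv R (Y q) 0 3 * N q i j‖ ≤
            2 * entrySum R * (1 + entrySum (N q)) * ‖Y q‖ := fun R i j => by
        refine (norm_add_le _ _).trans ?_
        rw [norm_mul]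
        have h1 := norm_gramDeriv_le R (Y q) i j hn
        have h2 := mul_le_mul (norm_gramDeriv_le R (Y q) 0 3 hn) (entry_le_entrySum (N q) i j)
          (norm_nonneg _) (mul_nonneg (mul_nonneg zero_le_two (entrySum_nonneg R)) (norm_nonneg _))
        linarith
      have hpos : ∀ R : Matrix (Fin 4) (Fin 4) 𝕜,
          0 ≤ 2 * entrySum R * (1 + entrySum (N q)) * ‖Y q‖ := fun R =>
        (norm_nonneg _).trans (hb R 0 0)
      rw [add_mul]
      refine add_le_add ?_ ?_
      · rw [show pd₁ _ q = _ from (hYd q hq).fst]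
        exact (pi_norm_le_iff_of_nonneg (hpos _)).2 fun i =>
          (pi_norm_le_iff_of_nonneg (hpos _)).2 fun j => hb _ i j
      · rw [show pd₂ _ q = _ from (hYd q hq).snd]
        exact (pi_norm_le_iff_of_nonneg (hpos _)).2 fun i =>
          (pi_norm_le_iff_of_nonneg (hpos _)).2 fun j => hb _ i j)
    hp₀ (funext fun i => funext fun j => by
      simp only [hYdef, hK, hform, h03 p₀ hp₀]; simp)
  intro p hp
  have := congrFun (congrFun (hz p hp) 0) 0
  simpa [hYdef, hK, h00 p hp, form_apply] using this

end Frames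

/-! ### Conjugate nets on quadrics and their Laplace transforms. -/

section Conjugate

variable {𝕜 : Type*} [RCLike 𝕜] {U : Set (𝕜 × 𝕜)} {z : 𝕜 × 𝕜 → (Fin 4 → 𝕜)}
  {C : ConjugateCoeffs 𝕜} {v w : 𝕜 × 𝕜}

/-- The conjugate system with respect to the directions `v`, `w` instead of the coordinate axes,
together with the smoothness of its solution. -/
structure IsConj (v w : 𝕜 × 𝕜) (U : Set (𝕜 × 𝕜)) (z : 𝕜 × 𝕜 → (Fin 4 → 𝕜))
    (C : ConjugateCoeffs 𝕜) : Prop where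
  isOpen : IsOpen U
  smooth : ContDiffOn 𝕜 ∞ z U
  smooth_a : ContDiffOn 𝕜 ∞ C.a U
  smooth_b : ContDiffOn 𝕜 ∞ C.b U
  smooth_c : ContDiffOn 𝕜 ∞ C.c U
  smooth_q : ContDiffOn 𝕜 ∞ C.q U
  q_ne_zero : ∀ p ∈ U, C.q p ≠ 0
  frame : ∀ p ∈ U, LinearIndependent 𝕜 ![z p, dd v z p, dd w z p, dd v (dd v z) p]
  hyperbolic : ∀ p ∈ U,
    dd w (dd v z) p + C.a p • dd v z p + C.b p • dd w z p + C.c p • z p = 0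
  second : ∀ p ∈ U, dd w (dd w z) p + C.q p • dd v (dd v z) p + C.m p • dd v z p
    + C.n p • dd w z p + C.r p • z p = 0

theorem IsConjugateSystem.isConj (h : IsConjugateSystem U z C) (hU : IsOpen U)
    (hz : ContDiffOn 𝕜 ∞ z U) : IsConj (1, 0) (0, 1) U z C :=
  ⟨hU, hz, h.smooth_a, h.smooth_b, h.smooth_c, h.smooth_q, h.q_ne_zero, h.frame, h.hyperbolic,
    h.second⟩

/-- The coefficients after the exchange of the two coordinates. -/
noncomputable def swapCoeffs (C : ConjugateCoeffs 𝕜) : ConjugateCoeffs 𝕜 where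
  a := C.b
  b := C.a
  c := C.c
  q := fun p => (C.q p)⁻¹
  m := fun p => (C.q p)⁻¹ * C.n p
  n := fun p => (C.q p)⁻¹ * C.m p
  r := fun p => (C.q p)⁻¹ * C.r p

theorem dual_frame {e₀ e₁ e₂ e₃ : Fin 4 → 𝕜}
    (h : ∀ x : Fin 4 → 𝕜, e₀ ⬝ᵥ x = 0 → e₁ ⬝ᵥ x = 0 → e₂ ⬝ᵥ x = 0 → e₃ ⬝ᵥ x = 0 → x = 0) :
    LinearIndependent 𝕜 ![e₀, e₁, e₂, e₃] :=
  linearIndependent_of_dual fun x hx => h x (hx 0) (hx 1) (hx 2) (hx 3)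

/-- Division of the second equation by q ≠ 0 restores its normal form with the directions exchanged,
and the same equation recovers z_vv from z_ww in the frame. Results on S⁺ thereby carry over to S⁻.
-/
theorem IsConj.swap (h : IsConj v w U z C) : IsConj w v U z (swapCoeffs C) where
  isOpen := h.isOpen
  smooth := h.smooth
  smooth_a := h.smooth_b
  smooth_b := h.smooth_a
  smooth_c := h.smooth_c
  smooth_q := h.smooth_q.inv h.q_ne_zero
  q_ne_zero := fun p hp => inv_ne_zero (h.q_ne_zero p hp)
  frame := fun p hp => by
    refine dual_frame fun x h0 h1 h2 h3 => eq_zero_of_dual (h.frame p hp) (x := x) ?_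
    have := congrArg (fun V => V ⬝ᵥ x) (h.second p hp)
    simp only [add_dotProduct, smul_dotProduct, h0, h1, h2, h3, zero_dotProduct, mul_zero,
      zero_add, add_zero, smul_eq_mul, mul_eq_zero, h.q_ne_zero p hp, false_or] at this
    simp [Fin.forall_fin_succ, h0, h1, h2, this]
  hyperbolic := fun p hp => by
    rw [← h.hyperbolic p hp, dd_comm h.isOpen h.smooth hp]
    simp only [swapCoeffs]
    abel
  second := fun p hp => by
    have hq := h.q_ne_zero p hp
    have := congrArg (fun V => (C.q p)⁻¹ • V) (h.second p hp)
    simp only [smul_add, smul_smul, inv_mul_cancel₀ hq, one_smul, smul_zero] at this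
    rw [← this]
    simp only [swapCoeffs]
    abel

theorem IsConj.pd (h : IsConj v w U z C) {p : 𝕜 × 𝕜} (hp : p ∈ U) :
    HasPD v w z p (dd v z p) (dd w z p) ∧
    HasPD v w (dd v z) p (dd v (dd v z) p) (dd w (dd v z) p) ∧
    HasPD v w (dd w z) p (dd w (dd v z) p) (dd w (dd w z) p) :=
  ⟨.of_smooth h.isOpen h.smooth hp, .of_smooth h.isOpen (dd_smooth h.isOpen h.smooth) hp,
    ⟨diffAt_of_smooth h.isOpen (dd_smooth h.isOpen h.smooth) hp,
      dd_comm h.isOpen h.smooth hp, rfl⟩⟩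

/-- Compatibility of the system `A_v = φ A`, `A_w = ψ A`. -/
theorem cross_derivative_eq (hU : IsOpen U) {A φ ψ : 𝕜 × 𝕜 → 𝕜} (hA : ContDiffOn 𝕜 ∞ A U)
    (hφ : ContDiffOn 𝕜 ∞ φ U) (hψ : ContDiffOn 𝕜 ∞ ψ U)
    (h1 : ∀ p ∈ U, dd v A p = φ p * A p) (h2 : ∀ p ∈ U, dd w A p = ψ p * A p)
    {p : 𝕜 × 𝕜} (hp : p ∈ U) (h0 : A p ≠ 0) : dd w φ p = dd v ψ p := by
  have e1 := HasPD.eq_of_eqOn hU hp h1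
    (HasPD.of_smooth (v := v) (w := w) hU (dd_smooth hU hA) hp)
    ((HasPD.of_smooth hU hφ hp).mul (HasPD.of_smooth hU hA hp))
  have e2 := HasPD.eq_of_eqOn hU hp h2
    (HasPD.of_smooth (v := v) (w := w) hU (dd_smooth hU hA) hp)
    ((HasPD.of_smooth hU hψ hp).mul (HasPD.of_smooth hU hA hp))
  have e3 := dd_comm (v := v) (w := w) hU hA hp
  rw [e1.2, e2.1, h1 p hp, h2 p hp] at e3
  refine mul_right_cancel₀ h0 ?_
  linear_combination -e3

theorem form_smooth (M : Matrix (Fin 4) (Fin 4) 𝕜) {f g : 𝕜 × 𝕜 → (Fin 4 → 𝕜)}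
    (hf : ContDiffOn 𝕜 ∞ f U) (hg : ContDiffOn 𝕜 ∞ g U) :
    ContDiffOn 𝕜 ∞ (fun p => form M (f p) (g p)) U :=
  ((form M).contDiff.comp_contDiffOn hf).clm_apply hg

set_option maxHeartbeats 1000000 in
/-- If a conjugate net lies on a quadric, the first fundamental form `A = ⟨z_v, z_v⟩` satisfies
`A_v = -(2 b + q_v / q) A`, `A_w = -2 a A`, and `2 m = 4 b q + q_v`. -/
theorem IsConj.quadric_metric (h : IsConj v w U z C) (hq : IsQuadricOn U z) :
    (∀ p ∈ U, 2 * C.m p = 4 * C.b p * C.q p + dd v C.q p) ∧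
    ∃ A : 𝕜 × 𝕜 → 𝕜, ContDiffOn 𝕜 ∞ A U ∧ (∀ p ∈ U, A p ≠ 0) ∧
      (∀ p ∈ U, dd v A p = -(2 * C.b p + dd v C.q p / C.q p) * A p) ∧
      ∀ p ∈ U, dd w A p = (-2 * C.a p) * A p := by
  obtain ⟨M, hMs, hMd, hM⟩ := hq
  set B := form M with hB
  have hs : ∀ x y, B x y = B y x := form_symm hMs
  have hzz : ∀ p ∈ U, B (z p) (z p) = 0 := fun p hp => by rw [hB, form_apply]; exact hM p hp
  have hU := h.isOpen
  have h1 : ∀ p ∈ U, B (z p) (dd v z p) = 0 ∧ B (z p) (dd w z p) = 0 := fun p hp => by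
    -- First derivatives of ⟨z, z⟩ = 0.
    obtain ⟨d0, d1, d2⟩ := h.pd hp
    have e := HasPD.eq_of_eqOn hU hp hzz (d0.bilin B d0) (HasPD.const 0)
    rw [hs (dd v z p), hs (dd w z p)] at e
    constructor
    · linear_combination e.1 / 2
    · linear_combination e.2 / 2
  have hyp : ∀ p ∈ U, ∀ x, B x (dd w (dd v z) p) = - C.a p * B x (dd v z p)
      - C.b p * B x (dd w z p) - C.c p * B x (z p) := fun p hp x => by
    have := congrArg (B x) (h.hyperbolic p hp)
    simp only [map_add, map_smul, smul_eq_mul, map_zero] at this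
    linear_combination this
  have sec : ∀ p ∈ U, ∀ x, B x (dd w (dd w z) p) = - C.q p * B x (dd v (dd v z) p)
      - C.m p * B x (dd v z p) - C.n p * B x (dd w z p) - C.r p * B x (z p) := fun p hp x => by
    have := congrArg (B x) (h.second p hp)
    simp only [map_add, map_smul, smul_eq_mul, map_zero] at this
    linear_combination this
  -- Differentiating ⟨z, z_v⟩ = ⟨z, z_w⟩ = 0 and inserting the two equations shows that the induced
  -- metric is conformal to dv² - q dw².
  have h2 : ∀ p ∈ U, B (z p) (dd v (dd v z) p) = - B (dd v z p) (dd v z p) ∧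
      B (dd v z p) (dd w z p) = 0 ∧
      B (dd w z p) (dd w z p) = - C.q p * B (dd v z p) (dd v z p) := fun p hp => by
    obtain ⟨d0, d1, d2⟩ := h.pd hp
    have e1 := HasPD.eq_of_eqOn hU hp (fun p hp => (h1 p hp).1) (d0.bilin B d1) (HasPD.const 0)
    have e2 := HasPD.eq_of_eqOn hU hp (fun p hp => (h1 p hp).2) (d0.bilin B d2) (HasPD.const 0)
    have e3 := hyp p hp (z p)
    have e4 := sec p hp (z p)
    rw [(h1 p hp).1, (h1 p hp).2, hzz p hp] at e3 e4
    refine ⟨by linear_combination e1.1, by linear_combination e2.1 - e3, ?_⟩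
    linear_combination e2.2 - e4 + C.q p * e1.1
  -- Otherwise z would be orthogonal to the whole frame.
  have hA0 : ∀ p ∈ U, B (dd v z p) (dd v z p) ≠ 0 := fun p hp h0 => by
    have hz0 : z p = 0 := by
      refine eq_zero_of_form hMd (h.frame p hp) fun i => ?_
      rw [← hB, hs]
      revert i
      simp [Fin.forall_fin_succ, hzz p hp, h1 p hp, (h2 p hp).1, h0]
    have := (h.frame p hp).ne_zero 0
    simp [hz0] at this
  have hAd : ∀ p ∈ U, HasPD v w (fun p => B (dd v z p) (dd v z p)) p
      (2 * B (dd v z p) (dd v (dd v z) p)) (-2 * C.a p * B (dd v z p) (dd v z p)) := fun p hp => by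
    obtain ⟨d0, d1, d2⟩ := h.pd hp
    refine (d1.bilin B d1).congr ?_ ?_
    · rw [hs _ (dd v z p)]; ring
    · rw [hs _ (dd v z p), hyp p hp, (h2 p hp).2.1, hs _ (z p), (h1 p hp).1]; ring
  -- Two evaluations of q A_v: from the w-derivative of ⟨z_v, z_w⟩ = 0 and from the v-derivative of
  -- ⟨z_w, z_w⟩ = -q A. Their difference is the relation for 2m.
  have key : ∀ p ∈ U, C.q p * (2 * B (dd v z p) (dd v (dd v z) p)) =
        2 * (C.b p * C.q p - C.m p) * B (dd v z p) (dd v z p) ∧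
      dd v C.q p * B (dd v z p) (dd v z p) + C.q p * (2 * B (dd v z p) (dd v (dd v z) p)) =
        -2 * C.b p * C.q p * B (dd v z p) (dd v z p) := fun p hp => by
    obtain ⟨d0, d1, d2⟩ := h.pd hp
    have e1 := HasPD.eq_of_eqOn hU hp (fun p hp => (h2 p hp).2.1) (d1.bilin B d2) (HasPD.const 0)
    have e2 := HasPD.eq_of_eqOn hU hp (fun p hp => (h2 p hp).2.2) (d2.bilin B d2)
      ((HasPD.of_smooth hU h.smooth_q hp).neg.mul (hAd p hp))
    have e3 := hyp p hp (dd w z p)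
    have e4 := sec p hp (dd v z p)
    rw [hs _ (z p), (h1 p hp).2, hs _ (dd v z p), (h2 p hp).2.1, (h2 p hp).2.2] at e3
    rw [hs _ (z p), (h1 p hp).1, (h2 p hp).2.1] at e4
    have e1' := e1.2
    have e2' := e2.1
    rw [hs _ (dd w z p)] at e1' e2'
    constructor
    · linear_combination -2 * e1' + 2 * e3 + 2 * e4
    · linear_combination e2' - 2 * e3
  refine ⟨fun p hp => mul_right_cancel₀ (hA0 p hp) ?_, fun p => B (dd v z p) (dd v z p), ?_, hA0,
    fun p hp => ?_, fun p hp => (hAd p hp).snd⟩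
  · linear_combination (key p hp).1 - (key p hp).2
  · exact form_smooth M (dd_smooth hU h.smooth) (dd_smooth hU h.smooth)
  · rw [(hAd p hp).fst]
    have hq0 := h.q_ne_zero p hp
    refine mul_left_cancel₀ hq0 ?_
    have := (key p hp).2
    field_simp
    linear_combination this

/-- On a quadric with `(log q)_{vw} = 0` the Laplace invariants coincide. -/
theorem IsConj.quadric_symmetric (h : IsConj v w U z C) (hq : IsQuadricOn U z) {μ : 𝕜 × 𝕜 → 𝕜}
    (hμ : ContDiffOn 𝕜 ∞ μ U) (hqμ : ∀ p ∈ U, dd v C.q p = μ p * C.q p)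
    (hμw : ∀ p ∈ U, dd w μ p = 0) {p : 𝕜 × 𝕜} (hp : p ∈ U) : dd v C.a p = dd w C.b p := by
  obtain ⟨-, A, hA, hA0, hAv, hAw⟩ := h.quadric_metric hq
  have hU := h.isOpen
  have hpd := ((HasPD.const (v := v) (w := w) (p := p) (2 : 𝕜)).mul
    (HasPD.of_smooth hU h.smooth_b hp)).add (HasPD.of_smooth hU hμ hp)
  have hpd' := (HasPD.const (v := v) (w := w) (p := p) (-2 : 𝕜)).mul
    (HasPD.of_smooth hU h.smooth_a hp)
  have := cross_derivative_eq (v := v) (w := w) hU hA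
    (φ := fun p => -(2 * C.b p + μ p)) (ψ := fun p => -2 * C.a p)
    ((contDiffOn_const.mul h.smooth_b).add hμ).neg (contDiffOn_const.mul h.smooth_a)
    (fun p hp => by rw [hAv p hp, hqμ p hp, mul_div_cancel_right₀ _ (h.q_ne_zero p hp)])
    hAw hp (hA0 p hp)
  rw [hpd.neg.snd, hpd'.fst, hμw p hp] at this
  linear_combination this / 2

/-- The Laplace invariant `a b + a_v - c`. -/
noncomputable def laplaceInv (v : 𝕜 × 𝕜) (C : ConjugateCoeffs 𝕜) (p : 𝕜 × 𝕜) : 𝕜 :=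
  C.a p * C.b p + dd v C.a p - C.c p

theorem IsConj.smooth_laplaceInv (h : IsConj v w U z C) : ContDiffOn 𝕜 ∞ (laplaceInv v C) U :=
  ((h.smooth_a.mul h.smooth_b).add (dd_smooth h.isOpen h.smooth_a)).sub h.smooth_c

set_option maxHeartbeats 1000000 in
/-- If a conjugate net with `(log q)_{vw} = 0` and its Laplace transform `z_w + a z` both lie on
quadrics, then `(log h)_{vw} = 0` wherever `h ≠ 0`. -/
theorem IsConj.laplaceInv_log (h : IsConj v w U z C) (hq : IsQuadricOn U z)
    (hq' : IsQuadricOn U (fun p => dd w z p + C.a p • z p)) {μ : 𝕜 × 𝕜 → 𝕜}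
    (hμ : ContDiffOn 𝕜 ∞ μ U) (hqμ : ∀ p ∈ U, dd v C.q p = μ p * C.q p)
    (hμw : ∀ p ∈ U, dd w μ p = 0) {p : 𝕜 × 𝕜} (hp : p ∈ U) (hp0 : laplaceInv v C p ≠ 0) :
    dd w (dd v (laplaceInv v C)) p * laplaceInv v C p =
      dd v (laplaceInv v C) p * dd w (laplaceInv v C) p := by
  have hab := h.quadric_symmetric hq hμ hqμ hμw hp
  obtain ⟨hm, -⟩ := h.quadric_metric hq
  obtain ⟨M, hMs, hMd, hM⟩ := hq'
  set H := laplaceInv v C with hH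
  have hHs : ContDiffOn 𝕜 ∞ H U := h.smooth_laplaceInv
  set B := form M with hB
  have hs : ∀ x y, B x y = B y x := form_symm hMs
  set X : 𝕜 × 𝕜 → (Fin 4 → 𝕜) := fun p => dd w z p + C.a p • z p with hX
  have hXX : ∀ p ∈ U, B (X p) (X p) = 0 := fun p hp => by rw [hB, form_apply]; exact hM p hp
  have hU := h.isOpen
  -- The argument divides by H, and it differentiates the resulting identities, so it needs the open
  -- set where H ≠ 0.
  set V := U ∩ {p | H p ≠ 0} with hVdef
  have hV : IsOpen V := hHs.continuousOn.isOpen_inter_preimage hU isOpen_ne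
  have hVU : V ⊆ U := Set.inter_subset_left
  -- The hyperbolic equation in factored form: X_v + b X = H z.
  have hXd : ∀ p ∈ U, HasPD v w X p (-C.b p • X p + H p • z p)
      (dd w (dd w z) p + (dd w C.a p • z p + C.a p • dd w z p)) := fun p hp => by
    obtain ⟨d0, d1, d2⟩ := h.pd hp
    refine (d2.add ((HasPD.of_smooth hU h.smooth_a hp).smul d0)).congr ?_ rfl
    have e : dd w (dd v z) p = -C.a p • dd v z p - C.b p • dd w z p - C.c p • z p := by
      rw [← sub_eq_zero, ← h.hyperbolic p hp]; module
    rw [e, hH, hX]; simp only [laplaceInv]; module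
  have hzt : ∀ p, dd w z p = X p - C.a p • z p := fun p => by simp [hX]
  have sec : ∀ p ∈ U, ∀ x, B x (dd w (dd w z) p) = - C.q p * B x (dd v (dd v z) p)
      - C.m p * B x (dd v z p) - C.n p * B x (dd w z p) - C.r p * B x (z p) := fun p hp x => by
    have := congrArg (B x) (h.second p hp)
    simp only [map_add, map_smul, smul_eq_mul, map_zero] at this
    linear_combination this
  -- The v-derivative of ⟨X, X⟩ = 0 is 2H⟨X, z⟩.
  have h1 : ∀ p ∈ V, B (X p) (z p) = 0 := fun p hp => by
    have e := HasPD.eq_of_eqOn hU hp.1 hXX ((hXd p hp.1).bilin B (hXd p hp.1)) (HasPD.const 0)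
    have e1 := e.1
    rw [hs _ (X p)] at e1
    simp only [map_add, map_smul, smul_eq_mul, hXX p hp.1] at e1
    refine mul_left_cancel₀ hp.2 ?_
    linear_combination e1 / 2
  have h1t : ∀ p ∈ V, B (X p) (dd w z p) = 0 := fun p hp => by
    rw [hzt, map_sub, map_smul, hXX p hp.1, h1 p hp]; simp
  have h1tt : ∀ p ∈ V, B (X p) (dd w (dd w z) p) = 0 := fun p hp => by
    have e := HasPD.eq_of_eqOn hU hp.1 hXX ((hXd p hp.1).bilin B (hXd p hp.1)) (HasPD.const 0)
    have e2 := e.2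
    rw [hs _ (X p)] at e2
    simp only [map_add, map_smul, smul_eq_mul, h1 p hp, h1t p hp] at e2
    linear_combination e2 / 2
  have h2 : ∀ p ∈ V, B (X p) (dd v z p) = - H p * B (z p) (z p) := fun p hp => by
    obtain ⟨d0, d1, d2⟩ := h.pd hp.1
    have e := HasPD.eq_of_eqOn hV hp h1 ((hXd p hp.1).bilin B d0) (HasPD.const 0)
    have e1 := e.1
    simp only [map_add, map_smul, add_apply, smul_apply,
      smul_eq_mul, h1 p hp] at e1
    linear_combination e1
  have hAd : ∀ p ∈ V, HasPD v w (fun p => B (z p) (z p)) p (2 * B (z p) (dd v z p))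
      (-2 * C.a p * B (z p) (z p)) := fun p hp => by
    obtain ⟨d0, d1, d2⟩ := h.pd hp.1
    refine (d0.bilin B d0).congr ?_ ?_
    · rw [hs _ (z p)]; ring
    · rw [hs _ (z p), hzt, map_sub, map_smul, hs _ (X p), h1 p hp, smul_eq_mul]; ring
  -- ⟨X, z_vv⟩ is found twice, by pairing the second equation with X and by differentiating ⟨X, z_v⟩
  -- = -H⟨z, z⟩. Comparison yields the v-derivative of ⟨z, z⟩.
  have h3 : ∀ p ∈ V, C.q p * B (X p) (dd v (dd v z) p) = C.m p * H p * B (z p) (z p) ∧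
      B (X p) (dd v (dd v z) p) = - dd v H p * B (z p) (z p)
        - 3 * H p * B (z p) (dd v z p) - C.b p * H p * B (z p) (z p) := fun p hp => by
    obtain ⟨d0, d1, d2⟩ := h.pd hp.1
    have e := (HasPD.eq_of_eqOn hV hp h2 ((hXd p hp.1).bilin B d1)
      ((HasPD.of_smooth hU hHs hp.1).neg.mul (hAd p hp))).1
    simp only [map_add, map_smul, add_apply, smul_apply,
      smul_eq_mul, h2 p hp] at e
    have e' := sec p hp.1 (X p)
    rw [h1tt p hp, h1t p hp, h1 p hp, h2 p hp] at e'
    constructor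
    · linear_combination e'
    · linear_combination e
  -- If ⟨z, z⟩ vanished, X would be orthogonal to the frame, hence zero, against the independence of
  -- z and z_w.
  have hA0 : ∀ p ∈ V, B (z p) (z p) ≠ 0 := fun p hp h0 => by
    have e := (h3 p hp).1
    rw [h0, mul_zero] at e
    have hX0 : X p = 0 := by
      refine eq_zero_of_form hMd (h.frame p hp.1) fun i => ?_
      rw [← hB, hs]
      revert i
      simp [Fin.forall_fin_succ, h1 p hp, h2 p hp, h1t p hp, h0,
        (mul_eq_zero.1 e).resolve_left (h.q_ne_zero p hp.1)]
    have hli := Fintype.linearIndependent_iff.1 (h.frame p hp.1) ![C.a p, 0, 1, 0] (by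
      simp only [Fin.sum_univ_four, Matrix.cons_val_zero, Matrix.cons_val_one, Matrix.cons_val,
        zero_smul, one_smul, add_zero]
      rw [← hX0]; simp only [hX]; abel) 2
    simp at hli
  have hpV : p ∈ V := ⟨hp, hp0⟩
  have hbs := h.smooth_b.mono hVU
  have hHV := hHs.mono hVU
  have hHvV : ContDiffOn 𝕜 ∞ (dd v H) V := (dd_smooth hU hHs).mono hVU
  -- The coefficients in `φ` come from `h3` with m/q = 2b + μ/2, which holds because the original
  -- net also lies on a quadric.
  have hcross := cross_derivative_eq (v := v) (w := w) hV (A := fun p => B (z p) (z p))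
    (φ := fun p => (-2 / 3) * (dd v H p / H p) + (-2) * C.b p + (-1 / 3) * μ p)
    (ψ := fun p => -2 * C.a p)
    (form_smooth M (h.smooth.mono hVU) (h.smooth.mono hVU))
    (((contDiffOn_const.mul (hHvV.div hHV fun p hp => hp.2)).add
      (contDiffOn_const.mul hbs)).add (contDiffOn_const.mul (hμ.mono hVU)))
    (contDiffOn_const.mul (h.smooth_a.mono hVU))
    (fun p hp => by
      rw [(hAd p hp).fst]
      have hHp : H p ≠ 0 := hp.2
      have hq0 := h.q_ne_zero p hp.1
      have e1 := h3 p hp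
      have e2 := hm p hp.1
      rw [hqμ p hp.1] at e2
      refine mul_left_cancel₀ (mul_ne_zero hHp hq0) ?_
      have hd : dd v H p / H p * H p = dd v H p := div_mul_cancel₀ _ hHp
      linear_combination (-2 / 3) * e1.1 + 2 / 3 * C.q p * e1.2
        - 1 / 3 * H p * B (z p) (z p) * e2 + 2 / 3 * C.q p * B (z p) (z p) * hd)
    (fun p hp => (hAd p hp).snd) hpV (hA0 p hpV)
  have g1 := ((((HasPD.const (v := v) (w := w) (p := p) (-2 / 3 : 𝕜)).mul
    ((HasPD.of_smooth hV hHvV hpV).div (HasPD.of_smooth hV hHV hpV) hp0)).add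
    ((HasPD.const (-2 : 𝕜)).mul (HasPD.of_smooth hV hbs hpV))).add
    ((HasPD.const (-1 / 3 : 𝕜)).mul (HasPD.of_smooth hU hμ hp)))
  have g2 := (HasPD.const (v := v) (w := w) (p := p) (-2 : 𝕜)).mul
    (HasPD.of_smooth hU h.smooth_a hp)
  rw [g1.snd, g2.fst, hμw p hp, hab] at hcross
  -- With a_v = b_w and μ_w = 0 only (H_v/H)_w survives.
  have h3 : (dd w (dd v H) p * H p - dd v H p * dd w H p) / H p ^ 2 = 0 := by
    linear_combination (-3 / 2) * hcross
  rw [div_eq_zero_iff, or_iff_left (pow_ne_zero 2 hp0)] at h3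
  exact sub_eq_zero.1 h3

end Conjugate

/-! ### Gauge transformations and invariance of the Laplace data. -/

section Gauge

variable {𝕜 : Type*} [RCLike 𝕜] {U : Set (𝕜 × 𝕜)} {z w : 𝕜 × 𝕜 → (Fin 4 → 𝕜)}
  {C C' : ConjugateCoeffs 𝕜} {f : 𝕜 × 𝕜 → 𝕜}

/-- The coefficients of the conjugate system satisfied by `f • w`. -/
noncomputable def gaugeCoeffs (C : ConjugateCoeffs 𝕜) (f : 𝕜 × 𝕜 → 𝕜) : ConjugateCoeffs 𝕜 where
  a := fun p => C.a p - pd₂ f p / f p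
  b := fun p => C.b p - pd₁ f p / f p
  c := fun p => C.c p - C.a p * (pd₁ f p / f p) - C.b p * (pd₂ f p / f p)
    + 2 * (pd₁ f p / f p) * (pd₂ f p / f p) - pd₂ (pd₁ f) p / f p
  q := C.q
  m := fun p => C.m p - 2 * C.q p * (pd₁ f p / f p)
  n := fun p => C.n p - 2 * (pd₂ f p / f p)
  r := fun p => C.r p - C.m p * (pd₁ f p / f p) - C.n p * (pd₂ f p / f p)
    + 2 * (pd₂ f p / f p) ^ 2 - pd₂ (pd₂ f) p / f p
    + C.q p * (2 * (pd₁ f p / f p) ^ 2 - pd₁ (pd₁ f) p / f p)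

theorem gauge_derivatives (hU : IsOpen U) (hw : ContDiffOn 𝕜 ∞ w U) (hf : ContDiffOn 𝕜 ∞ f U)
    (hz : ∀ p ∈ U, z p = f p • w p) {p : 𝕜 × 𝕜} (hp : p ∈ U) :
    pd₁ z p = pd₁ f p • w p + f p • pd₁ w p ∧ pd₂ z p = pd₂ f p • w p + f p • pd₂ w p ∧
    pd₁ (pd₁ z) p = pd₁ (pd₁ f) p • w p + (2 * pd₁ f p) • pd₁ w p + f p • pd₁ (pd₁ w) p ∧
    pd₂ (pd₁ z) p = pd₂ (pd₁ f) p • w p + pd₁ f p • pd₂ w p + pd₂ f p • pd₁ w p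
      + f p • pd₂ (pd₁ w) p ∧
    pd₂ (pd₂ z) p = pd₂ (pd₂ f) p • w p + (2 * pd₂ f p) • pd₂ w p + f p • pd₂ (pd₂ w) p := by
  have hd : ∀ p ∈ U, HasPD (1, 0) (0, 1) z p (pd₁ f p • w p + f p • pd₁ w p)
      (pd₂ f p • w p + f p • pd₂ w p) := fun p hp =>
    ((HasPD.of_smooth' hU hf hp).smul (HasPD.of_smooth' hU hw hp)).congr_fun hU hp
      fun p hp => (hz p hp).symm
  have f1 := HasPD.of_smooth' hU (pd₁_smooth hU hf) hp
  have f2 := HasPD.of_smooth' hU (pd₂_smooth hU hf) hp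
  have w1 := HasPD.of_smooth' hU (pd₁_smooth hU hw) hp
  have w2 := HasPD.of_smooth' hU (pd₂_smooth hU hw) hp
  have f0 := HasPD.of_smooth' hU hf hp
  have w0 := HasPD.of_smooth' hU hw hp
  have h1 := ((f1.smul w0).add (f0.smul w1)).congr_fun hU hp fun p hp => ((hd p hp).fst).symm
  have h2 := ((f2.smul w0).add (f0.smul w2)).congr_fun hU hp fun p hp => ((hd p hp).snd).symm
  refine ⟨(hd p hp).fst, (hd p hp).snd, h1.fst.trans ?_, h1.snd.trans ?_, h2.snd.trans ?_⟩ <;>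
  module

/-- The new frame is related to the old one by a triangular matrix with f on the diagonal, so
independence persists; the equations are those of w multiplied by f. -/
theorem IsConjugateSystem.gauge (h : IsConjugateSystem U w C) (hU : IsOpen U)
    (hw : ContDiffOn 𝕜 ∞ w U) (hf : ContDiffOn 𝕜 ∞ f U) (hf0 : ∀ p ∈ U, f p ≠ 0)
    (hz : ∀ p ∈ U, z p = f p • w p) : IsConjugateSystem U z (gaugeCoeffs C f) := by
  have h1 := (pd₁_smooth hU hf).div hf hf0
  have h2 := (pd₂_smooth hU hf).div hf hf0
  have h11 := (pd₁_smooth hU (pd₁_smooth hU hf)).div hf hf0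
  have h12 := (pd₂_smooth hU (pd₁_smooth hU hf)).div hf hf0
  have h22 := (pd₂_smooth hU (pd₂_smooth hU hf)).div hf hf0
  refine ⟨h.smooth_a.sub h2, h.smooth_b.sub h1, ?_, h.smooth_q,
    h.smooth_m.sub ((contDiffOn_const.mul h.smooth_q).mul h1),
    h.smooth_n.sub (contDiffOn_const.mul h2), ?_, h.q_ne_zero, fun p hp => ?_, fun p hp => ?_,
    fun p hp => ?_⟩
  · exact (((h.smooth_c.sub (h.smooth_a.mul h1)).sub (h.smooth_b.mul h2)).add
      ((contDiffOn_const.mul h1).mul h2)).sub h12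
  · exact ((((h.smooth_r.sub (h.smooth_m.mul h1)).sub (h.smooth_n.mul h2)).add
      (contDiffOn_const.mul (h2.pow 2))).sub h22).add
      (h.smooth_q.mul ((contDiffOn_const.mul (h1.pow 2)).sub h11))
  · obtain ⟨e1, e2, e11, -, -⟩ := gauge_derivatives hU hw hf hz hp
    have hfp := hf0 p hp
    refine dual_frame fun x k0 k1 k2 k3 => eq_zero_of_dual (h.frame p hp) (x := x) ?_
    rw [hz p hp, smul_dotProduct, smul_eq_mul, mul_eq_zero, or_iff_right hfp] at k0
    rw [e1, add_dotProduct, smul_dotProduct, smul_dotProduct, k0, smul_zero, zero_add,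
      smul_eq_mul, mul_eq_zero, or_iff_right hfp] at k1
    rw [e2, add_dotProduct, smul_dotProduct, smul_dotProduct, k0, smul_zero, zero_add,
      smul_eq_mul, mul_eq_zero, or_iff_right hfp] at k2
    rw [e11, add_dotProduct, add_dotProduct, smul_dotProduct, smul_dotProduct, smul_dotProduct,
      k0, k1, smul_zero, smul_zero, zero_add, zero_add,
      smul_eq_mul, mul_eq_zero, or_iff_right hfp] at k3
    simp [Fin.forall_fin_succ, k0, k1, k2, k3]
  · obtain ⟨e1, e2, -, e12, -⟩ := gauge_derivatives hU hw hf hz hp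
    have hfp := hf0 p hp
    rw [e1, e2, e12, hz p hp]
    have := congrArg (fun V => f p • V) (h.hyperbolic p hp)
    simp only [smul_zero] at this
    rw [← this]
    simp only [gaugeCoeffs]
    match_scalars <;> field_simp <;> ring
  · obtain ⟨e1, e2, e11, -, e22⟩ := gauge_derivatives hU hw hf hz hp
    have hfp := hf0 p hp
    rw [e1, e2, e11, e22, hz p hp]
    have := congrArg (fun V => f p • V) (h.second p hp)
    simp only [smul_zero] at this
    rw [← this]
    simp only [gaugeCoeffs]
    match_scalars <;> field_simp <;> ring

/-- The terms from the s-derivative of f_t/f cancel against those in the new ab - c, once the mixed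
derivatives of f are interchanged. -/
theorem gaugeCoeffs_h (hU : IsOpen U) (ha : ContDiffOn 𝕜 ∞ C.a U) (hf : ContDiffOn 𝕜 ∞ f U)
    (hf0 : ∀ p ∈ U, f p ≠ 0) {p : 𝕜 × 𝕜} (hp : p ∈ U) : (gaugeCoeffs C f).h p = C.h p := by
  have hfp := hf0 p hp
  have e : pd₁ (gaugeCoeffs C f).a p = _ := ((HasPD.of_smooth' hU ha hp).sub
    ((HasPD.of_smooth' hU (pd₂_smooth hU hf) hp).div (HasPD.of_smooth' hU hf hp) hfp)).fst
  rw [ConjugateCoeffs.h, e, ConjugateCoeffs.h, pd_comm hU hf hp]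
  simp only [gaugeCoeffs]
  field_simp
  ring

theorem gaugeCoeffs_k (hU : IsOpen U) (hb : ContDiffOn 𝕜 ∞ C.b U) (hf : ContDiffOn 𝕜 ∞ f U)
    (hf0 : ∀ p ∈ U, f p ≠ 0) {p : 𝕜 × 𝕜} (hp : p ∈ U) : (gaugeCoeffs C f).k p = C.k p := by
  have hfp := hf0 p hp
  have e : pd₂ (gaugeCoeffs C f).b p = _ := ((HasPD.of_smooth' hU hb hp).sub
    ((HasPD.of_smooth' hU (pd₁_smooth hU hf) hp).div (HasPD.of_smooth' hU hf hp) hfp)).snd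
  rw [ConjugateCoeffs.k, e, ConjugateCoeffs.k]
  simp only [gaugeCoeffs]
  field_simp
  ring

/-- The conjugate system determines the Laplace data. -/
theorem IsConjugateSystem.unique (h : IsConjugateSystem U z C) (h' : IsConjugateSystem U z C')
    {p : 𝕜 × 𝕜} (hp : p ∈ U) : C.a p = C'.a p ∧ C.b p = C'.b p ∧ C.c p = C'.c p := by
  have hli := Fintype.linearIndependent_iff.1 (h.frame p hp)
    ![C.c p - C'.c p, C.a p - C'.a p, C.b p - C'.b p, 0] (by
      simp only [Fin.sum_univ_four, Matrix.cons_val_zero, Matrix.cons_val_one, Matrix.cons_val]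
      have e := h.hyperbolic p hp
      rw [← h'.hyperbolic p hp, ← sub_eq_zero] at e
      rw [← e]; module)
  have h0 := hli 0
  have h1 := hli 1
  have h2 := hli 2
  simp only [Matrix.cons_val_zero, Matrix.cons_val_one, Matrix.cons_val, sub_eq_zero] at h0 h1 h2
  exact ⟨h1, h2, h0⟩

theorem IsConjugateSystem.h_eq (h : IsConjugateSystem U z C) (h' : IsConjugateSystem U z C')
    (hU : IsOpen U) {p : 𝕜 × 𝕜} (hp : p ∈ U) : C.h p = C'.h p := by
  obtain ⟨ha, hb, hc⟩ := h.unique h' hp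
  rw [ConjugateCoeffs.h, ConjugateCoeffs.h, ha, hb, hc,
    pd₁_congr hU hp fun p hp => (h.unique h' hp).1]

theorem IsConjugateSystem.k_eq (h : IsConjugateSystem U z C) (h' : IsConjugateSystem U z C')
    (hU : IsOpen U) {p : 𝕜 × 𝕜} (hp : p ∈ U) : C.k p = C'.k p := by
  obtain ⟨ha, hb, hc⟩ := h.unique h' hp
  rw [ConjugateCoeffs.k, ConjugateCoeffs.k, ha, hb, hc,
    pd₂_congr hU hp fun p hp => (h.unique h' hp).2.1]

theorem IsQuadricOn.of_smul (h : IsQuadricOn U z) (hf0 : ∀ p ∈ U, f p ≠ 0)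
    (hz : ∀ p ∈ U, z p = f p • w p) : IsQuadricOn U w := by
  obtain ⟨M, h1, h2, h3⟩ := h
  refine ⟨M, h1, h2, fun p hp => ?_⟩
  have := h3 p hp
  rw [hz p hp, Matrix.mulVec_smul, smul_dotProduct, dotProduct_smul] at this
  simpa [hf0 p hp] using this

/-- Reduction of the assertions on a gauged lift to a fixed lift. -/
theorem conjugate_assertions_of_gauge (h : IsConjugateSystem U w C) (hU : IsOpen U)
    (hw : ContDiffOn 𝕜 ∞ w U) (hf : ContDiffOn 𝕜 ∞ f U) (hf0 : ∀ p ∈ U, f p ≠ 0)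
    (hz : ∀ p ∈ U, z p = f p • w p)
    (hpos : PosFocalQuadrics U w C → ∀ p ∈ U, C.h p = 0)
    (hneg : NegFocalQuadrics U w C → ∀ p ∈ U, C.k p = 0) :
    (∃ C', IsConjugateSystem U z C') ∧ ∀ C', IsConjugateSystem U z C' →
      (PosFocalQuadrics U z C' → ∀ p ∈ U, C'.h p = 0) ∧
      (NegFocalQuadrics U z C' → ∀ p ∈ U, C'.k p = 0) := by
  have hg := h.gauge hU hw hf hf0 hz
  refine ⟨⟨_, hg⟩, fun C' hC' => ⟨fun hQ p hp => ?_, fun hQ p hp => ?_⟩⟩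
  · rw [hC'.h_eq hg hU hp, gaugeCoeffs_h hU h.smooth_a hf hf0 hp]
    -- The Laplace transform scales by the same factor: z_t + a' z = f (w_t + a w) for a' = a -
    -- f_t/f.
    refine hpos ⟨hQ.1.of_smul hf0 hz, hQ.2.of_smul hf0 fun p hp => ?_⟩ p hp
    obtain ⟨-, e2, -⟩ := gauge_derivatives hU hw hf hz hp
    have hfp := hf0 p hp
    rw [laplacePos, laplacePos, e2, hz p hp, (hC'.unique hg hp).1]
    simp only [gaugeCoeffs]
    match_scalars <;> field_simp <;> ring
  · rw [hC'.k_eq hg hU hp, gaugeCoeffs_k hU h.smooth_b hf hf0 hp]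
    refine hneg ⟨hQ.1.of_smul hf0 hz, hQ.2.of_smul hf0 fun p hp => ?_⟩ p hp
    obtain ⟨e1, -⟩ := gauge_derivatives hU hw hf hz hp
    have hfp := hf0 p hp
    rw [laplaceNeg, laplaceNeg, e1, hz p hp, (hC'.unique hg hp).2.1]
    simp only [gaugeCoeffs]
    match_scalars <;> field_simp <;> ring

/-- Consequences of quadratic focal surfaces for a conjugate system whose coefficient `q` satisfies
`(log q)_{st} = 0`. -/
theorem IsConjugateSystem.focal_log (h : IsConjugateSystem U z C) (hU : IsOpen U)
    (hz : ContDiffOn 𝕜 ∞ z U) {μ ν : 𝕜 × 𝕜 → 𝕜} (hμ : ContDiffOn 𝕜 ∞ μ U)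
    (hν : ContDiffOn 𝕜 ∞ ν U) (hqμ : ∀ p ∈ U, pd₁ C.q p = μ p * C.q p)
    (hqν : ∀ p ∈ U, pd₂ C.q p = ν p * C.q p) (hμ2 : ∀ p ∈ U, pd₂ μ p = 0)
    (hν1 : ∀ p ∈ U, pd₁ ν p = 0) {p : 𝕜 × 𝕜} (hp : p ∈ U) :
    (PosFocalQuadrics U z C → C.h p ≠ 0 → pd₂ (pd₁ C.h) p * C.h p = pd₁ C.h p * pd₂ C.h p) ∧
    (NegFocalQuadrics U z C → C.k p ≠ 0 → pd₂ (pd₁ C.k) p * C.k p = pd₁ C.k p * pd₂ C.k p) := by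
  have hc := h.isConj hU hz
  refine ⟨fun hQ h0 => hc.laplaceInv_log hQ.1 hQ.2 hμ hqμ hμ2 hp h0, fun hQ h0 => ?_⟩
  -- For the negative transform the net is read with s and t exchanged. Then q becomes 1/q, with
  -- logarithmic t-derivative -ν.
  have hk : C.k = laplaceInv (0, 1) (swapCoeffs C) := by
    funext p
    simp only [ConjugateCoeffs.k, laplaceInv, swapCoeffs, pd₂, dd, mul_comm]
  have hν' : ∀ p ∈ U, dd (1, 0) (fun p => -ν p) p = 0 := fun p hp => by
    rw [(HasPD.of_smooth (v := (1, 0)) (w := (0, 1)) hU hν hp).neg.fst]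
    exact neg_eq_zero.2 (hν1 p hp)
  have := hc.swap.laplaceInv_log hQ.1 hQ.2 hν.neg (fun p hp => by
    have hq0 := h.q_ne_zero p hp
    refine ((HasPD.of_smooth' hU h.smooth_q hp).inv hq0).snd.trans ?_
    rw [hqν p hp]
    simp only [swapCoeffs]
    field_simp) hν' hp (by rw [← hk]; exact h0)
  rw [← hk] at this
  have hks : ContDiffOn 𝕜 ∞ C.k U := hk ▸ hc.swap.smooth_laplaceInv
  rw [← pd_comm hU hks hp, mul_comm (pd₁ C.k p)]
  exact this

end Gauge

/-! ### The F₂ system in conjugate coordinates and as a total system. -/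

section SystemF₂

variable {𝕜 : Type*} [RCLike 𝕜]

/-- The complement of the singular locus of the `F₂` system in the coordinates `(s, t)`. -/
def regularST₂ (𝕜 : Type*) [RCLike 𝕜] : Set (𝕜 × 𝕜) :=
  {p | p.1 ≠ 0 ∧ p.1 - 1 ≠ 0 ∧ p.2 ≠ 0 ∧ p.2 - 1 ≠ 0 ∧ p.1 - p.2 ≠ 0}

theorem mem_regularST₂ {p : 𝕜 × 𝕜} (h : T₂ p ∈ regularF₂ 𝕜) : p ∈ regularST₂ 𝕜 := by
  obtain ⟨h1, h2, h3, h4, h5⟩ := h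
  simp only [T₂] at h1 h2 h3 h4 h5
  -- `T₂` is total: at s = 0 division by zero gives x = 0, which the singular locus already
  -- contains. The other factors are 1 - x = (s-1)/s, 1 - y = t/s, 1 - x - y = (t-1)/s and y =
  -- (s-t)/s.
  have hs : p.1 ≠ 0 := fun h => h1 (by rw [h, div_zero])
  refine ⟨hs, fun h => h3 ?_, fun h => h4 ?_, fun h => h5 ?_, fun h => h2 ?_⟩
  · rw [sub_eq_zero] at h; rw [h]; simp
  · rw [h]; simp
  · rw [sub_eq_zero] at h; rw [h]; ring
  · rw [sub_eq_zero] at h; rw [← h, div_self hs, sub_self]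

/-- Coefficient of `w_s` in the separated form of the second equation. -/
noncomputable def sepCoeff₁ (α β₁ β₂ γ₁ : 𝕜) (p : 𝕜 × 𝕜) : 𝕜 :=
  β₂ * (2 * p.1 * p.2 - p.1 - p.2) / (p.1 - p.2) + ((2 * α + 2 - γ₁) * p.1 - (α - β₁ + 1))

/-- Coefficient of `w_t` in the separated form of the second equation. -/
noncomputable def sepCoeff₂ (α β₁ β₂ γ₁ γ₂ : 𝕜) (p : 𝕜 × 𝕜) : 𝕜 :=
  -(γ₂ - β₂) * (2 * p.1 * p.2 - p.1 - p.2) / (p.1 - p.2)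
    + ((2 * α + 2 - γ₁) * p.2 - (α - β₁ + 1))

/-- The coefficients of the conjugate system of `S_{F₂}`. -/
noncomputable def coeffsF₂ (α β₁ β₂ γ₁ γ₂ : 𝕜) : ConjugateCoeffs 𝕜 where
  a := fun p => -β₂ / (p.1 - p.2)
  b := fun p => (γ₂ - β₂) / (p.1 - p.2) - α / p.1
  c := fun p => α * β₂ / (p.1 * (p.1 - p.2))
  q := fun p => (p.1 * (p.1 - 1)) / (p.2 * (p.2 - 1))
  m := fun p => (sepCoeff₁ α β₁ β₂ γ₁ p - 2 * (p.1 - 1) * α) / (p.2 * (p.2 - 1))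
  n := fun p => sepCoeff₂ α β₁ β₂ γ₁ γ₂ p / (p.2 * (p.2 - 1))
  r := fun p => (α * (α + 1 - γ₁) + (p.1 - 1) * (α * (α + 1)) / p.1
    - sepCoeff₁ α β₁ β₂ γ₁ p * (α / p.1)) / (p.2 * (p.2 - 1))

theorem hasPD_comp_T₂ {E : Type*} [NormedAddCommGroup E] [NormedSpace 𝕜 E] {V : Set (𝕜 × 𝕜)}
    (hV : IsOpen V) {g : 𝕜 × 𝕜 → E} (hg : ContDiffOn 𝕜 ∞ g V) {p : 𝕜 × 𝕜} (hp : T₂ p ∈ V)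
    (hs : p.1 ≠ 0) :
    HasPD (1, 0) (0, 1) (fun p => g (T₂ p)) p
      ((-1 / p.1 ^ 2) • pd₁ g (T₂ p) + (p.2 / p.1 ^ 2) • pd₂ g (T₂ p))
      ((-1 / p.1) • pd₂ g (T₂ p)) := by
  refine (HasPD.comp (X := fun p => 1 / p.1) (Y := fun p => 1 - p.2 / p.1)
    (HasPD.of_smooth' hV hg hp) ((HasPD.const 1).div .x hs)
    ((HasPD.const 1).sub (HasPD.y.div .x hs))).congr ?_ ?_
  · change _ • pd₁ g (T₂ p) + _ • pd₂ g (T₂ p) = _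
    match_scalars <;> field_simp <;> ring
  · change _ • pd₁ g (T₂ p) + _ • pd₂ g (T₂ p) = _
    match_scalars <;> field_simp <;> ring

theorem smooth_T₂ {U : Set (𝕜 × 𝕜)} (h : U ⊆ regularST₂ 𝕜) : ContDiffOn 𝕜 ∞ (T₂ (𝕜 := 𝕜)) U := by
  have h0 : ∀ p ∈ U, p.1 ≠ 0 := fun p hp => (h hp).1
  exact (contDiffOn_const.div contDiffOn_fst h0).prodMk
    (contDiffOn_const.sub (contDiffOn_snd.div contDiffOn_fst h0))

variable {α β₁ β₂ γ₁ γ₂ : 𝕜} {U V : Set (𝕜 × 𝕜)} {F : 𝕜 × 𝕜 → (Fin 4 → 𝕜)}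

/-- The `F₂` system in the coordinates `(s, t)`. -/
theorem conjugate_equations_F₂ (hV : IsOpen V) (hF : ContDiffOn 𝕜 ∞ F V)
    (hS : SolvesAppellF₂ α β₁ β₂ γ₁ γ₂ V F) (hU : IsOpen U) (hUV : Set.MapsTo T₂ U V)
    (hreg : U ⊆ regularST₂ 𝕜) {p : 𝕜 × 𝕜} (hp : p ∈ U) :
    let w := fun p => F (T₂ p)
    let C := coeffsF₂ α β₁ β₂ γ₁ γ₂
    pd₂ (pd₁ w) p + C.a p • pd₁ w p + C.b p • pd₂ w p + C.c p • w p = 0 ∧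
    pd₂ (pd₂ w) p + C.q p • pd₁ (pd₁ w) p + C.m p • pd₁ w p + C.n p • pd₂ w p + C.r p • w p = 0 := by
  intro w C
  have hw : ∀ p ∈ U, _ := fun p hp => hasPD_comp_T₂ hV hF (hUV hp) (hreg hp).1
  have dx := hasPD_comp_T₂ hV (pd₁_smooth hV hF) (hUV hp) (hreg hp).1
  have dy := hasPD_comp_T₂ hV (pd₂_smooth hV hF) (hUV hp) (hreg hp).1
  obtain ⟨hs, hs1, ht, ht1, hd⟩ := hreg hp
  have hs2 : p.1 * p.1 ≠ 0 := mul_ne_zero hs hs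
  have hsq : ∀ p : 𝕜 × 𝕜, p.1 ^ 2 = p.1 * p.1 := fun p => sq _
  simp only [hsq] at hw
  have e1 := (((HasPD.const (-1 : 𝕜)).div (HasPD.x.mul HasPD.x) hs2).smul dx).add
    ((HasPD.y.div (HasPD.x.mul HasPD.x) hs2).smul dy) |>.congr_fun hU hp
    fun p hp => (hw p hp).fst.symm
  have e2 := (((HasPD.const (-1 : 𝕜)).div HasPD.x hs).smul dy).congr_fun hU hp
    fun p hp => (hw p hp).snd.symm
  obtain ⟨q1, q2⟩ := hS _ (hUV hp)
  have h1 : pd₁ w p = _ := (hw p hp).fst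
  have h2 : pd₂ w p = _ := (hw p hp).snd
  have h11 : pd₁ (pd₁ w) p = _ := e1.fst
  have h12 : pd₂ (pd₁ w) p = _ := e1.snd
  have h22 : pd₂ (pd₂ w) p = _ := e2.snd
  rw [pd_comm hV hF (hUV hp)] at h11
  rw [h1, h2, h11, h12, h22]
  simp only [w, C, coeffsF₂, sepCoeff₁, sepCoeff₂]
  simp only [T₂] at q1 q2 ⊢
  generalize pd₁ (pd₁ F) (1 / p.1, 1 - p.2 / p.1) = Fxx at *
  generalize pd₂ (pd₁ F) (1 / p.1, 1 - p.2 / p.1) = Fxy at *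
  generalize pd₂ (pd₂ F) (1 / p.1, 1 - p.2 / p.1) = Fyy at *
  generalize pd₁ F (1 / p.1, 1 - p.2 / p.1) = Fx at *
  generalize pd₂ F (1 / p.1, 1 - p.2 / p.1) = Fy at *
  generalize F (1 / p.1, 1 - p.2 / p.1) = F0 at *
  clear hw e1 e2 h1 h2 h11 h12 h22 dx dy
  obtain ⟨s, t⟩ := p
  simp only at *
  constructor
  -- The hyperbolic equation is a multiple of the second Appell equation alone, the factor being
  -- fixed by the coefficient of F_yy; the other conjugate equation needs both.
  · linear_combination (norm := skip) (-1 / (s * (s - t))) • q2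
    match_scalars <;> field_simp <;> ring
  · linear_combination (norm := skip) (1 / (s * (t * (t - 1)))) • q1
      + ((2 * s * t - s - t) / (t * (t - 1) * (s * (s - t)))) • q2
    match_scalars <;> field_simp <;> ring

theorem smooth_sepCoeff₁ (h : U ⊆ regularST₂ 𝕜) : ContDiffOn 𝕜 ∞ (sepCoeff₁ α β₁ β₂ γ₁) U := by
  have hd : ∀ p ∈ U, p.1 - p.2 ≠ 0 := fun p hp => (h hp).2.2.2.2
  unfold sepCoeff₁
  fun_prop (disch := assumption)

theorem smooth_sepCoeff₂ (h : U ⊆ regularST₂ 𝕜) : ContDiffOn 𝕜 ∞ (sepCoeff₂ α β₁ β₂ γ₁ γ₂) U := by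
  have hd : ∀ p ∈ U, p.1 - p.2 ≠ 0 := fun p hp => (h hp).2.2.2.2
  unfold sepCoeff₂
  fun_prop (disch := assumption)

theorem isConjugateSystem_F₂ (hV : IsOpen V) (hF : ContDiffOn 𝕜 ∞ F V)
    (hS : SolvesAppellF₂ α β₁ β₂ γ₁ γ₂ V F) (hU : IsOpen U) (hUV : Set.MapsTo T₂ U V)
    (hreg : U ⊆ regularST₂ 𝕜)
    (hframe : ∀ p ∈ U, LinearIndependent 𝕜 ![F (T₂ p), pd₁ (fun p => F (T₂ p)) p,
      pd₂ (fun p => F (T₂ p)) p, pd₁ (pd₁ fun p => F (T₂ p)) p]) :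
    IsConjugateSystem U (fun p => F (T₂ p)) (coeffsF₂ α β₁ β₂ γ₁ γ₂) := by
  have hs : ∀ p ∈ U, p.1 ≠ 0 := fun p hp => (hreg hp).1
  have hs1 : ∀ p ∈ U, p.1 - 1 ≠ 0 := fun p hp => (hreg hp).2.1
  have ht : ∀ p ∈ U, p.2 ≠ 0 := fun p hp => (hreg hp).2.2.1
  have ht1 : ∀ p ∈ U, p.2 - 1 ≠ 0 := fun p hp => (hreg hp).2.2.2.1
  have hd : ∀ p ∈ U, p.1 - p.2 ≠ 0 := fun p hp => (hreg hp).2.2.2.2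
  have htt : ∀ p ∈ U, p.2 * (p.2 - 1) ≠ 0 := fun p hp => mul_ne_zero (ht p hp) (ht1 p hp)
  have hsd : ∀ p ∈ U, p.1 * (p.1 - p.2) ≠ 0 := fun p hp => mul_ne_zero (hs p hp) (hd p hp)
  have h1 := smooth_sepCoeff₁ (α := α) (β₁ := β₁) (β₂ := β₂) (γ₁ := γ₁) hreg
  have h2 := smooth_sepCoeff₂ (α := α) (β₁ := β₁) (β₂ := β₂) (γ₁ := γ₁) (γ₂ := γ₂) hreg
  refine ⟨?_, ?_, ?_, ?_, ?_, ?_, ?_, fun p hp => ?_, hframe,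
    fun p hp => (conjugate_equations_F₂ hV hF hS hU hUV hreg hp).1,
    fun p hp => (conjugate_equations_F₂ hV hF hS hU hUV hreg hp).2⟩
  · unfold coeffsF₂; fun_prop (disch := assumption)
  · unfold coeffsF₂; fun_prop (disch := assumption)
  · unfold coeffsF₂; fun_prop (disch := assumption)
  · unfold coeffsF₂; fun_prop (disch := assumption)
  · unfold coeffsF₂; fun_prop (disch := assumption)
  · unfold coeffsF₂; fun_prop (disch := assumption)
  · unfold coeffsF₂; fun_prop (disch := assumption)
  · exact div_ne_zero (mul_ne_zero (hs p hp) (hs1 p hp)) (htt p hp)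

theorem hasPD_sepCoeff₁ {p : 𝕜 × 𝕜} (hd : p.1 - p.2 ≠ 0) :
    HasPD (1, 0) (0, 1) (sepCoeff₁ α β₁ β₂ γ₁) p
      (-2 * β₂ * (p.2 * (p.2 - 1)) / (p.1 - p.2) ^ 2 + (2 * α + 2 - γ₁))
      (2 * β₂ * (p.1 * (p.1 - 1)) / (p.1 - p.2) ^ 2) := by
  refine ((((HasPD.const β₂).mul ((((HasPD.const 2).mul .x).mul .y).sub .x |>.sub .y)).div
    (HasPD.x.sub .y) hd).add (((HasPD.const (2 * α + 2 - γ₁)).mul .x).sub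
      (HasPD.const (α - β₁ + 1)))).congr ?_ ?_ <;> field_simp <;> ring

theorem hasPD_sepCoeff₂ {p : 𝕜 × 𝕜} (hd : p.1 - p.2 ≠ 0) :
    HasPD (1, 0) (0, 1) (sepCoeff₂ α β₁ β₂ γ₁ γ₂) p
      (2 * (γ₂ - β₂) * (p.2 * (p.2 - 1)) / (p.1 - p.2) ^ 2)
      (-2 * (γ₂ - β₂) * (p.1 * (p.1 - 1)) / (p.1 - p.2) ^ 2 + (2 * α + 2 - γ₁)) := by
  refine ((((HasPD.const (-(γ₂ - β₂))).mul
    ((((HasPD.const 2).mul .x).mul .y).sub .x |>.sub .y)).div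
    (HasPD.x.sub .y) hd).add (((HasPD.const (2 * α + 2 - γ₁)).mul .y).sub
      (HasPD.const (α - β₁ + 1)))).congr ?_ ?_ <;> field_simp <;> ring

/-- First matrix of the total differential system equivalent to the `F₂` system. -/
noncomputable def totalP₂ (α β₁ β₂ γ₁ γ₂ : 𝕜) (p : 𝕜 × 𝕜) : Matrix (Fin 4) (Fin 4) 𝕜 :=
  !![α / p.1, 1, 0, 0;
    0, α / p.1 - sepCoeff₁ α β₁ β₂ γ₁ p / (p.1 * (p.1 - 1)), 0, 1 / (p.1 * (p.1 - 1));
    0, β₂ / (p.1 - p.2), α / p.1 - (γ₂ - β₂) / (p.1 - p.2), 0;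
    -(γ₂ - β₂) * (α * (α + 1 - γ₁)) / (p.1 - p.2),
      -(α * (α + 1 - γ₁)) - p.2 * (p.2 - 1) * (β₂ * (1 + β₂)) / (p.1 - p.2) ^ 2
        - sepCoeff₂ α β₁ β₂ γ₁ γ₂ p * β₂ / (p.1 - p.2),
      p.2 * (p.2 - 1) * ((γ₂ - β₂) * (β₂ - 1)) / (p.1 - p.2) ^ 2,
      α / p.1 - (γ₂ - β₂) / (p.1 - p.2)]

/-- Second matrix of the total differential system equivalent to the `F₂` system. -/
noncomputable def totalQ₂ (α β₁ β₂ γ₁ γ₂ : 𝕜) (p : 𝕜 × 𝕜) : Matrix (Fin 4) (Fin 4) 𝕜 :=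
  !![0, 0, 1, 0;
    0, β₂ / (p.1 - p.2), -(γ₂ - β₂) / (p.1 - p.2), 0;
    -(α * (α + 1 - γ₁)) / (p.2 * (p.2 - 1)), 0,
      -sepCoeff₂ α β₁ β₂ γ₁ γ₂ p / (p.2 * (p.2 - 1)), -1 / (p.2 * (p.2 - 1));
    0, p.1 * (p.1 - 1) * (β₂ * (1 - (γ₂ - β₂))) / (p.1 - p.2) ^ 2,
      p.1 * (p.1 - 1) * ((γ₂ - β₂) * (1 + (γ₂ - β₂))) / (p.1 - p.2) ^ 2
        - sepCoeff₁ α β₁ β₂ γ₁ p * (γ₂ - β₂) / (p.1 - p.2),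
      β₂ / (p.1 - p.2)]

/-- The frame `w, w_s - (α / s) w, w_t, -(t (t - 1) w_tt + l w_t + ω w)`. -/
noncomputable def frameF₂ (α β₁ β₂ γ₁ γ₂ : 𝕜) (w : 𝕜 × 𝕜 → (Fin 4 → 𝕜)) :
    Fin 4 → 𝕜 × 𝕜 → (Fin 4 → 𝕜) :=
  ![w, fun p => pd₁ w p - (α / p.1) • w p, pd₂ w,
    fun p => -((p.2 * (p.2 - 1)) • pd₂ (pd₂ w) p + sepCoeff₂ α β₁ β₂ γ₁ γ₂ p • pd₂ w p
      + (α * (α + 1 - γ₁)) • w p)]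

/-- The shift by α/s in y₁ removes w from the t-derivative of y₁. By the separated second equation,
y₃ has one expression in t-derivatives and another in s-derivatives of y₁. Differentiating the first
in s and the second in t produces only third derivatives that the hyperbolic equation controls, so
the system closes at rank four. -/
theorem isTotalSystem_F₂ (hU : IsOpen U) (hreg : U ⊆ regularST₂ 𝕜) {w : 𝕜 × 𝕜 → (Fin 4 → 𝕜)}
    (hw : ContDiffOn 𝕜 ∞ w U)
    (hyp : let C := coeffsF₂ α β₁ β₂ γ₁ γ₂; ∀ p ∈ U,
      pd₂ (pd₁ w) p + C.a p • pd₁ w p + C.b p • pd₂ w p + C.c p • w p = 0)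
    (sec : let C := coeffsF₂ α β₁ β₂ γ₁ γ₂; ∀ p ∈ U,
      pd₂ (pd₂ w) p + C.q p • pd₁ (pd₁ w) p + C.m p • pd₁ w p + C.n p • pd₂ w p
        + C.r p • w p = 0) :
    IsTotalSystem U (totalP₂ α β₁ β₂ γ₁ γ₂) (totalQ₂ α β₁ β₂ γ₁ γ₂)
      (frameF₂ α β₁ β₂ γ₁ γ₂ w) := by
  have hs : ∀ p ∈ U, p.1 ≠ 0 := fun p hp => (hreg hp).1
  have hs1 : ∀ p ∈ U, p.1 - 1 ≠ 0 := fun p hp => (hreg hp).2.1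
  have ht : ∀ p ∈ U, p.2 ≠ 0 := fun p hp => (hreg hp).2.2.1
  have ht1 : ∀ p ∈ U, p.2 - 1 ≠ 0 := fun p hp => (hreg hp).2.2.2.1
  have hd : ∀ p ∈ U, p.1 - p.2 ≠ 0 := fun p hp => (hreg hp).2.2.2.2
  have htt : ∀ p ∈ U, p.2 * (p.2 - 1) ≠ 0 := fun p hp => mul_ne_zero (ht p hp) (ht1 p hp)
  have hss : ∀ p ∈ U, p.1 * (p.1 - 1) ≠ 0 := fun p hp => mul_ne_zero (hs p hp) (hs1 p hp)
  have hdd : ∀ p ∈ U, (p.1 - p.2) ^ 2 ≠ 0 := fun p hp => pow_ne_zero 2 (hd p hp)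
  have c1 := (smooth_sepCoeff₁ (α := α) (β₁ := β₁) (β₂ := β₂) (γ₁ := γ₁) hreg).continuousOn
  have c2 := (smooth_sepCoeff₂ (α := α) (β₁ := β₁) (β₂ := β₂) (γ₁ := γ₁) (γ₂ := γ₂)
    hreg).continuousOn
  have sl2 := smooth_sepCoeff₂ (α := α) (β₁ := β₁) (β₂ := β₂) (γ₁ := γ₁) (γ₂ := γ₂) hreg
  refine ⟨fun i j => ?_, fun i j => ?_, ?_⟩
  · fin_cases i <;> fin_cases j <;> simp [totalP₂] <;> fun_prop (disch := assumption)
  · fin_cases i <;> fin_cases j <;> simp [totalQ₂] <;> fun_prop (disch := assumption)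
  set l₁ := sepCoeff₁ α β₁ β₂ γ₁ with hl₁
  set l₂ := sepCoeff₂ α β₁ β₂ γ₁ γ₂ with hl₂
  set y₁ : 𝕜 × 𝕜 → (Fin 4 → 𝕜) := fun p => pd₁ w p - (α / p.1) • w p with hy₁
  set y₂ : 𝕜 × 𝕜 → (Fin 4 → 𝕜) := pd₂ w with hy₂
  set y₃ : 𝕜 × 𝕜 → (Fin 4 → 𝕜) := fun p => -((p.2 * (p.2 - 1)) • pd₂ (pd₂ w) p
    + l₂ p • pd₂ w p + (α * (α + 1 - γ₁)) • w p) with hy₃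
  have s₂ : ContDiffOn 𝕜 ∞ y₂ U := pd₂_smooth hU hw
  have s₁ : ContDiffOn 𝕜 ∞ y₁ U :=
    (pd₁_smooth hU hw).sub ((contDiffOn_const.div contDiffOn_fst hs).smul hw)
  have d₀ : ∀ p ∈ U, HasPD (1, 0) (0, 1) w p (y₁ p + (α / p.1) • w p) (y₂ p) := fun p hp =>
    (HasPD.of_smooth' hU hw hp).congr (by simp [hy₁]) rfl
  have d₁ : ∀ p ∈ U, HasPD (1, 0) (0, 1) y₁ p
      ((α / p.1 - l₁ p / (p.1 * (p.1 - 1))) • y₁ p + (1 / (p.1 * (p.1 - 1))) • y₃ p)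
      ((β₂ / (p.1 - p.2)) • y₁ p + (-(γ₂ - β₂) / (p.1 - p.2)) • y₂ p) := fun p hp => by
    have h0 := hs p hp
    have h1 := hs1 p hp
    have h2 := ht p hp
    have h3 := ht1 p hp
    have h4 := hd p hp
    have e1 := hyp p hp
    have e2 := sec p hp
    simp only [coeffsF₂, ← hl₁, ← hl₂] at e1 e2
    refine ((HasPD.of_smooth' hU (pd₁_smooth hU hw) hp).sub
      (((HasPD.const α).div .x h0).smul (HasPD.of_smooth' hU hw hp))).congr ?_ ?_
    · simp only [hy₃, hy₁]
      linear_combination (norm := skip) ((p.2 * (p.2 - 1)) / (p.1 * (p.1 - 1))) • e2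
      match_scalars <;> field_simp <;> ring
    · simp only [hy₁, hy₂]
      linear_combination (norm := skip) (1 : 𝕜) • e1
      match_scalars <;> field_simp <;> ring
  have d₂ : ∀ p ∈ U, HasPD (1, 0) (0, 1) y₂ p
      ((β₂ / (p.1 - p.2)) • y₁ p + (α / p.1 - (γ₂ - β₂) / (p.1 - p.2)) • y₂ p)
      ((-(α * (α + 1 - γ₁)) / (p.2 * (p.2 - 1))) • w p + (-l₂ p / (p.2 * (p.2 - 1))) • y₂ p
        + (-1 / (p.2 * (p.2 - 1))) • y₃ p) := fun p hp => by
    have h0 := hs p hp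
    have h2 := ht p hp
    have h3 := ht1 p hp
    have h4 := hd p hp
    have e1 := hyp p hp
    simp only [coeffsF₂] at e1
    refine (HasPD.of_smooth' hU s₂ hp).congr ?_ ?_
    · rw [hy₂, pd_comm hU hw hp]
      simp only [hy₁]
      linear_combination (norm := skip) (1 : 𝕜) • e1
      match_scalars <;> field_simp <;> ring
    · simp only [hy₃, hy₂]
      match_scalars <;> field_simp <;> ring
  have d₃ : ∀ p ∈ U, HasPD (1, 0) (0, 1) y₃ p
      ((-(γ₂ - β₂) * (α * (α + 1 - γ₁)) / (p.1 - p.2)) • w p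
        + (-(α * (α + 1 - γ₁)) - p.2 * (p.2 - 1) * (β₂ * (1 + β₂)) / (p.1 - p.2) ^ 2
        - l₂ p * β₂ / (p.1 - p.2)) • y₁ p
        + (p.2 * (p.2 - 1) * ((γ₂ - β₂) * (β₂ - 1)) / (p.1 - p.2) ^ 2) • y₂ p
        + (α / p.1 - (γ₂ - β₂) / (p.1 - p.2)) • y₃ p)
      ((p.1 * (p.1 - 1) * (β₂ * (1 - (γ₂ - β₂))) / (p.1 - p.2) ^ 2) • y₁ p
        + (p.1 * (p.1 - 1) * ((γ₂ - β₂) * (1 + (γ₂ - β₂))) / (p.1 - p.2) ^ 2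
        - l₁ p * (γ₂ - β₂) / (p.1 - p.2)) • y₂ p + (β₂ / (p.1 - p.2)) • y₃ p) := fun p hp => by
    have h0 := hs p hp
    have h1 := hs1 p hp
    have h2 := ht p hp
    have h3 := ht1 p hp
    have h4 := hd p hp
    have f₂ := HasPD.of_smooth' hU (pd₂_smooth hU s₂) hp
    have f₁ := HasPD.of_smooth' hU (pd₁_smooth hU s₁) hp
    have g₂ := HasPD.eq_of_eqOn hU hp (fun p hp => (d₂ p hp).fst)
      (HasPD.of_smooth' hU (pd₁_smooth hU s₂) hp)
      ((((HasPD.const β₂).div (HasPD.x.sub .y) h4).smul (d₁ p hp)).add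
      ((((HasPD.const α).div .x h0).sub ((HasPD.const (γ₂ - β₂)).div (HasPD.x.sub .y) h4)).smul
        (d₂ p hp)))
    have g₁ := HasPD.eq_of_eqOn hU hp (fun p hp => (d₁ p hp).snd)
      (HasPD.of_smooth' hU (pd₂_smooth hU s₁) hp)
      ((((HasPD.const β₂).div (HasPD.x.sub .y) h4).smul (d₁ p hp)).add
      (((HasPD.const (-(γ₂ - β₂))).div (HasPD.x.sub .y) h4).smul (d₂ p hp)))
    have k₂ := (pd_comm hU s₂ hp).trans g₂.2
    have k₁ := (pd_comm hU s₁ hp).symm.trans g₁.1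
    have t1 := (((((HasPD.y.mul (HasPD.y.sub (HasPD.const 1))).smul f₂).add
      ((hasPD_sepCoeff₂ (α := α) (β₁ := β₁) (β₂ := β₂) (γ₁ := γ₁) (γ₂ := γ₂) h4).smul
        (HasPD.of_smooth' hU s₂ hp))).add
      ((HasPD.const (α * (α + 1 - γ₁))).smul (d₀ p hp))).neg)
    -- The expression of y₃ by s-derivatives: y₃ = s(s-1) ∂_s y₁ + (l₁ - (s-1)α) y₁. It is used only
    -- for the t-derivative, while `t1` serves for the s-derivative.
    have t2 := (((HasPD.x.mul (HasPD.x.sub (HasPD.const 1))).smul f₁).add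
      (((hasPD_sepCoeff₁ (α := α) (β₁ := β₁) (β₂ := β₂) (γ₁ := γ₁) h4).sub
        ((HasPD.x.sub (HasPD.const 1)).mul (HasPD.const α))).smul (d₁ p hp))).congr_fun
        (g := y₃) hU hp fun p hp => by
        have h0 := hs p hp
        have h1 := hs1 p hp
        rw [show pd₁ y₁ p = _ from (d₁ p hp).fst]
        match_scalars <;> field_simp <;> ring
    refine ⟨t1.diff, t1.fst.trans ?_, t2.snd.trans ?_⟩
    · rw [k₂, show pd₁ y₂ p = _ from (d₂ p hp).fst, show pd₂ y₂ p = _ from (d₂ p hp).snd]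
      match_scalars <;> field_simp <;> ring
    · rw [k₁, show pd₁ y₁ p = _ from (d₁ p hp).fst]
      match_scalars <;> field_simp <;> ring
  intro p hp i
  fin_cases i
  · refine (d₀ p hp).congr ?_ ?_ <;>
    simp [Fin.sum_univ_four, totalP₂, totalQ₂, frameF₂, ← hy₁, ← hy₂, add_comm]
  · refine (d₁ p hp).congr ?_ ?_ <;>
    simp [Fin.sum_univ_four, totalP₂, totalQ₂, frameF₂, hy₁, hy₂, hy₃, hl₁, hl₂]
  · refine (d₂ p hp).congr ?_ ?_ <;>
    simp [Fin.sum_univ_four, totalP₂, totalQ₂, frameF₂, hy₁, hy₂, hy₃, hl₂]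
  · refine (d₃ p hp).congr ?_ ?_ <;>
    simp [Fin.sum_univ_four, totalP₂, totalQ₂, frameF₂, hy₁, hy₂, hy₃, hl₁, hl₂]

end SystemF₂

/-! ### The surface S_{F₂}: quadric criterion and focal surfaces. -/

section SurfaceF₂

variable {𝕜 : Type*} [RCLike 𝕜] {α β₁ β₂ γ₁ γ₂ : 𝕜} {U V : Set (𝕜 × 𝕜)}
  {F : 𝕜 × 𝕜 → (Fin 4 → 𝕜)}

/-- The inverse of `T₂`. -/
noncomputable def T₂inv (p : 𝕜 × 𝕜) : 𝕜 × 𝕜 := (1 / p.1, (1 - p.2) / p.1)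

theorem T₂_T₂inv {p : 𝕜 × 𝕜} (h : p.1 ≠ 0) : T₂ (T₂inv p) = p := by
  ext
  · simp [T₂, T₂inv]
  · simp only [T₂, T₂inv]; field_simp; ring

theorem T₂inv_T₂ {p : 𝕜 × 𝕜} (h : p.1 ≠ 0) : T₂inv (T₂ p) = p := by
  ext
  · simp [T₂, T₂inv]
  · simp only [T₂, T₂inv]; field_simp; ring

theorem preimage_T₂_eq (hV : V ⊆ regularF₂ 𝕜) : T₂ ⁻¹' V = T₂inv '' V := by
  ext p
  constructor
  · intro hp
    exact ⟨T₂ p, hp, T₂inv_T₂ (mem_regularST₂ (hV hp)).1⟩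
  · rintro ⟨q, hq, rfl⟩
    rw [Set.mem_preimage, T₂_T₂inv (hV hq).1]
    exact hq

theorem isPreconnected_preimage_T₂ (hV : V ⊆ regularF₂ 𝕜) (hc : IsPreconnected V) :
    IsPreconnected (T₂ ⁻¹' V) := by
  rw [preimage_T₂_eq hV]
  have h0 : ∀ p ∈ V, p.1 ≠ 0 := fun p hp => (hV hp).1
  exact hc.image _ ((continuousOn_const.div continuousOn_fst h0).prodMk
    ((continuousOn_const.sub continuousOn_snd).div continuousOn_fst h0))

/-- Continuity of `T₂` is available only on s ≠ 0, but the preimage of a regular set lies there. -/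
theorem isOpen_preimage_T₂ (hV : V ⊆ regularF₂ 𝕜) (ho : IsOpen V) :
    IsOpen (T₂ ⁻¹' V) := by
  have h0 : IsOpen {p : 𝕜 × 𝕜 | p.1 ≠ 0} := isOpen_ne.preimage continuous_fst
  have hc : ContinuousOn (T₂ (𝕜 := 𝕜)) {p | p.1 ≠ 0} :=
    (continuousOn_const.div continuousOn_fst fun _ h => h).prodMk
      (continuousOn_const.sub (continuousOn_snd.div continuousOn_fst fun _ h => h))
  have := hc.isOpen_inter_preimage h0 ho
  have he : {p : 𝕜 × 𝕜 | p.1 ≠ 0} ∩ T₂ ⁻¹' V = T₂ ⁻¹' V :=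
    Set.inter_eq_right.2 fun p hp => (mem_regularST₂ (hV hp)).1
  rwa [he] at this

/-- An independent solution of the total differential system gives an independent conjugate
frame. -/
theorem frame_F₂ {w : 𝕜 × 𝕜 → (Fin 4 → 𝕜)}
    (sec : let C := coeffsF₂ α β₁ β₂ γ₁ γ₂; ∀ p ∈ U,
      pd₂ (pd₂ w) p + C.q p • pd₁ (pd₁ w) p + C.m p • pd₁ w p + C.n p • pd₂ w p
        + C.r p • w p = 0)
    {p : 𝕜 × 𝕜} (hp : p ∈ U)
    (hi : LinearIndependent 𝕜 (fun i => frameF₂ α β₁ β₂ γ₁ γ₂ w i p)) :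
    LinearIndependent 𝕜 ![w p, pd₁ w p, pd₂ w p, pd₁ (pd₁ w) p] := by
  refine dual_frame fun x k0 k1 k2 k3 => eq_zero_of_dual hi (x := x) ?_
  have k4 := congrArg (fun v => v ⬝ᵥ x) (sec p hp)
  simp only [add_dotProduct, smul_dotProduct, k0, k1, k2, k3, smul_zero, add_zero,
    zero_dotProduct] at k4
  simp [Fin.forall_fin_succ, frameF₂, add_dotProduct, sub_dotProduct, smul_dotProduct, k0, k1, k2,
    k4]

/-- The conformal metric of the quadric `S_{F₂}`. -/
noncomputable def metric₂ (β ρ : 𝕜) (p : 𝕜 × 𝕜) : Matrix (Fin 4) (Fin 4) 𝕜 :=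
  !![0, 0, 0, -1;
    0, 1 / (p.1 * (p.1 - 1)), 0, β / (p.1 - p.2);
    0, 0, -1 / (p.2 * (p.2 - 1)), -β / (p.1 - p.2);
    -1, β / (p.1 - p.2), -β / (p.1 - p.2), ρ + β ^ 2 * (p.1 + p.2 - 1) / (p.1 - p.2)]

theorem det_adapted (e g h a b c : 𝕜) :
    (!![0, 0, 0, -1; 0, e, g, a; 0, g, h, b; -1, a, b, c] : Matrix (Fin 4) (Fin 4) 𝕜).det =
      g ^ 2 - e * h := by
  rw [Matrix.det_succ_row_zero]
  simp [Fin.sum_univ_four, Matrix.det_fin_three, Matrix.submatrix, Fin.succAbove]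
  ring

theorem symm_adapted (e g h a b c : 𝕜) :
    (!![0, 0, 0, -1; 0, e, g, a; 0, g, h, b; -1, a, b, c] : Matrix (Fin 4) (Fin 4) 𝕜).IsSymm := by
  ext i j
  fin_cases i <;> fin_cases j <;> simp

set_option maxHeartbeats 4000000 in
-- This is conformal invariance of `metric₂`, the hypothesis of `IsTotalSystem.isQuadricOn`. The
-- diagonal entries have ratio -q, as the metric of a conjugate net on a quadric must, and the
-- scaling factors are the ones forced by the constant entry -1.
theorem hasPD_metric₂ (hα : α = β₁ + β₂ - 1 / 2) (hγ₁ : γ₁ = 2 * β₁) (hγ₂ : γ₂ = 2 * β₂)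
    {p : 𝕜 × 𝕜} (hp : p ∈ regularST₂ 𝕜) (i j : Fin 4) :
    HasPD (1, 0) (0, 1) (fun p => metric₂ β₂ (α * (α + 1 - γ₁)) p i j) p
      (gramDeriv (totalP₂ α β₁ β₂ γ₁ γ₂ p) (metric₂ β₂ (α * (α + 1 - γ₁)) p) i j
        - (2 * α / p.1 - 2 * β₂ / (p.1 - p.2)) * metric₂ β₂ (α * (α + 1 - γ₁)) p i j)
      (gramDeriv (totalQ₂ α β₁ β₂ γ₁ γ₂ p) (metric₂ β₂ (α * (α + 1 - γ₁)) p) i j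
        - (2 * β₂ / (p.1 - p.2)) * metric₂ β₂ (α * (α + 1 - γ₁)) p i j) := by
  obtain ⟨hs, hs1, ht, ht1, hd⟩ := hp
  have d11 := (HasPD.const (1 : 𝕜)).div (HasPD.x.mul (HasPD.x.sub (HasPD.const 1)))
    (mul_ne_zero hs hs1)
  have d22 := (HasPD.const (-1 : 𝕜)).div (HasPD.y.mul (HasPD.y.sub (HasPD.const 1)))
    (mul_ne_zero ht ht1)
  have d13 := (HasPD.const β₂).div (HasPD.x.sub HasPD.y) hd
  have d23 := (HasPD.const (-β₂)).div (HasPD.x.sub HasPD.y) hd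
  have d33 := (HasPD.const (α * (α + 1 - γ₁))).add (((HasPD.const (β₂ ^ 2)).mul
    ((HasPD.x.add .y).sub (HasPD.const 1))).div (HasPD.x.sub HasPD.y) hd)
  have d0 := HasPD.const (v := (1, 0)) (w := (0, 1)) (p := p) (0 : 𝕜)
  have dm := HasPD.const (v := (1, 0)) (w := (0, 1)) (p := p) (-1 : 𝕜)
  obtain rfl := hα
  obtain rfl := hγ₁
  obtain rfl := hγ₂
  fin_cases i <;> fin_cases j
  all_goals
    first
    | refine d0.congr ?_ ?_
    | refine dm.congr ?_ ?_
    | refine d11.congr ?_ ?_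
    | refine d22.congr ?_ ?_
    | refine d13.congr ?_ ?_
    | refine d23.congr ?_ ?_
    | refine d33.congr ?_ ?_
  all_goals
    simp [gramDeriv, Fin.sum_univ_four, metric₂, totalP₂, totalQ₂]
  all_goals
    try simp only [sepCoeff₁, sepCoeff₂]
    field_simp
    ring

theorem infinite_slice (hU : IsOpen U) {p : 𝕜 × 𝕜} (hp : p ∈ U) :
    {x : 𝕜 | (x, p.2) ∈ U}.Infinite := by
  have h : {x : 𝕜 | (x, p.2) ∈ U} ∈ nhds p.1 :=
    (Continuous.prodMk_left p.2).continuousAt.preimage_mem_nhds (hU.mem_nhds hp)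
  exact infinite_of_mem_nhds p.1 h

theorem IsConjugateSystem.mono {U' : Set (𝕜 × 𝕜)} {z : 𝕜 × 𝕜 → (Fin 4 → 𝕜)}
    {C : ConjugateCoeffs 𝕜} (h : IsConjugateSystem U z C) (hs : U' ⊆ U) :
    IsConjugateSystem U' z C :=
  ⟨h.smooth_a.mono hs, h.smooth_b.mono hs, h.smooth_c.mono hs, h.smooth_q.mono hs,
    h.smooth_m.mono hs, h.smooth_n.mono hs, h.smooth_r.mono hs, fun p hp => h.q_ne_zero p (hs hp),
    fun p hp => h.frame p (hs hp), fun p hp => h.hyperbolic p (hs hp),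
    fun p hp => h.second p (hs hp)⟩

theorem hasPD_q_F₂ {p : 𝕜 × 𝕜} (hp : p ∈ regularST₂ 𝕜) :
    HasPD (1, 0) (0, 1) (coeffsF₂ α β₁ β₂ γ₁ γ₂).q p
      ((2 * p.1 - 1) / (p.2 * (p.2 - 1)))
      (-(p.1 * (p.1 - 1)) * (2 * p.2 - 1) / (p.2 * (p.2 - 1)) ^ 2) := by
  obtain ⟨hs, hs1, ht, ht1, hd⟩ := hp
  refine ((HasPD.x.mul (HasPD.x.sub (HasPD.const 1))).div
    (HasPD.y.mul (HasPD.y.sub (HasPD.const 1))) (mul_ne_zero ht ht1)).congr ?_ ?_ <;>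
  field_simp <;> ring

theorem hasPD_a_F₂ {p : 𝕜 × 𝕜} (hp : p ∈ regularST₂ 𝕜) :
    HasPD (1, 0) (0, 1) (coeffsF₂ α β₁ β₂ γ₁ γ₂).a p
      (β₂ / (p.1 - p.2) ^ 2) (-β₂ / (p.1 - p.2) ^ 2) := by
  obtain ⟨hs, hs1, ht, ht1, hd⟩ := hp
  refine ((HasPD.const (-β₂)).div (HasPD.x.sub HasPD.y) hd).congr ?_ ?_ <;>
  field_simp <;> ring

theorem hasPD_b_F₂ {p : 𝕜 × 𝕜} (hp : p ∈ regularST₂ 𝕜) :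
    HasPD (1, 0) (0, 1) (coeffsF₂ α β₁ β₂ γ₁ γ₂).b p
      (-(γ₂ - β₂) / (p.1 - p.2) ^ 2 + α / p.1 ^ 2) ((γ₂ - β₂) / (p.1 - p.2) ^ 2) := by
  obtain ⟨hs, hs1, ht, ht1, hd⟩ := hp
  refine (((HasPD.const (γ₂ - β₂)).div (HasPD.x.sub HasPD.y) hd).sub
    ((HasPD.const α).div .x hs)).congr ?_ ?_ <;>
  field_simp <;> ring

theorem h_F₂ {p : 𝕜 × 𝕜} (hp : p ∈ regularST₂ 𝕜) :
    (coeffsF₂ α β₁ β₂ γ₁ γ₂).h p = β₂ * (1 + β₂ - γ₂) / (p.1 - p.2) ^ 2 := by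
  rw [ConjugateCoeffs.h, show pd₁ _ p = _ from (hasPD_a_F₂ hp).fst]
  obtain ⟨hs, hs1, ht, ht1, hd⟩ := hp
  simp only [coeffsF₂]
  field_simp
  ring

theorem k_F₂ {p : 𝕜 × 𝕜} (hp : p ∈ regularST₂ 𝕜) :
    (coeffsF₂ α β₁ β₂ γ₁ γ₂).k p = (1 - β₂) * (γ₂ - β₂) / (p.1 - p.2) ^ 2 := by
  rw [ConjugateCoeffs.k, show pd₂ _ p = _ from (hasPD_b_F₂ hp).snd]
  obtain ⟨hs, hs1, ht, ht1, hd⟩ := hp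
  simp only [coeffsF₂]
  field_simp
  ring

/-- A multiple of `(s - t)⁻²` with vanishing mixed logarithmic derivative is zero. -/
theorem eq_zero_of_log_inv_sq (hU : IsOpen U) (hreg : U ⊆ regularST₂ 𝕜) {φ : 𝕜 × 𝕜 → 𝕜} {c : 𝕜}
    (hφ : ∀ p ∈ U, φ p = c / (p.1 - p.2) ^ 2) {p : 𝕜 × 𝕜} (hp : p ∈ U)
    (h : φ p ≠ 0 → pd₂ (pd₁ φ) p * φ p = pd₁ φ p * pd₂ φ p) : φ p = 0 := by
  by_contra h0
  have h := h h0
  have e1 : ∀ p ∈ U, HasPD (1, 0) (0, 1) φ p (-2 * c / (p.1 - p.2) ^ 3)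
      (2 * c / (p.1 - p.2) ^ 3) := fun p hp => by
    obtain ⟨hs, hs1, ht, ht1, hd⟩ := hreg hp
    refine (((HasPD.const c).div ((HasPD.x.sub .y).mul (HasPD.x.sub .y))
      (mul_ne_zero hd hd)).congr_fun hU hp fun p hp => ?_).congr ?_ ?_
    · rw [hφ p hp, sq]
    all_goals field_simp; ring
  obtain ⟨hs, hs1, ht, ht1, hd⟩ := hreg hp
  have e2 : HasPD (1, 0) (0, 1) (pd₁ φ) p (6 * c / (p.1 - p.2) ^ 4)
      (-6 * c / (p.1 - p.2) ^ 4) := by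
    refine (((HasPD.const (-2 * c)).div ((HasPD.x.sub .y).mul ((HasPD.x.sub .y).mul
      (HasPD.x.sub .y))) (mul_ne_zero hd (mul_ne_zero hd hd))).congr_fun hU hp
      fun p hp => ?_).congr ?_ ?_
    · rw [show pd₁ φ p = _ from (e1 p hp).fst]; ring_nf
    all_goals field_simp; ring
  rw [show pd₂ (pd₁ φ) p = _ from e2.snd, show pd₁ φ p = _ from (e1 p hp).fst,
    show pd₂ φ p = _ from (e1 p hp).snd, hφ p hp] at h
  rw [hφ p hp] at h0
  have hc : c ≠ 0 := fun hc => h0 (by rw [hc, zero_div])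
  -- Up to the common factor (s-t)⁻⁶ the identity reads -6c² = -4c².
  field_simp at h
  norm_num at h

/-- Because q = s(s-1)/(t(t-1)) separates, its logarithmic derivatives μ and ν depend on one
variable each. The criterion on log h then meets h and k of the form c/(s-t)². -/
theorem focal_F₂ {w : 𝕜 × 𝕜 → (Fin 4 → 𝕜)} (hU : IsOpen U) (hreg : U ⊆ regularST₂ 𝕜)
    (hw : ContDiffOn 𝕜 ∞ w U) (h : IsConjugateSystem U w (coeffsF₂ α β₁ β₂ γ₁ γ₂)) :
    (PosFocalQuadrics U w (coeffsF₂ α β₁ β₂ γ₁ γ₂) →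
      ∀ p ∈ U, (coeffsF₂ α β₁ β₂ γ₁ γ₂).h p = 0) ∧
    (NegFocalQuadrics U w (coeffsF₂ α β₁ β₂ γ₁ γ₂) →
      ∀ p ∈ U, (coeffsF₂ α β₁ β₂ γ₁ γ₂).k p = 0) := by
  have h1 : ∀ p ∈ U, p.1 * (p.1 - 1) ≠ 0 := fun p hp => mul_ne_zero (hreg hp).1 (hreg hp).2.1
  have h2 : ∀ p ∈ U, p.2 * (p.2 - 1) ≠ 0 := fun p hp =>
    mul_ne_zero (hreg hp).2.2.1 (hreg hp).2.2.2.1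
  have key := fun (p : 𝕜 × 𝕜) (hp : p ∈ U) => h.focal_log hU hw
    (μ := fun p => (2 * p.1 - 1) / (p.1 * (p.1 - 1)))
    (ν := fun p => (1 - 2 * p.2) / (p.2 * (p.2 - 1)))
    (by fun_prop (disch := assumption)) (by fun_prop (disch := assumption))
    (fun p hp => by
      rw [show pd₁ _ p = _ from (hasPD_q_F₂ (hreg hp)).fst]
      obtain ⟨hs, hs1, ht, ht1, hd⟩ := hreg hp
      simp only [coeffsF₂]; field_simp)
    (fun p hp => by
      rw [show pd₂ _ p = _ from (hasPD_q_F₂ (hreg hp)).snd]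
      obtain ⟨hs, hs1, ht, ht1, hd⟩ := hreg hp
      simp only [coeffsF₂]; field_simp; ring)
    (fun p hp => by
      have := ((((HasPD.const (2 : 𝕜)).mul .x).sub (HasPD.const 1)).div
        (HasPD.x.mul (HasPD.x.sub (HasPD.const 1))) (h1 p hp)).snd
      exact this.trans (by simp))
    (fun p hp => by
      have := (((HasPD.const (1 : 𝕜)).sub ((HasPD.const (2 : 𝕜)).mul .y)).div
        (HasPD.y.mul (HasPD.y.sub (HasPD.const 1))) (h2 p hp)).fst
      exact this.trans (by simp)) hp
  exact ⟨fun hQ p hp => eq_zero_of_log_inv_sq hU hreg (fun p hp => h_F₂ (hreg hp)) hp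
      ((key p hp).1 hQ),
    fun hQ p hp => eq_zero_of_log_inv_sq hU hreg (fun p hp => k_F₂ (hreg hp)) hp
      ((key p hp).2 hQ)⟩

/-- The equality a_s = b_t gives γ₂ = 2β₂. Then 2m = 4bq + q_s reduces to an affine identity in s;
evaluation at two points with the same t annihilates both of its coefficients. -/
theorem params_of_quadric_F₂ {w : 𝕜 × 𝕜 → (Fin 4 → 𝕜)} (hU : IsOpen U) (hne : U.Nonempty)
    (hreg : U ⊆ regularST₂ 𝕜) (hw : ContDiffOn 𝕜 ∞ w U)
    (h : IsConjugateSystem U w (coeffsF₂ α β₁ β₂ γ₁ γ₂)) (hq : IsQuadricOn U w) :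
    α = β₁ + β₂ - 1 / 2 ∧ γ₁ = 2 * β₁ ∧ γ₂ = 2 * β₂ := by
  obtain ⟨p, hp⟩ := hne
  have hc := h.isConj hU hw
  have h1 : ∀ p ∈ U, p.1 * (p.1 - 1) ≠ 0 := fun p hp => mul_ne_zero (hreg hp).1 (hreg hp).2.1
  have hγ₂ : γ₂ = 2 * β₂ := by
    have e := hc.quadric_symmetric hq (μ := fun p => (2 * p.1 - 1) / (p.1 * (p.1 - 1)))
      (by fun_prop (disch := assumption))
      (fun p hp => by
        rw [(hasPD_q_F₂ (hreg hp)).fst]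
        obtain ⟨hs, hs1, ht, ht1, hd⟩ := hreg hp
        simp only [coeffsF₂]; field_simp)
      (fun p hp => by
        have := ((((HasPD.const (2 : 𝕜)).mul .x).sub (HasPD.const 1)).div
          (HasPD.x.mul (HasPD.x.sub (HasPD.const 1))) (h1 p hp)).snd
        exact this.trans (by simp)) hp
    rw [(hasPD_a_F₂ (hreg hp)).fst, (hasPD_b_F₂ (hreg hp)).snd] at e
    have hd := (hreg hp).2.2.2.2
    field_simp at e
    linear_combination -e
  have hlin : ∀ p ∈ U, (2 * (2 * α + 2 - γ₁) - 4 * β₂ - 2) * p.1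
      + (2 * β₂ + 1 - 2 * (α - β₁ + 1)) = 0 := fun p hp => by
    have e := (hc.quadric_metric hq).1 p hp
    rw [(hasPD_q_F₂ (hreg hp)).fst] at e
    obtain ⟨hs, hs1, ht, ht1, hd⟩ := hreg hp
    simp only [coeffsF₂, sepCoeff₁, hγ₂] at e
    field_simp at e
    refine mul_left_cancel₀ hd ?_
    linear_combination e
  obtain ⟨x, hx, hxp⟩ : ∃ x, (x, p.2) ∈ U ∧ x ≠ p.1 := by
    obtain ⟨x, hx, hxp⟩ := (infinite_slice hU hp).exists_notMem_finset {p.1}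
    exact ⟨x, hx, by simpa using hxp⟩
  have e1 := hlin p hp
  have e2 := hlin _ hx
  have e3 : 2 * (2 * α + 2 - γ₁) - 4 * β₂ - 2 = 0 := by
    refine mul_right_cancel₀ (sub_ne_zero.2 hxp) ?_
    linear_combination e2 - e1
  rw [e3] at e1
  have hα : α = β₁ + β₂ - 1 / 2 := by linear_combination -e1 / 2
  refine ⟨hα, ?_, hγ₂⟩
  rw [hα] at e3
  linear_combination -e3 / 2

/-- Everything is first proved on the full preimage of `V`, which is connected because `T₂` is
invertible there. Pointwise independence of the frame then restricts to any `U`, where independence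
of the components as functions is not assumed. -/
theorem surfaceF₂_assertions (h : IsSurfaceF₂ α β₁ β₂ γ₁ γ₂ V F) :
    (IsQuadricOn V F ↔ α = β₁ + β₂ - 1 / 2 ∧ γ₁ = 2 * β₁ ∧ γ₂ = 2 * β₂) ∧
    ∀ (U : Set (𝕜 × 𝕜)) (z : 𝕜 × 𝕜 → (Fin 4 → 𝕜)), IsGaugedPullback T₂ V F U z →
      (∃ C, IsConjugateSystem U z C) ∧
      ∀ C, IsConjugateSystem U z C →
        (PosFocalQuadrics U z C → ∀ p ∈ U, C.h p = 0) ∧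
        (NegFocalQuadrics U z C → ∀ p ∈ U, C.k p = 0) := by
  obtain ⟨⟨hV, hVc, hVr, hF, hi⟩, hS⟩ := h
  set W := T₂ ⁻¹' V with hW
  have hWo : IsOpen W := isOpen_preimage_T₂ hVr hV
  have hWc : IsPreconnected W := isPreconnected_preimage_T₂ hVr hVc.isPreconnected
  have hWr : W ⊆ regularST₂ 𝕜 := fun p hp => mem_regularST₂ (hVr hp)
  have hinv : ∀ q ∈ V, T₂inv q ∈ W ∧ T₂ (T₂inv q) = q := fun q hq => by
    have := T₂_T₂inv (hVr hq).1
    exact ⟨by rw [hW, Set.mem_preimage, this]; exact hq, this⟩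
  have hmaps : Set.MapsTo T₂ W V := fun p hp => hp
  set w : 𝕜 × 𝕜 → (Fin 4 → 𝕜) := fun p => F (T₂ p) with hw
  have hws : ContDiffOn 𝕜 ∞ w W := hF.comp (smooth_T₂ hWr) hmaps
  have heq := fun (p : 𝕜 × 𝕜) (hp : p ∈ W) => conjugate_equations_F₂ hV hF hS hWo hmaps hWr hp
  have htot := isTotalSystem_F₂ hWo hWr hws (fun p hp => (heq p hp).1) (fun p hp => (heq p hp).2)
  have hiw : LinearIndependent 𝕜 (fun (i : Fin 4) (p : W) => w p i) := by
    rw [Fintype.linearIndependent_iff] at hi ⊢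
    refine fun g hg => hi g (funext fun q => ?_)
    have := congrFun hg ⟨T₂inv q, (hinv q q.2).1⟩
    simp only [hw, Finset.sum_apply, Pi.smul_apply, (hinv q q.2).2] at this ⊢
    exact this
  have hli := fun (p : 𝕜 × 𝕜) (hp : p ∈ W) => htot.linearIndependent hWo hWc hiw hp
  have hsys : IsConjugateSystem W w (coeffsF₂ α β₁ β₂ γ₁ γ₂) :=
    isConjugateSystem_F₂ hV hF hS hWo hmaps hWr fun p hp =>
      frame_F₂ (fun p hp => (heq p hp).2) hp (hli p hp)
  refine ⟨⟨fun hq => ?_, fun ⟨hα, hγ₁, hγ₂⟩ => ?_⟩, fun U z hz => ?_⟩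
  · obtain ⟨q, hq0⟩ := hVc.nonempty
    refine params_of_quadric_F₂ hWo ⟨_, (hinv q hq0).1⟩ hWr hws hsys ?_
    obtain ⟨M, h1, h2, h3⟩ := hq
    exact ⟨M, h1, h2, fun p hp => h3 _ hp⟩
  · obtain ⟨q, hq0⟩ := hVc.nonempty
    have hp₀ := (hinv q hq0).1
    have hr := hWr hp₀
    obtain ⟨M, h1, h2, h3⟩ := htot.isQuadricOn hWo hWc hp₀ (hli _ hp₀)
      (metric₂ β₂ (α * (α + 1 - γ₁))) _ _ (symm_adapted _ _ _ _ _ _)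
      (by
        rw [metric₂, det_adapted]
        obtain ⟨hs, hs1, ht, ht1, hd⟩ := hr
        rw [zero_pow two_ne_zero, zero_sub, neg_ne_zero]
        exact mul_ne_zero (div_ne_zero one_ne_zero (mul_ne_zero hs hs1))
          (div_ne_zero (neg_ne_zero.2 one_ne_zero) (mul_ne_zero ht ht1)))
      (fun _ _ => rfl) (fun _ _ => rfl)
      (fun p hp i j => hasPD_metric₂ hα hγ₁ hγ₂ (hWr hp) i j)
    refine ⟨M, h1, h2, fun q hq => ?_⟩
    have := h3 _ (hinv q hq).1
    change F (T₂ (T₂inv q)) ⬝ᵥ M.mulVec (F (T₂ (T₂inv q))) = 0 at this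
    rwa [(hinv q hq).2] at this
  · obtain ⟨hUo, -, hUm, f, hf, hf0, hfz⟩ := hz
    have hUW : U ⊆ W := hUm
    have hsysU := hsys.mono hUW
    have hfoc := focal_F₂ hUo (hUW.trans hWr) (hws.mono hUW) hsysU
    exact conjugate_assertions_of_gauge hsysU hUo (hws.mono hUW) hf hf0 hfz hfoc.1 hfoc.2

end SurfaceF₂

/-! ### The F₄ system as a total system. -/

section SystemF₄

variable {𝕜 : Type*} [RCLike 𝕜] {α β γ₁ γ₂ : 𝕜} {U V : Set (𝕜 × 𝕜)}
  {F : 𝕜 × 𝕜 → (Fin 4 → 𝕜)}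

/-- The discriminant `(1 - x - y)² - 4 x y`. -/
def disc (p : 𝕜 × 𝕜) : 𝕜 := (1 - p.1 - p.2) ^ 2 - 4 * p.1 * p.2

/-- The `F₄` system solved for `y F_yy` and `x y F_xy`. -/
theorem solved_equations_F₄ (hV : IsOpen V) (hF : ContDiffOn 𝕜 ∞ F V)
    (hS : SolvesAppellF₄ α β γ₁ γ₂ V F) {p : 𝕜 × 𝕜} (hp : p ∈ V) :
    p.2 • pd₂ (pd₂ F) p = p.1 • pd₁ (pd₁ F) p + γ₁ • pd₁ F p - γ₂ • pd₂ F p ∧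
    (p.1 * p.2) • pd₂ (pd₁ F) p =
      ((1 - p.1 - p.2) / 2) • (p.1 • pd₁ (pd₁ F) p + γ₁ • pd₁ F p)
      + ((γ₁ - 1 - α - β) / 2 * p.1) • pd₁ F p + ((γ₂ - 1 - α - β) / 2 * p.2) • pd₂ F p
      - (α * β / 2) • F p := by
  set R : 𝕜 × 𝕜 → (Fin 4 → 𝕜) := fun p =>
    p.1 • pd₁ (pd₁ F) p + γ₁ • pd₁ F p - γ₂ • pd₂ F p - p.2 • pd₂ (pd₂ F) p with hR
  have s1 := pd₁_smooth hV hF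
  have s2 := pd₂_smooth hV hF
  have s11 := pd₁_smooth hV s1
  have s22 := pd₂_smooth hV s2
  have hRc : ContinuousOn R V := by
    have c1 := s1.continuousOn
    have c2 := s2.continuousOn
    have c11 := s11.continuousOn
    have c22 := s22.continuousOn
    fun_prop
  -- The difference of the two Appell equations is (x + y - 1) R. The factor may vanish inside `V`,
  -- but not on a nonempty open set, so continuity of `R` still gives R = 0.
  have hR0 : ∀ q ∈ V, (q.1 + q.2 - 1) • R q = 0 := fun q hq => by
    obtain ⟨e1, e2⟩ := hS q hq
    simp only [hR]
    linear_combination (norm := skip) (1 : 𝕜) • e1 - (1 : 𝕜) • e2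
    match_scalars <;> ring
  have hRp : R p = 0 := by
    by_contra h0
    have hW : IsOpen (V ∩ {q | R q ≠ 0}) := hRc.isOpen_inter_preimage hV isOpen_ne
    have hz : ∀ q ∈ V ∩ {q | R q ≠ 0}, q.1 + q.2 - 1 = 0 := fun q hq =>
      (smul_eq_zero.1 (hR0 q hq.1)).resolve_right hq.2
    obtain ⟨x, hx, hxp⟩ :=
      (infinite_slice hW (p := p) ⟨hp, h0⟩).exists_notMem_finset {p.1}
    refine hxp (Finset.mem_singleton.2 ?_)
    linear_combination hz _ hx - hz p ⟨hp, h0⟩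
  have e0 : p.2 • pd₂ (pd₂ F) p = p.1 • pd₁ (pd₁ F) p + γ₁ • pd₁ F p - γ₂ • pd₂ F p :=
    (sub_eq_zero.1 hRp).symm
  refine ⟨e0, ?_⟩
  obtain ⟨e1, -⟩ := hS p hp
  linear_combination (norm := skip) (1 / 2 : 𝕜) • e1
  match_scalars <;> ring

/-- Coefficients of `y T_y - G T_x` in the frame, where `G = (1 - x - y) / 2`. -/
noncomputable def auxRow₁ (α β γ₁ γ₂ : 𝕜) (p : 𝕜 × 𝕜) : Fin 4 → 𝕜 :=
  let μ₁ := (γ₁ - 1 - α - β) / 2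
  let μ₂ := (γ₂ - 1 - α - β) / 2
  ![-(μ₂ + γ₁ - 1) * (α * β) / (2 * p.1),
    (-μ₁ * (γ₁ - 1) - α * β / 2 + (μ₂ + γ₁ - 1) * μ₁) / p.1,
    (μ₂ + γ₁ - 1) * μ₂ / p.1,
    μ₁ - 1 / 2 + (μ₂ + γ₁ - 1) * ((1 - p.1 - p.2) / 2) / p.1]

/-- Coefficients of `x T_x - G T_y` in the frame, where `G = (1 - x - y) / 2`. -/
noncomputable def auxRow₂ (α β γ₁ γ₂ : 𝕜) (p : 𝕜 × 𝕜) : Fin 4 → 𝕜 :=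
  let μ₁ := (γ₁ - 1 - α - β) / 2
  let μ₂ := (γ₂ - 1 - α - β) / 2
  ![-(μ₁ + γ₂ - 1) * (α * β) / (2 * p.2),
    (μ₁ + γ₂ - 1) * μ₁ / p.2,
    (-μ₂ * (γ₂ - 1) - α * β / 2 + (μ₁ + γ₂ - 1) * μ₂) / p.2,
    μ₂ - 1 / 2 + (μ₁ + γ₂ - 1) * ((1 - p.1 - p.2) / 2) / p.2]

/-- First matrix of the total differential system equivalent to the `F₄` system. -/
noncomputable def totalP₄ (α β γ₁ γ₂ : 𝕜) (p : 𝕜 × 𝕜) : Matrix (Fin 4) (Fin 4) 𝕜 :=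
  Matrix.of ![![0, 1 / p.1, 0, 0],
    ![0, -(γ₁ - 1) / p.1, 0, 1],
    ![-(α * β) / (2 * p.1), (γ₁ - 1 - α - β) / (2 * p.1), (γ₂ - 1 - α - β) / (2 * p.1),
      (1 - p.1 - p.2) / (2 * p.1)],
    fun j => -4 * (p.2 * auxRow₂ α β γ₁ γ₂ p j
      + (1 - p.1 - p.2) / 2 * auxRow₁ α β γ₁ γ₂ p j) / disc p]

/-- Second matrix of the total differential system equivalent to the `F₄` system. -/
noncomputable def totalQ₄ (α β γ₁ γ₂ : 𝕜) (p : 𝕜 × 𝕜) : Matrix (Fin 4) (Fin 4) 𝕜 :=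
  Matrix.of ![![0, 0, 1 / p.2, 0],
    ![-(α * β) / (2 * p.2), (γ₁ - 1 - α - β) / (2 * p.2), (γ₂ - 1 - α - β) / (2 * p.2),
      (1 - p.1 - p.2) / (2 * p.2)],
    ![0, 0, -(γ₂ - 1) / p.2, 1],
    fun j => -4 * (p.1 * auxRow₁ α β γ₁ γ₂ p j
      + (1 - p.1 - p.2) / 2 * auxRow₂ α β γ₁ γ₂ p j) / disc p]

/-- The frame `F, x F_x, y F_y, x F_xx + γ₁ F_x`. -/
noncomputable def frameF₄ (γ₁ : 𝕜) (F : 𝕜 × 𝕜 → (Fin 4 → 𝕜)) : Fin 4 → 𝕜 × 𝕜 → (Fin 4 → 𝕜) :=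
  ![F, fun p => p.1 • pd₁ F p, fun p => p.2 • pd₂ F p,
    fun p => p.1 • pd₁ (pd₁ F) p + γ₁ • pd₁ F p]

/-- Let T = x F_xx + γ₁ F_x, which also equals y F_yy + γ₂ F_y, and G = (1 - x - y)/2. Equality of
the mixed derivatives of x F_x and of y F_y gives y T_y - G T_x and x T_x - G T_y in terms of the
frame. This linear system for T_x, T_y has discriminating factor xy - G² = -disc/4, nonzero off the
singular locus. -/
theorem isTotalSystem_F₄ (hV : IsOpen V) (hVr : V ⊆ regularF₄ 𝕜) (hF : ContDiffOn 𝕜 ∞ F V)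
    (hS : SolvesAppellF₄ α β γ₁ γ₂ V F) :
    IsTotalSystem V (totalP₄ α β γ₁ γ₂) (totalQ₄ α β γ₁ γ₂) (frameF₄ γ₁ F) := by
  have hx : ∀ p ∈ V, p.1 ≠ 0 := fun p hp => (hVr hp).1
  have hy : ∀ p ∈ V, p.2 ≠ 0 := fun p hp => (hVr hp).2.1
  have hD : ∀ p ∈ V, disc p ≠ 0 := fun p hp => (hVr hp).2.2
  have hx2 : ∀ p ∈ V, 2 * p.1 ≠ 0 := fun p hp => mul_ne_zero two_ne_zero (hx p hp)
  have hy2 : ∀ p ∈ V, 2 * p.2 ≠ 0 := fun p hp => mul_ne_zero two_ne_zero (hy p hp)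
  have cD : ContinuousOn (disc (𝕜 := 𝕜)) V := by unfold disc; fun_prop
  have cr1 : ∀ j, ContinuousOn (fun p => auxRow₁ α β γ₁ γ₂ p j) V := fun j => by
    fin_cases j <;> simp [auxRow₁] <;> fun_prop (disch := assumption)
  have cr2 : ∀ j, ContinuousOn (fun p => auxRow₂ α β γ₁ γ₂ p j) V := fun j => by
    fin_cases j <;> simp [auxRow₂] <;> fun_prop (disch := assumption)
  refine ⟨fun i j => ?_, fun i j => ?_, ?_⟩
  · fin_cases i
    on_goal 4 =>
      have := cr1 j
      have := cr2 j
      simp [totalP₄]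
      fun_prop (disch := assumption)
    all_goals fin_cases j <;> simp [totalP₄] <;> fun_prop (disch := assumption)
  · fin_cases i
    on_goal 4 =>
      have := cr1 j
      have := cr2 j
      simp [totalQ₄]
      fun_prop (disch := assumption)
    all_goals fin_cases j <;> simp [totalQ₄] <;> fun_prop (disch := assumption)
  set y₁ : 𝕜 × 𝕜 → (Fin 4 → 𝕜) := fun p => p.1 • pd₁ F p with hy₁
  set y₂ : 𝕜 × 𝕜 → (Fin 4 → 𝕜) := fun p => p.2 • pd₂ F p with hy₂
  set y₃ : 𝕜 × 𝕜 → (Fin 4 → 𝕜) := fun p => p.1 • pd₁ (pd₁ F) p + γ₁ • pd₁ F p with hy₃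
  have s1 := pd₁_smooth hV hF
  have s2 := pd₂_smooth hV hF
  have s₁ : ContDiffOn 𝕜 ∞ y₁ V := contDiffOn_fst.smul s1
  have s₂ : ContDiffOn 𝕜 ∞ y₂ V := contDiffOn_snd.smul s2
  have s₃ : ContDiffOn 𝕜 ∞ y₃ V :=
    (contDiffOn_fst.smul (pd₁_smooth hV s1)).add (s1.const_smul γ₁)
  have d₀ : ∀ p ∈ V, HasPD (1, 0) (0, 1) F p ((1 / p.1) • y₁ p) ((1 / p.2) • y₂ p) := fun p hp =>
    (HasPD.of_smooth' hV hF hp).congr (by simp [hy₁, smul_smul, hx p hp])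
      (by simp [hy₂, smul_smul, hy p hp])
  have d₁ : ∀ p ∈ V, HasPD (1, 0) (0, 1) y₁ p ((-(γ₁ - 1) / p.1) • y₁ p + y₃ p)
      ((-(α * β) / (2 * p.2)) • F p + ((γ₁ - 1 - α - β) / (2 * p.2)) • y₁ p
        + ((γ₂ - 1 - α - β) / (2 * p.2)) • y₂ p + ((1 - p.1 - p.2) / (2 * p.2)) • y₃ p) :=
      fun p hp => by
    have h1 := hx p hp
    have h2 := hy p hp
    obtain ⟨-, e⟩ := solved_equations_F₄ hV hF hS hp
    refine (HasPD.x.smul (HasPD.of_smooth' hV s1 hp)).congr ?_ ?_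
    · simp only [hy₁, hy₃]
      match_scalars <;> field_simp <;> ring
    · simp only [hy₁, hy₂, hy₃]
      linear_combination (norm := skip) (1 / p.2) • e
      match_scalars <;> field_simp <;> ring
  have d₂ : ∀ p ∈ V, HasPD (1, 0) (0, 1) y₂ p
      ((-(α * β) / (2 * p.1)) • F p + ((γ₁ - 1 - α - β) / (2 * p.1)) • y₁ p
        + ((γ₂ - 1 - α - β) / (2 * p.1)) • y₂ p + ((1 - p.1 - p.2) / (2 * p.1)) • y₃ p)
      ((-(γ₂ - 1) / p.2) • y₂ p + y₃ p) := fun p hp => by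
    have h1 := hx p hp
    have h2 := hy p hp
    obtain ⟨e', e⟩ := solved_equations_F₄ hV hF hS hp
    refine (HasPD.y.smul (HasPD.of_smooth' hV s2 hp)).congr ?_ ?_
    · rw [pd_comm hV hF hp]
      simp only [hy₁, hy₂, hy₃]
      linear_combination (norm := skip) (1 / p.1) • e
      match_scalars <;> field_simp <;> ring
    · simp only [hy₂, hy₃]
      linear_combination (norm := skip) (1 : 𝕜) • e'
      match_scalars <;> field_simp <;> ring
  have d₃ : ∀ p ∈ V, HasPD (1, 0) (0, 1) y₃ p
      (∑ j, totalP₄ α β γ₁ γ₂ p 3 j • frameF₄ γ₁ F j p)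
      (∑ j, totalQ₄ α β γ₁ γ₂ p 3 j • frameF₄ γ₁ F j p) := fun p hp => by
    have h1 := hx p hp
    have h2 := hy p hp
    have hD' := hD p hp
    have f₃ := HasPD.of_smooth' hV s₃ hp
    have hG := ((HasPD.const (v := (1, 0)) (w := (0, 1)) (p := p) (1 : 𝕜)).sub .x).sub .y
    have h2y := (HasPD.const (v := (1, 0)) (w := (0, 1)) (p := p) (2 : 𝕜)).mul .y
    have h2x := (HasPD.const (v := (1, 0)) (w := (0, 1)) (p := p) (2 : 𝕜)).mul .x
    have g1 := HasPD.eq_of_eqOn hV hp (fun p hp => (d₁ p hp).fst)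
      (HasPD.of_smooth' hV (pd₁_smooth hV s₁) hp)
      ((((HasPD.const (-(γ₁ - 1))).div .x h1).smul (d₁ p hp)).add f₃)
    have g1' := HasPD.eq_of_eqOn hV hp (fun p hp => (d₁ p hp).snd)
      (HasPD.of_smooth' hV (pd₂_smooth hV s₁) hp)
      ((((((HasPD.const (-(α * β))).div h2y (hy2 p hp)).smul (d₀ p hp)).add
        (((HasPD.const (γ₁ - 1 - α - β)).div h2y (hy2 p hp)).smul (d₁ p hp))).add
        (((HasPD.const (γ₂ - 1 - α - β)).div h2y (hy2 p hp)).smul (d₂ p hp))).add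
        ((hG.div h2y (hy2 p hp)).smul f₃))
    have k1 := g1.2.symm.trans ((pd_comm hV s₁ hp).symm.trans g1'.1)
    have g2 := HasPD.eq_of_eqOn hV hp (fun p hp => (d₂ p hp).snd)
      (HasPD.of_smooth' hV (pd₂_smooth hV s₂) hp)
      ((((HasPD.const (-(γ₂ - 1))).div .y h2).smul (d₂ p hp)).add f₃)
    have g2' := HasPD.eq_of_eqOn hV hp (fun p hp => (d₂ p hp).fst)
      (HasPD.of_smooth' hV (pd₁_smooth hV s₂) hp)
      ((((((HasPD.const (-(α * β))).div h2x (hx2 p hp)).smul (d₀ p hp)).add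
        (((HasPD.const (γ₁ - 1 - α - β)).div h2x (hx2 p hp)).smul (d₁ p hp))).add
        (((HasPD.const (γ₂ - 1 - α - β)).div h2x (hx2 p hp)).smul (d₂ p hp))).add
        ((hG.div h2x (hx2 p hp)).smul f₃))
    have k2 := g2.1.symm.trans ((pd_comm hV s₂ hp).trans g2'.2)
    clear g1 g1' g2 g2' f₃ hG h2x h2y
    have hfr : ∀ (c : Fin 4 → 𝕜), ∑ j, c j • frameF₄ γ₁ F j p =
        c 0 • F p + c 1 • y₁ p + c 2 • y₂ p + c 3 • y₃ p := fun c => by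
      simp [Fin.sum_univ_four, frameF₄, hy₁, hy₂, hy₃]
    refine (HasPD.of_smooth' hV s₃ hp).congr ?_ ?_
    · rw [hfr]
      simp only [totalP₄, auxRow₁, auxRow₂, Matrix.of_apply, Matrix.cons_val]
      -- Cramer's rule for T_x; the extra factors x and y clear the denominators in `k2` and `k1`.
      linear_combination (norm := skip) (-4 * p.2 * p.1 / disc p) • k2
        + (-4 * ((1 - p.1 - p.2) / 2) * p.2 / disc p) • k1
      generalize y₁ p = Y₁, y₂ p = Y₂, y₃ p = Y₃, pd₁ y₃ p = Z₁, pd₂ y₃ p = Z₂, F p = F₀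
      match_scalars <;> field_simp <;> simp only [disc] <;> ring
    · rw [hfr]
      simp only [totalQ₄, auxRow₁, auxRow₂, Matrix.of_apply, Matrix.cons_val]
      linear_combination (norm := skip) (-4 * p.1 * p.2 / disc p) • k1
        + (-4 * ((1 - p.1 - p.2) / 2) * p.1 / disc p) • k2
      generalize y₁ p = Y₁, y₂ p = Y₂, y₃ p = Y₃, pd₁ y₃ p = Z₁, pd₂ y₃ p = Z₂, F p = F₀
      match_scalars <;> field_simp <;> simp only [disc] <;> ring
  intro p hp i
  fin_cases i
  · refine (d₀ p hp).congr ?_ ?_ <;>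
    simp [Fin.sum_univ_four, totalP₄, totalQ₄, frameF₄, hy₁, hy₂]
  · refine (d₁ p hp).congr ?_ ?_ <;>
    simp [Fin.sum_univ_four, totalP₄, totalQ₄, frameF₄, hy₁, hy₂, hy₃]
  · refine (d₂ p hp).congr ?_ ?_ <;>
    simp [Fin.sum_univ_four, totalP₄, totalQ₄, frameF₄, hy₁, hy₂, hy₃]
  · exact d₃ p hp

end SystemF₄

/-! ### The quadric criterion for S_{F₄}. -/

section QuadricF₄

variable {𝕜 : Type*} [RCLike 𝕜] {α β γ₁ γ₂ : 𝕜} {U V : Set (𝕜 × 𝕜)}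
  {F : 𝕜 × 𝕜 → (Fin 4 → 𝕜)}

/-- The conformal metric of the quadric `S_{F₄}`. -/
noncomputable def metric₄ (κ γ₁ γ₂ : 𝕜) (p : 𝕜 × 𝕜) : Matrix (Fin 4) (Fin 4) 𝕜 :=
  !![0, 0, 0, -1;
    0, p.1, (1 - p.1 - p.2) / 2, γ₁ / 2 + p.1 * (1 - p.1 + p.2) / disc p;
    0, (1 - p.1 - p.2) / 2, p.2, γ₂ / 2 + p.2 * (1 + p.1 - p.2) / disc p;
    -1, γ₁ / 2 + p.1 * (1 - p.1 + p.2) / disc p, γ₂ / 2 + p.2 * (1 + p.1 - p.2) / disc p,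
      -((γ₁ - 1) ^ 2 * p.2 + (γ₂ - 1) ^ 2 * p.1
        + (1 - p.1 - p.2) * (2 * κ + 1 - γ₁ * γ₂)) / disc p
        + (1 - p.1 - p.2) * (1 - p.1 - p.2) / (disc p * disc p)]

theorem hasPD_disc {p : 𝕜 × 𝕜} : HasPD (1, 0) (0, 1) (disc (𝕜 := 𝕜)) p
    (-2 * (1 - p.1 + p.2)) (-2 * (1 + p.1 - p.2)) := by
  have hG := ((HasPD.const (v := (1, 0)) (w := (0, 1)) (p := p) (1 : 𝕜)).sub .x).sub .y
  have h := (hG.mul hG).sub (((HasPD.const (4 : 𝕜)).mul .x).mul .y)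
  refine (h.congr_fun (g := disc) isOpen_univ (Set.mem_univ p) fun p _ => ?_).congr ?_ ?_
  · rw [disc]; ring
  all_goals ring

set_option maxHeartbeats 4000000 in
-- The middle block with entries x, (1 - x - y)/2, y is the one that any quadric through the surface
-- induces after scaling to B(y₀, y₃) = -1; compare `h11` in `params_of_quadric_F₄`.
theorem hasPD_metric₄ (hγ : γ₂ = α + β - γ₁ + 1) {p : 𝕜 × 𝕜} (hp : p ∈ regularF₄ 𝕜) (i j : Fin 4) :
    HasPD (1, 0) (0, 1) (fun p => metric₄ (α * β) γ₁ γ₂ p i j) p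
      (gramDeriv (totalP₄ α β γ₁ γ₂ p) (metric₄ (α * β) γ₁ γ₂ p) i j
        - (-(γ₁ - 1) / p.1 + 2 * (1 - p.1 + p.2) / disc p) * metric₄ (α * β) γ₁ γ₂ p i j)
      (gramDeriv (totalQ₄ α β γ₁ γ₂ p) (metric₄ (α * β) γ₁ γ₂ p) i j
        - (-(γ₂ - 1) / p.2 + 2 * (1 + p.1 - p.2) / disc p) * metric₄ (α * β) γ₁ γ₂ p i j) := by
  obtain ⟨hx, hy, hD⟩ := hp
  change disc p ≠ 0 at hD
  have d0 := HasPD.const (v := (1, 0)) (w := (0, 1)) (p := p) (0 : 𝕜)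
  have dm := HasPD.const (v := (1, 0)) (w := (0, 1)) (p := p) (-1 : 𝕜)
  have d1 := HasPD.const (v := (1, 0)) (w := (0, 1)) (p := p) (1 : 𝕜)
  have d2 := HasPD.const (v := (1, 0)) (w := (0, 1)) (p := p) (2 : 𝕜)
  have dG := (d1.sub .x).sub .y
  have d11 := HasPD.x (p := p)
  have d22 := HasPD.y (p := p)
  have d12 := dG.div d2 two_ne_zero
  have d13 := (HasPD.const (γ₁ / 2)).add ((HasPD.x.mul ((d1.sub .x).add .y)).div hasPD_disc hD)
  have d23 := (HasPD.const (γ₂ / 2)).add ((HasPD.y.mul ((d1.add .x).sub .y)).div hasPD_disc hD)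
  have d33 := (((((HasPD.const ((γ₁ - 1) ^ 2)).mul .y).add ((HasPD.const ((γ₂ - 1) ^ 2)).mul .x)).add
    (dG.mul (HasPD.const (2 * (α * β) + 1 - γ₁ * γ₂)))).neg.div hasPD_disc hD).add
    ((dG.mul dG).div (hasPD_disc.mul hasPD_disc) (mul_ne_zero hD hD))
  obtain rfl := hγ
  fin_cases i <;> fin_cases j
  all_goals
    first
    | refine d0.congr ?_ ?_
    | refine dm.congr ?_ ?_
    | refine d11.congr ?_ ?_
    | refine d22.congr ?_ ?_
    | refine d12.congr ?_ ?_
    | refine d13.congr ?_ ?_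
    | refine d23.congr ?_ ?_
    | refine d33.congr ?_ ?_
  all_goals
    simp [gramDeriv, Fin.sum_univ_four, metric₄, totalP₄, totalQ₄, auxRow₁, auxRow₂]
  all_goals
    field_simp
    try simp only [disc]
    try ring

/-- The factors `1 + x - y` and `1 - x + y` have no common zero. -/
theorem eq_zero_of_factors {κ A x y : 𝕜} (hA : A ≠ 0)
    (h1 : κ * ((1 + x - y) / 2) * A = 0) (h2 : κ * ((1 - x + y) / 2) * A = 0) : κ = 0 := by
  refine mul_right_cancel₀ hA ?_
  linear_combination h1 + h2

/-- Put A = -B(y₀, y₃). Two differentiations of B(y₀, y₀) = 0 give the Gram entries xA, (1 - x -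
y)A/2, yA of y₁, y₂. Differentiating these gives six equations in A_x, A_y, B(y₁, y₃), B(y₂, y₃);
elimination leaves multiples of γ₁ + γ₂ - 1 - α - β. -/
theorem params_of_quadric_F₄ (hV : IsOpen V) (hVr : V ⊆ regularF₄ 𝕜)
    (h : IsTotalSystem V (totalP₄ α β γ₁ γ₂) (totalQ₄ α β γ₁ γ₂) (frameF₄ γ₁ F))
    {p : 𝕜 × 𝕜} (hp : p ∈ V) (hi : LinearIndependent 𝕜 (fun i => frameF₄ γ₁ F i p))
    (hq : IsQuadricOn V F) : γ₂ = α + β - γ₁ + 1 := by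
  obtain ⟨M, hMs, hMd, hM⟩ := hq
  set B := form M with hB
  have hs : ∀ x y, B x y = B y x := form_symm hMs
  set y := frameF₄ γ₁ F with hydef
  have hx0 : ∀ p ∈ V, p.1 ≠ 0 := fun p hp => (hVr hp).1
  have hy0 : ∀ p ∈ V, p.2 ≠ 0 := fun p hp => (hVr hp).2.1
  have hd := h.deriv
  have d₀ : ∀ p ∈ V, HasPD (1, 0) (0, 1) (y 0) p ((1 / p.1) • y 1 p) ((1 / p.2) • y 2 p) :=
    fun p hp => (hd p hp 0).congr (by simp [Fin.sum_univ_four, totalP₄])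
      (by simp [Fin.sum_univ_four, totalQ₄])
  have d₁ : ∀ p ∈ V, HasPD (1, 0) (0, 1) (y 1) p ((-(γ₁ - 1) / p.1) • y 1 p + y 3 p)
      ((-(α * β) / (2 * p.2)) • y 0 p + ((γ₁ - 1 - α - β) / (2 * p.2)) • y 1 p
        + ((γ₂ - 1 - α - β) / (2 * p.2)) • y 2 p + ((1 - p.1 - p.2) / (2 * p.2)) • y 3 p) :=
    fun p hp => (hd p hp 1).congr (by simp [Fin.sum_univ_four, totalP₄])
      (by simp [Fin.sum_univ_four, totalQ₄])
  have d₂ : ∀ p ∈ V, HasPD (1, 0) (0, 1) (y 2) p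
      ((-(α * β) / (2 * p.1)) • y 0 p + ((γ₁ - 1 - α - β) / (2 * p.1)) • y 1 p
        + ((γ₂ - 1 - α - β) / (2 * p.1)) • y 2 p + ((1 - p.1 - p.2) / (2 * p.1)) • y 3 p)
      ((-(γ₂ - 1) / p.2) • y 2 p + y 3 p) :=
    fun p hp => (hd p hp 2).congr (by simp [Fin.sum_univ_four, totalP₄])
      (by simp [Fin.sum_univ_four, totalQ₄])
  have h00 : ∀ p ∈ V, B (y 0 p) (y 0 p) = 0 := fun p hp => by
    rw [hB, form_apply]; exact hM p hp
  have h01 : ∀ p ∈ V, B (y 0 p) (y 1 p) = 0 ∧ B (y 0 p) (y 2 p) = 0 := fun p hp => by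
    have e := HasPD.eq_of_eqOn hV hp h00 ((d₀ p hp).bilin B (d₀ p hp)) (HasPD.const 0)
    have h1 := hx0 p hp
    have h2 := hy0 p hp
    rw [hs ((1 / p.1) • y 1 p), hs ((1 / p.2) • y 2 p)] at e
    simp only [map_smul, smul_eq_mul] at e
    obtain ⟨e1, e2⟩ := e
    field_simp at e1 e2
    exact ⟨by linear_combination e1 / 2, by linear_combination e2 / 2⟩
  have h11 : ∀ p ∈ V, B (y 1 p) (y 1 p) = p.1 * -B (y 0 p) (y 3 p) ∧
      B (y 1 p) (y 2 p) = (1 - p.1 - p.2) / 2 * -B (y 0 p) (y 3 p) ∧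
      B (y 2 p) (y 2 p) = p.2 * -B (y 0 p) (y 3 p) := fun p hp => by
    have h1 := hx0 p hp
    have h2 := hy0 p hp
    have e := HasPD.eq_of_eqOn hV hp (fun p hp => (h01 p hp).1) ((d₀ p hp).bilin B (d₁ p hp))
      (HasPD.const 0)
    have f := HasPD.eq_of_eqOn hV hp (fun p hp => (h01 p hp).2) ((d₀ p hp).bilin B (d₂ p hp))
      (HasPD.const 0)
    simp only [map_add, map_smul, smul_apply, smul_eq_mul, h00 p hp, (h01 p hp).1,
      (h01 p hp).2, hs (y 2 p) (y 1 p)] at e f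
    obtain ⟨e1, e2⟩ := e
    obtain ⟨f1, f2⟩ := f
    field_simp at e1 e2 f1 f2
    refine ⟨by linear_combination e1, by linear_combination e2 / 2, by linear_combination f2⟩
  have hyp := h01 p hp
  have hq := h11 p hp
  have hA0 : -B (y 0 p) (y 3 p) ≠ 0 := fun h0 => by
    have hz0 : y 0 p = 0 := by
      refine eq_zero_of_form hMd hi fun i => ?_
      rw [← hB, hs]
      revert i
      simp [Fin.forall_fin_succ, h00 p hp, hyp, neg_eq_zero.1 h0]
    exact hi.ne_zero 0 hz0
  have hx := hx0 p hp
  have hy := hy0 p hp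
  have dA := ((d₀ p hp).bilin B (HasPD.of_diff (v := (1, 0)) (w := (0, 1))
    (hd p hp 3).diff)).neg
  -- The derivatives of A stay unknowns; only their common occurrence in the three Gram identities
  -- matters.
  generalize hAx : -(B ((1 / p.1) • y 1 p) (y 3 p) + B (y 0 p) (dd (1, 0) (y 3) p)) = Ax at dA
  generalize hAy : -(B ((1 / p.2) • y 2 p) (y 3 p) + B (y 0 p) (dd (0, 1) (y 3) p)) = Ay at dA
  have e11 := HasPD.eq_of_eqOn hV hp (fun p hp => (h11 p hp).1) ((d₁ p hp).bilin B (d₁ p hp))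
    (HasPD.x.mul dA)
  have e12 := HasPD.eq_of_eqOn hV hp (fun p hp => (h11 p hp).2.1) ((d₁ p hp).bilin B (d₂ p hp))
    (((((HasPD.const 1).sub .x).sub .y).div (HasPD.const 2) two_ne_zero).mul dA)
  have e22 := HasPD.eq_of_eqOn hV hp (fun p hp => (h11 p hp).2.2) ((d₂ p hp).bilin B (d₂ p hp))
    (HasPD.y.mul dA)
  simp only [map_add, map_smul, add_apply, smul_apply, smul_eq_mul, hyp.1, hyp.2, hs (y 1 p) (y 0 p),
    hs (y 2 p) (y 0 p), hs (y 2 p) (y 1 p), hs (y 3 p), hq.1, hq.2.1, hq.2.2] at e11 e12 e22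
  generalize -B (y 0 p) (y 3 p) = A at *
  generalize B (y 1 p) (y 3 p) = τ₁ at *
  generalize B (y 2 p) (y 3 p) = τ₂ at *
  obtain ⟨a1, a2⟩ := e11
  obtain ⟨b1, b2⟩ := e12
  obtain ⟨c1, c2⟩ := e22
  field_simp at a1 a2 b1 b2 c1 c2
  have key := eq_zero_of_factors (κ := γ₁ + γ₂ - 1 - α - β) (x := p.1) (y := p.2) hA0
  have := key (by linear_combination b1 / 4 - (1 - p.1 - p.2) / 2 * a1 + a2 / 8 - p.1 * c2 / 2)
    (by linear_combination b2 / 4 - (1 - p.1 - p.2) / 2 * c2 + c1 / 8 - p.2 * a1 / 2)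
  linear_combination this

end QuadricF₄

/-! ### Conjugate coordinates on S_{F₄}. -/

section ConjugateF₄

variable {𝕜 : Type*} [RCLike 𝕜] {α β γ₁ γ₂ : 𝕜} {U V : Set (𝕜 × 𝕜)}
  {F : 𝕜 × 𝕜 → (Fin 4 → 𝕜)}

/-- The complement of the singular locus of the `F₄` system in the coordinates `(s, t)`. -/
def regularST₄ (𝕜 : Type*) [RCLike 𝕜] : Set (𝕜 × 𝕜) :=
  {p | p.1 + p.2 ≠ 0 ∧ p.1 - p.2 ≠ 0 ∧ 4 * p.1 ^ 2 - 1 ≠ 0 ∧ 4 * p.2 ^ 2 - 1 ≠ 0}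

/-- The substitution makes the discriminant factor as (4s² - 1)(4t² - 1)/(s+t)⁴. The line s + t = 0
is excluded through the convention 1/0 = 0. -/
theorem mem_regularST₄ {p : 𝕜 × 𝕜} (h : T₄ p ∈ regularF₄ 𝕜) : p ∈ regularST₄ 𝕜 := by
  obtain ⟨h1, h2, h3⟩ := h
  simp only [T₄] at h1 h2 h3
  have hu : p.1 + p.2 ≠ 0 := fun h => h1 (by simp [h])
  have hD : (1 - 1 / (p.1 + p.2) ^ 2 - (p.1 - p.2) ^ 2 / (p.1 + p.2) ^ 2) ^ 2
      - 4 * (1 / (p.1 + p.2) ^ 2) * ((p.1 - p.2) ^ 2 / (p.1 + p.2) ^ 2) =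
      (4 * p.1 ^ 2 - 1) * (4 * p.2 ^ 2 - 1) / (p.1 + p.2) ^ 4 := by
    field_simp
    ring
  rw [hD] at h3
  exact ⟨hu, fun h => h2 (by simp [h]), fun h => h3 (by simp [h]), fun h => h3 (by simp [h])⟩

/-- The coefficients of the conjugate system of `S_{F₄}`. -/
noncomputable def coeffsF₄ (α β γ₁ γ₂ : 𝕜) : ConjugateCoeffs 𝕜 :=
  let a := fun p : 𝕜 × 𝕜 =>
    (1 - 2 * (α + β)) / 2 / (p.1 + p.2) - (2 * γ₂ - 1) / 2 / (p.1 - p.2)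
  let b := fun p : 𝕜 × 𝕜 =>
    (1 - 2 * (α + β)) / 2 / (p.1 + p.2) + (2 * γ₂ - 1) / 2 / (p.1 - p.2)
  let c := fun p : 𝕜 × 𝕜 => 4 * α * β / (p.1 + p.2) ^ 2
  { a := a
    b := b
    c := c
    q := fun p => (4 * p.1 ^ 2 - 1) / (4 * p.2 ^ 2 - 1)
    m := fun p => (-(8 * p.1 * p.2 + 2) * a p + 4 * (3 - 2 * γ₁) * p.1
      - 2 * (2 * γ₂ - 1) / (p.1 - p.2)) / (4 * p.2 ^ 2 - 1)
    n := fun p => (-(8 * p.1 * p.2 + 2) * b p + 4 * (3 - 2 * γ₁) * p.2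
      + 2 * (2 * γ₂ - 1) / (p.1 - p.2)) / (4 * p.2 ^ 2 - 1)
    r := fun p => -(8 * p.1 * p.2 + 2) * c p / (4 * p.2 ^ 2 - 1) }

theorem hasPD_comp_T₄ {E : Type*} [NormedAddCommGroup E] [NormedSpace 𝕜 E] {V : Set (𝕜 × 𝕜)}
    (hV : IsOpen V) {g : 𝕜 × 𝕜 → E} (hg : ContDiffOn 𝕜 ∞ g V) {p : 𝕜 × 𝕜} (hp : T₄ p ∈ V)
    (hu : p.1 + p.2 ≠ 0) :
    HasPD (1, 0) (0, 1) (fun p => g (T₄ p)) p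
      ((-2 / (p.1 + p.2) ^ 3) • pd₁ g (T₄ p)
        + (4 * (p.1 - p.2) * p.2 / (p.1 + p.2) ^ 3) • pd₂ g (T₄ p))
      ((-2 / (p.1 + p.2) ^ 3) • pd₁ g (T₄ p)
        + (-4 * (p.1 - p.2) * p.1 / (p.1 + p.2) ^ 3) • pd₂ g (T₄ p)) := by
  have hT : (fun p : 𝕜 × 𝕜 => g (T₄ p)) = fun p => g (1 / ((p.1 + p.2) * (p.1 + p.2)),
      (p.1 - p.2) * (p.1 - p.2) / ((p.1 + p.2) * (p.1 + p.2))) := by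
    funext p; simp only [T₄, sq]
  have hTp : T₄ p = (1 / ((p.1 + p.2) * (p.1 + p.2)),
      (p.1 - p.2) * (p.1 - p.2) / ((p.1 + p.2) * (p.1 + p.2))) := by
    simp only [T₄, sq]
  rw [hT]
  rw [hTp] at hp ⊢
  have du := (HasPD.x (𝕜 := 𝕜) (p := p)).add .y
  have dv := (HasPD.x (𝕜 := 𝕜) (p := p)).sub .y
  refine (HasPD.comp (X := fun p => 1 / ((p.1 + p.2) * (p.1 + p.2)))
    (Y := fun p => (p.1 - p.2) * (p.1 - p.2) / ((p.1 + p.2) * (p.1 + p.2)))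
    (HasPD.of_smooth' hV hg hp) ((HasPD.const 1).div (du.mul du) (mul_ne_zero hu hu))
    ((dv.mul dv).div (du.mul du) (mul_ne_zero hu hu))).congr ?_ ?_
  all_goals match_scalars <;> field_simp <;> ring

theorem smooth_T₄ (h : U ⊆ regularST₄ 𝕜) : ContDiffOn 𝕜 ∞ (T₄ (𝕜 := 𝕜)) U := by
  have h0 : ∀ p ∈ U, (p.1 + p.2) ^ 2 ≠ 0 := fun p hp => pow_ne_zero 2 (h hp).1
  unfold T₄
  fun_prop (disch := assumption)

/-- The derivatives of `F ∘ T₄` up to order two. -/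
theorem derivatives_comp_T₄ (hV : IsOpen V) (hF : ContDiffOn 𝕜 ∞ F V) (hU : IsOpen U)
    (hUV : Set.MapsTo T₄ U V) (hreg : U ⊆ regularST₄ 𝕜) {p : 𝕜 × 𝕜} (hp : p ∈ U) :
    let w := fun p => F (T₄ p)
    let u := p.1 + p.2
    let v := p.1 - p.2
    pd₁ w p = (-2 / u ^ 3) • pd₁ F (T₄ p) + (4 * v * p.2 / u ^ 3) • pd₂ F (T₄ p) ∧
    pd₂ w p = (-2 / u ^ 3) • pd₁ F (T₄ p) + (-4 * v * p.1 / u ^ 3) • pd₂ F (T₄ p) ∧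
    pd₁ (pd₁ w) p = (4 / u ^ 6) • pd₁ (pd₁ F) (T₄ p) + (-16 * p.2 * v / u ^ 6) • pd₂ (pd₁ F) (T₄ p)
      + (16 * p.2 ^ 2 * v ^ 2 / u ^ 6) • pd₂ (pd₂ F) (T₄ p) + (6 / u ^ 4) • pd₁ F (T₄ p)
      + (8 * p.2 * (2 * p.2 - p.1) / u ^ 4) • pd₂ F (T₄ p) ∧
    pd₂ (pd₁ w) p = (4 / u ^ 6) • pd₁ (pd₁ F) (T₄ p) + (8 * v ^ 2 / u ^ 6) • pd₂ (pd₁ F) (T₄ p)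
      + (-16 * p.1 * p.2 * v ^ 2 / u ^ 6) • pd₂ (pd₂ F) (T₄ p) + (6 / u ^ 4) • pd₁ F (T₄ p)
      + (4 * (p.1 ^ 2 - 4 * p.1 * p.2 + p.2 ^ 2) / u ^ 4) • pd₂ F (T₄ p) ∧
    pd₂ (pd₂ w) p = (4 / u ^ 6) • pd₁ (pd₁ F) (T₄ p) + (16 * p.1 * v / u ^ 6) • pd₂ (pd₁ F) (T₄ p)
      + (16 * p.1 ^ 2 * v ^ 2 / u ^ 6) • pd₂ (pd₂ F) (T₄ p) + (6 / u ^ 4) • pd₁ F (T₄ p)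
      + (8 * p.1 * (2 * p.1 - p.2) / u ^ 4) • pd₂ F (T₄ p) := by
  intro w u v
  have hw : ∀ p ∈ U, _ := fun p hp => hasPD_comp_T₄ hV hF (hUV hp) (hreg hp).1
  have dx := hasPD_comp_T₄ hV (pd₁_smooth hV hF) (hUV hp) (hreg hp).1
  have dy := hasPD_comp_T₄ hV (pd₂_smooth hV hF) (hUV hp) (hreg hp).1
  have hu : p.1 + p.2 ≠ 0 := (hreg hp).1
  have hu3 : (p.1 + p.2) * ((p.1 + p.2) * (p.1 + p.2)) ≠ 0 :=
    mul_ne_zero hu (mul_ne_zero hu hu)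
  have hcb : ∀ p : 𝕜 × 𝕜, (p.1 + p.2) ^ 3 = (p.1 + p.2) * ((p.1 + p.2) * (p.1 + p.2)) :=
    fun p => by ring
  simp only [hcb] at hw
  have du := (HasPD.x (𝕜 := 𝕜) (p := p)).add .y
  have dv := (HasPD.x (𝕜 := 𝕜) (p := p)).sub .y
  have du3 := du.mul (du.mul du)
  have dX := ((HasPD.const (-2 : 𝕜)).div du3 hu3).smul dx
  have e1 := (dX.add (((((HasPD.const (4 : 𝕜)).mul dv).mul .y).div du3 hu3).smul dy)).congr_fun
    hU hp fun p hp => (hw p hp).fst.symm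
  have e2 := (dX.add (((((HasPD.const (-4 : 𝕜)).mul dv).mul .x).div du3 hu3).smul dy)).congr_fun
    hU hp fun p hp => (hw p hp).snd.symm
  have hc := pd_comm hV hF (hUV hp)
  refine ⟨(hw p hp).fst.trans (by rw [← hcb]), (hw p hp).snd.trans (by rw [← hcb]),
    e1.fst.trans ?_, e1.snd.trans ?_, e2.snd.trans ?_⟩
  all_goals
    rw [hc]
    simp only [u, v]
    match_scalars <;> field_simp <;> ring

/-- The `F₄` system in the coordinates `(s, t)`. -/
theorem conjugate_equations_F₄ (hV : IsOpen V) (hF : ContDiffOn 𝕜 ∞ F V)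
    (hS : SolvesAppellF₄ α β γ₁ γ₂ V F) (hU : IsOpen U) (hUV : Set.MapsTo T₄ U V)
    (hreg : U ⊆ regularST₄ 𝕜) {p : 𝕜 × 𝕜} (hp : p ∈ U) :
    let w := fun p => F (T₄ p)
    let C := coeffsF₄ α β γ₁ γ₂
    pd₂ (pd₁ w) p + C.a p • pd₁ w p + C.b p • pd₂ w p + C.c p • w p = 0 ∧
    pd₂ (pd₂ w) p + C.q p • pd₁ (pd₁ w) p + C.m p • pd₁ w p + C.n p • pd₂ w p + C.r p • w p = 0 := by
  intro w C
  obtain ⟨h1, h2, h11, h12, h22⟩ := derivatives_comp_T₄ hV hF hU hUV hreg hp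
  obtain ⟨q1, q2⟩ := solved_equations_F₄ hV hF hS (hUV hp)
  rw [h1, h2, h11, h12, h22]
  obtain ⟨hu, hv, hs, ht⟩ := hreg hp
  clear h1 h2 h11 h12 h22
  simp only [w, C, coeffsF₄]
  simp only [show (T₄ p).1 = 1 / (p.1 + p.2) ^ 2 from rfl,
    show (T₄ p).2 = (p.1 - p.2) ^ 2 / (p.1 + p.2) ^ 2 from rfl] at q1 q2
  generalize pd₁ (pd₁ F) (T₄ p) = Fxx, pd₂ (pd₁ F) (T₄ p) = Fxy, pd₂ (pd₂ F) (T₄ p) = Fyy,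
    pd₁ F (T₄ p) = Fx, pd₂ F (T₄ p) = Fy, F (T₄ p) = F0 at *
  obtain ⟨s, t⟩ := p
  simp only at *
  constructor
  -- Here and in the second equation the multipliers match the coefficients of F_yy and F_xy in
  -- w_st, respectively in w_tt + q w_ss.
  · linear_combination (norm := skip) (-16 * s * t / (s + t) ^ 4) • q1 + (8 / (s + t) ^ 2) • q2
    match_scalars <;> field_simp <;> ring
  · have ht' : t ^ 2 * 4 - 1 ≠ 0 := by rwa [mul_comm]
    linear_combination (norm := skip)
      (16 * (s ^ 2 * (4 * t ^ 2 - 1) + (4 * s ^ 2 - 1) * t ^ 2)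
        / ((4 * t ^ 2 - 1) * (s + t) ^ 4)) • q1
      + (16 * (4 * s * t + 1) * (t - s) / ((4 * t ^ 2 - 1) * ((s - t) * (s + t) ^ 2))) • q2
    match_scalars <;> field_simp <;> ring

/-- The passage between frames is triangular: w_s - w_t is a multiple of F_y, then w_s gives F_x,
and modulo these w_ss gives F_xx with a coefficient containing 4t² - 1 ≠ 0. -/
theorem frame_comp_T₄ (hV : IsOpen V) (hF : ContDiffOn 𝕜 ∞ F V)
    (hS : SolvesAppellF₄ α β γ₁ γ₂ V F) (hU : IsOpen U) (hUV : Set.MapsTo T₄ U V)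
    (hreg : U ⊆ regularST₄ 𝕜) {p : 𝕜 × 𝕜} (hp : p ∈ U)
    (hi : LinearIndependent 𝕜 (fun i => frameF₄ γ₁ F i (T₄ p))) :
    LinearIndependent 𝕜 ![F (T₄ p), pd₁ (fun p => F (T₄ p)) p,
      pd₂ (fun p => F (T₄ p)) p, pd₁ (pd₁ fun p => F (T₄ p)) p] := by
  refine dual_frame fun x k0 k1 k2 k3 => eq_zero_of_dual hi (x := x) ?_
  obtain ⟨h1, h2, h11, -, -⟩ := derivatives_comp_T₄ hV hF hU hUV hreg hp
  obtain ⟨q1, q2⟩ := solved_equations_F₄ hV hF hS (hUV hp)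
  rw [h1] at k1
  rw [h2] at k2
  rw [h11] at k3
  replace q1 := congrArg (· ⬝ᵥ x) q1
  replace q2 := congrArg (· ⬝ᵥ x) q2
  simp only [add_dotProduct, sub_dotProduct, smul_dotProduct, smul_eq_mul] at k1 k2 k3 q1 q2
  obtain ⟨hu, hv, hs, ht⟩ := hreg hp
  have ky : pd₂ F (T₄ p) ⬝ᵥ x = 0 := by
    have : (4 * (p.1 - p.2) / (p.1 + p.2) ^ 2) * (pd₂ F (T₄ p) ⬝ᵥ x) = 0 := by
      linear_combination (norm := skip) k1 - k2
      field_simp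
      ring
    exact (mul_eq_zero.1 this).resolve_left
      (div_ne_zero (mul_ne_zero (by norm_num) hv) (pow_ne_zero 2 hu))
  have kx : pd₁ F (T₄ p) ⬝ᵥ x = 0 := by
    rw [ky, mul_zero, add_zero] at k1
    exact (mul_eq_zero.1 k1).resolve_left
      (div_ne_zero (neg_ne_zero.2 two_ne_zero) (pow_ne_zero 3 hu))
  have kxx : pd₁ (pd₁ F) (T₄ p) ⬝ᵥ x = 0 := by
    rw [kx, ky] at k3 q1 q2
    simp only [k0, show (T₄ p).1 = 1 / (p.1 + p.2) ^ 2 from rfl,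
      show (T₄ p).2 = (p.1 - p.2) ^ 2 / (p.1 + p.2) ^ 2 from rfl] at q1 q2
    have : (-4 * (4 * p.2 ^ 2 - 1) / ((p.1 + p.2) ^ 5 * (p.1 - p.2)))
        * (pd₁ (pd₁ F) (T₄ p) ⬝ᵥ x) = 0 := by
      linear_combination (norm := skip) k3 - (16 * p.2 ^ 2 / (p.1 + p.2) ^ 4) * q1
        + (16 * p.2 / ((p.1 - p.2) * (p.1 + p.2) ^ 2)) * q2
      field_simp
      ring
    refine (mul_eq_zero.1 this).resolve_left (div_ne_zero (mul_ne_zero (by norm_num) ht)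
      (mul_ne_zero (pow_ne_zero 5 hu) hv))
  intro i
  fin_cases i <;> simp [frameF₄, k0, kx, ky, kxx]

theorem isConjugateSystem_F₄ (hV : IsOpen V) (hF : ContDiffOn 𝕜 ∞ F V)
    (hS : SolvesAppellF₄ α β γ₁ γ₂ V F) (hU : IsOpen U) (hUV : Set.MapsTo T₄ U V)
    (hreg : U ⊆ regularST₄ 𝕜)
    (hi : ∀ p ∈ V, LinearIndependent 𝕜 (fun i => frameF₄ γ₁ F i p)) :
    IsConjugateSystem U (fun p => F (T₄ p)) (coeffsF₄ α β γ₁ γ₂) := by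
  have hu : ∀ p ∈ U, p.1 + p.2 ≠ 0 := fun p hp => (hreg hp).1
  have hu2 : ∀ p ∈ U, (p.1 + p.2) ^ 2 ≠ 0 := fun p hp => pow_ne_zero 2 (hu p hp)
  have hv : ∀ p ∈ U, p.1 - p.2 ≠ 0 := fun p hp => (hreg hp).2.1
  have hs : ∀ p ∈ U, 4 * p.1 ^ 2 - 1 ≠ 0 := fun p hp => (hreg hp).2.2.1
  have ht : ∀ p ∈ U, 4 * p.2 ^ 2 - 1 ≠ 0 := fun p hp => (hreg hp).2.2.2
  refine ⟨?_, ?_, ?_, ?_, ?_, ?_, ?_, fun p hp => div_ne_zero (hs p hp) (ht p hp),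
    fun p hp => frame_comp_T₄ hV hF hS hU hUV hreg hp (hi _ (hUV hp)),
    fun p hp => (conjugate_equations_F₄ hV hF hS hU hUV hreg hp).1,
    fun p hp => (conjugate_equations_F₄ hV hF hS hU hUV hreg hp).2⟩
  all_goals simp only [coeffsF₄]; fun_prop (disch := assumption)

end ConjugateF₄

/-! ### The surface S_{F₄}: Laplace invariants and conclusion. -/

section SurfaceF₄

variable {𝕜 : Type*} [RCLike 𝕜] {α β γ₁ γ₂ : 𝕜} {U V : Set (𝕜 × 𝕜)}
  {F : 𝕜 × 𝕜 → (Fin 4 → 𝕜)}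

theorem h_F₄ {p : 𝕜 × 𝕜} (hp : p ∈ regularST₄ 𝕜) :
    (coeffsF₄ α β γ₁ γ₂).h p = ((α - β) ^ 2 - 1 / 4) / (p.1 + p.2) ^ 2
      + (1 / 4 - (γ₂ - 1) ^ 2) / (p.1 - p.2) ^ 2 := by
  obtain ⟨hu, hv, -, -⟩ := hp
  have d := ((HasPD.const ((1 - 2 * (α + β)) / 2)).div (HasPD.x.add HasPD.y) hu).sub
    ((HasPD.const ((2 * γ₂ - 1) / 2)).div (HasPD.x.sub HasPD.y) hv)
  rw [ConjugateCoeffs.h, show pd₁ (coeffsF₄ α β γ₁ γ₂).a p = _ from d.fst]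
  simp only [coeffsF₄]
  field_simp
  ring

theorem k_F₄ {p : 𝕜 × 𝕜} (hp : p ∈ regularST₄ 𝕜) :
    (coeffsF₄ α β γ₁ γ₂).k p = ((α - β) ^ 2 - 1 / 4) / (p.1 + p.2) ^ 2
      + (1 / 4 - (γ₂ - 1) ^ 2) / (p.1 - p.2) ^ 2 := by
  obtain ⟨hu, hv, -, -⟩ := hp
  have d := ((HasPD.const ((1 - 2 * (α + β)) / 2)).div (HasPD.x.add HasPD.y) hu).add
    ((HasPD.const ((2 * γ₂ - 1) / 2)).div (HasPD.x.sub HasPD.y) hv)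
  rw [ConjugateCoeffs.k, show pd₂ (coeffsF₄ α β γ₁ γ₂).b p = _ from d.snd]
  simp only [coeffsF₄]
  field_simp
  ring

/-- The parameter is u = s + t with s - t fixed, so an identity rational in u and v becomes a
polynomial identity in u. -/
theorem infinite_antidiagonal_slice (hU : IsOpen U) {p : 𝕜 × 𝕜} (hp : p ∈ U) :
    {u : 𝕜 | ((u + (p.1 - p.2)) / 2, (u - (p.1 - p.2)) / 2) ∈ U}.Infinite := by
  have hc : Continuous fun u : 𝕜 => ((u + (p.1 - p.2)) / 2, (u - (p.1 - p.2)) / 2) := by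
    fun_prop
  refine infinite_of_mem_nhds (p.1 + p.2) (hc.continuousAt.preimage_mem_nhds (hU.mem_nhds ?_))
  convert hp using 1
  ext <;> simp

open Polynomial in
theorem eq_zero_of_infinite_sextic {P R c : 𝕜} (hc : c ≠ 0) {S : Set 𝕜} (hS : S.Infinite)
    (h : ∀ u ∈ S, R ^ 2 * u ^ 6 + 3 * P * R * c * u ^ 4 - 3 * P * R * c ^ 2 * u ^ 2
      - P ^ 2 * c ^ 3 = 0) : P = 0 ∧ R = 0 := by
  have h0 : (C (R ^ 2) * X ^ 6 + C (3 * P * R * c) * X ^ 4 - C (3 * P * R * c ^ 2) * X ^ 2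
      - C (P ^ 2 * c ^ 3) : 𝕜[X]) = 0 := by
    refine Polynomial.eq_zero_of_infinite_isRoot _ (hS.mono fun u hu => ?_)
    simpa [IsRoot.def] using h u hu
  -- The extreme coefficients R² and -P²c³ already decide.
  have e6 := congrArg (coeff · 6) h0
  have e0 := congrArg (coeff · 0) h0
  simp only [coeff_sub, coeff_add, coeff_C_mul, coeff_X_pow, coeff_C] at e6 e0
  simp [hc] at e6 e0
  exact ⟨e0, e6⟩

/-- A function `P / (s + t)² + R / (s - t)²` with vanishing mixed logarithmic derivative is
zero. -/
theorem eq_zero_of_log_sum_inv_sq (hU : IsOpen U) (hreg : U ⊆ regularST₄ 𝕜) {φ : 𝕜 × 𝕜 → 𝕜}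
    {P R : 𝕜} (hφ : ∀ p ∈ U, φ p = P / (p.1 + p.2) ^ 2 + R / (p.1 - p.2) ^ 2)
    (h : ∀ p ∈ U, φ p ≠ 0 → pd₂ (pd₁ φ) p * φ p = pd₁ φ p * pd₂ φ p) {p : 𝕜 × 𝕜} (hp : p ∈ U) :
    φ p = 0 := by
  have e1 : ∀ p ∈ U, HasPD (1, 0) (0, 1) φ p (-2 * P / (p.1 + p.2) ^ 3 - 2 * R / (p.1 - p.2) ^ 3)
      (-2 * P / (p.1 + p.2) ^ 3 + 2 * R / (p.1 - p.2) ^ 3) := fun p hp => by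
    obtain ⟨hu, hv, -, -⟩ := hreg hp
    have du := (HasPD.x (𝕜 := 𝕜) (p := p)).add .y
    have dv := (HasPD.x (𝕜 := 𝕜) (p := p)).sub .y
    refine ((((HasPD.const P).div (du.mul du) (mul_ne_zero hu hu)).add
      ((HasPD.const R).div (dv.mul dv) (mul_ne_zero hv hv))).congr_fun hU hp
      fun p hp => ?_).congr ?_ ?_
    · rw [hφ p hp, sq, sq]
    all_goals field_simp; ring
  have e2 : ∀ p ∈ U, pd₂ (pd₁ φ) p = 6 * P / (p.1 + p.2) ^ 4 - 6 * R / (p.1 - p.2) ^ 4 :=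
      fun p hp => by
    obtain ⟨hu, hv, -, -⟩ := hreg hp
    have du := (HasPD.x (𝕜 := 𝕜) (p := p)).add .y
    have dv := (HasPD.x (𝕜 := 𝕜) (p := p)).sub .y
    have := (((HasPD.const (-2 * P)).div (du.mul (du.mul du))
      (mul_ne_zero hu (mul_ne_zero hu hu))).sub ((HasPD.const (2 * R)).div (dv.mul (dv.mul dv))
      (mul_ne_zero hv (mul_ne_zero hv hv)))).congr_fun (g := pd₁ φ) hU hp fun p hp => by
        rw [show pd₁ φ p = _ from (e1 p hp).fst]; ring_nf
    refine this.snd.trans ?_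
    field_simp
    ring
  have hφc : ContinuousOn φ U := fun p hp => (e1 p hp).diff.continuousAt.continuousWithinAt
  by_contra h0
  have hW : IsOpen (U ∩ {p | φ p ≠ 0}) := hφc.isOpen_inter_preimage hU isOpen_ne
  have hv := (hreg hp).2.1
  obtain ⟨hP, hR⟩ := eq_zero_of_infinite_sextic (P := P) (R := R) (pow_ne_zero 2 hv)
    (infinite_antidiagonal_slice hW ⟨hp, h0⟩) fun u hu => by
      have e := h _ hu.1 hu.2
      obtain ⟨hu', hv', -, -⟩ := hreg hu.1
      rw [e2 _ hu.1, show pd₁ φ _ = _ from (e1 _ hu.1).fst, show pd₂ φ _ = _ from (e1 _ hu.1).snd,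
        hφ _ hu.1] at e
      simp only at e hu' hv'
      have h1 : (u + (p.1 - p.2)) / 2 + (u - (p.1 - p.2)) / 2 = u := by ring
      have h2 : (u + (p.1 - p.2)) / 2 - (u - (p.1 - p.2)) / 2 = p.1 - p.2 := by ring
      rw [h1, h2] at e
      rw [h1] at hu'
      generalize p.1 - p.2 = v at *
      field_simp at e
      -- With c = v², the sextic is -u⁶v⁶/2 times φ_st φ - φ_s φ_t.
      linear_combination -e / 2
  exact h0 (by rw [hφ p hp, hP, hR, zero_div, zero_div, add_zero])

theorem focal_F₄ {w : 𝕜 × 𝕜 → (Fin 4 → 𝕜)} (hU : IsOpen U) (hreg : U ⊆ regularST₄ 𝕜)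
    (hw : ContDiffOn 𝕜 ∞ w U) (h : IsConjugateSystem U w (coeffsF₄ α β γ₁ γ₂)) :
    (PosFocalQuadrics U w (coeffsF₄ α β γ₁ γ₂) →
      ∀ p ∈ U, (coeffsF₄ α β γ₁ γ₂).h p = 0) ∧
    (NegFocalQuadrics U w (coeffsF₄ α β γ₁ γ₂) →
      ∀ p ∈ U, (coeffsF₄ α β γ₁ γ₂).k p = 0) := by
  have hs : ∀ p ∈ U, 4 * p.1 ^ 2 - 1 ≠ 0 := fun p hp => (hreg hp).2.2.1
  have ht : ∀ p ∈ U, 4 * p.2 ^ 2 - 1 ≠ 0 := fun p hp => (hreg hp).2.2.2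
  have hsq : ∀ x : 𝕜, 4 * x ^ 2 - 1 = 4 * (x * x) - 1 := fun x => by ring
  have hq : ∀ p ∈ U, HasPD (1, 0) (0, 1) (coeffsF₄ α β γ₁ γ₂).q p
      (8 * p.1 / (4 * p.2 ^ 2 - 1))
      (-(4 * p.1 ^ 2 - 1) * (8 * p.2) / (4 * p.2 ^ 2 - 1) ^ 2) := fun p hp => by
    have h2 : 4 * (p.2 * p.2) - 1 ≠ 0 := by rw [← hsq]; exact ht p hp
    have h2' : p.2 ^ 2 * 4 - 1 ≠ 0 := by rw [mul_comm]; exact ht p hp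
    have h2'' := ht p hp
    simp only [coeffsF₄, hsq]
    refine ((((HasPD.const 4).mul (HasPD.x.mul .x)).sub (HasPD.const 1)).div
      (((HasPD.const 4).mul (HasPD.y.mul .y)).sub (HasPD.const 1)) h2).congr ?_ ?_ <;>
    field_simp <;> ring
  have key := fun (p : 𝕜 × 𝕜) (hp : p ∈ U) => h.focal_log hU hw
    (μ := fun p => 8 * p.1 / (4 * p.1 ^ 2 - 1))
    (ν := fun p => -8 * p.2 / (4 * p.2 ^ 2 - 1))
    (by fun_prop (disch := assumption)) (by fun_prop (disch := assumption))
    (fun p hp => by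
      rw [show pd₁ _ p = _ from (hq p hp).fst]
      have h1 : p.1 ^ 2 * 4 - 1 ≠ 0 := by rw [mul_comm]; exact hs p hp
      have h2 := ht p hp
      simp only [coeffsF₄]; field_simp)
    (fun p hp => by
      rw [show pd₂ _ p = _ from (hq p hp).snd]
      have h2 := ht p hp
      simp only [coeffsF₄]; field_simp)
    (fun p hp => by
      have h1 := hs p hp
      simp only [hsq] at h1 ⊢
      have := (((HasPD.const (8 : 𝕜)).mul .x).div
        (((HasPD.const 4).mul (HasPD.x.mul .x)).sub (HasPD.const 1)) h1).snd
      exact this.trans (by simp))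
    (fun p hp => by
      have h2 := ht p hp
      simp only [hsq] at h2 ⊢
      have := (((HasPD.const (-8 : 𝕜)).mul .y).div
        (((HasPD.const 4).mul (HasPD.y.mul .y)).sub (HasPD.const 1)) h2).fst
      exact this.trans (by simp)) hp
  exact ⟨fun hQ p hp => eq_zero_of_log_sum_inv_sq hU hreg (fun p hp => h_F₄ (hreg hp))
      (fun p hp => (key p hp).1 hQ) hp,
    fun hQ p hp => eq_zero_of_log_sum_inv_sq hU hreg (fun p hp => k_F₄ (hreg hp))
      (fun p hp => (key p hp).2 hQ) hp⟩

/-- The total system is used on `V` in the variables (x, y), so the non-injective map `T₄` never has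
to be inverted; the conjugate frame at a point of `U` is compared with the frame at its image. -/
theorem surfaceF₄_assertions (h : IsSurfaceF₄ α β γ₁ γ₂ V F) :
    (IsQuadricOn V F ↔ γ₂ = α + β - γ₁ + 1) ∧
    ∀ (U : Set (𝕜 × 𝕜)) (z : 𝕜 × 𝕜 → (Fin 4 → 𝕜)), IsGaugedPullback T₄ V F U z →
      (∃ C, IsConjugateSystem U z C) ∧
      ∀ C, IsConjugateSystem U z C →
        (PosFocalQuadrics U z C → ∀ p ∈ U, C.h p = 0) ∧
        (NegFocalQuadrics U z C → ∀ p ∈ U, C.k p = 0) := by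
  obtain ⟨⟨hV, hVc, hVr, hF, hi⟩, hS⟩ := h
  have htot := isTotalSystem_F₄ hV hVr hF hS
  have hli := fun (p : 𝕜 × 𝕜) (hp : p ∈ V) =>
    htot.linearIndependent hV hVc.isPreconnected hi hp
  obtain ⟨p₀, hp₀⟩ := hVc.nonempty
  refine ⟨⟨fun hq => params_of_quadric_F₄ hV hVr htot hp₀ (hli _ hp₀) hq, fun hγ => ?_⟩,
    fun U z hz => ?_⟩
  · refine htot.isQuadricOn hV hVc.isPreconnected hp₀ (hli _ hp₀)
      (metric₄ (α * β) γ₁ γ₂) _ _ (symm_adapted _ _ _ _ _ _)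
      (by
        rw [metric₄, det_adapted]
        have hD := (hVr hp₀).2.2
        intro h0
        -- The determinant is (1 - x - y)²/4 - xy, a quarter of the discriminant.
        exact hD (by linear_combination 4 * h0))
      (fun _ _ => rfl) (fun _ _ => rfl)
      (fun p hp i j => hasPD_metric₄ hγ (hVr hp) i j)
  · obtain ⟨hUo, -, hUm, f, hf, hf0, hfz⟩ := hz
    have hUr : U ⊆ regularST₄ 𝕜 := fun p hp => mem_regularST₄ (hVr (hUm hp))
    have hws : ContDiffOn 𝕜 ∞ (fun p => F (T₄ p)) U := hF.comp (smooth_T₄ hUr) hUm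
    have hsys := isConjugateSystem_F₄ hV hF hS hUo hUm hUr hli
    have hfoc := focal_F₄ hUo hUr hws hsys
    exact conjugate_assertions_of_gauge hsys hUo hws hf hf0 hfz hfoc.1 hfoc.2

end SurfaceF₄

end HypergeometricCongruence

theorem mainTheorem11 {𝕜 : Type*} [RCLike 𝕜] :
    (∀ (α β₁ β₂ γ₁ γ₂ : 𝕜) (V : Set (𝕜 × 𝕜)) (F : 𝕜 × 𝕜 → (Fin 4 → 𝕜)),
      IsSurfaceF₂ α β₁ β₂ γ₁ γ₂ V F →
        (IsQuadricOn V F ↔ α = β₁ + β₂ - 1 / 2 ∧ γ₁ = 2 * β₁ ∧ γ₂ = 2 * β₂) ∧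
        ∀ (U : Set (𝕜 × 𝕜)) (z : 𝕜 × 𝕜 → (Fin 4 → 𝕜)), IsGaugedPullback T₂ V F U z →
          (∃ C, IsConjugateSystem U z C) ∧
          ∀ C, IsConjugateSystem U z C →
            (PosFocalQuadrics U z C → ∀ p ∈ U, C.h p = 0) ∧
            (NegFocalQuadrics U z C → ∀ p ∈ U, C.k p = 0)) ∧
    (∀ (α β γ₁ γ₂ : 𝕜) (V : Set (𝕜 × 𝕜)) (F : 𝕜 × 𝕜 → (Fin 4 → 𝕜)),
      IsSurfaceF₄ α β γ₁ γ₂ V F →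
        (IsQuadricOn V F ↔ γ₂ = α + β - γ₁ + 1) ∧
        ∀ (U : Set (𝕜 × 𝕜)) (z : 𝕜 × 𝕜 → (Fin 4 → 𝕜)), IsGaugedPullback T₄ V F U z →
          (∃ C, IsConjugateSystem U z C) ∧
          ∀ C, IsConjugateSystem U z C →
            (PosFocalQuadrics U z C → ∀ p ∈ U, C.h p = 0) ∧
            (NegFocalQuadrics U z C → ∀ p ∈ U, C.k p = 0)) :=
  ⟨fun _ _ _ _ _ _ _ h => surfaceF₂_assertions h, fun _ _ _ _ _ _ h => surfaceF₄_assertions h⟩
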